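/- Let $q_1=0$ and let $q_2,\dots,q_5=(\pm\tfrac{\sqrt2}{2},\pm\tfrac{\sqrt2}{2})$ be the corners of the square in the plane $\mathbb{R}^2=\mathbb{C}$ centred at $0$, let $\psi_i(z)=\frac13(z-q_i)+q_i$, let $K$ be the Vicsek set, i.e. the unique non-empty compact set with $K=\bigcup_{i=1}^5\psi_i(K)$, and let $X=\bigcup_{m\ge1}3^mK$ be the unbounded Vicsek set. Let $\mu$ be the normalized Hausdorff measure on $X$, i.e. the measure with $\mu(3^m\psi_{i_1}\circ\cdots\circ\psi_{i_n}(K))=5^{m-n}$ for all $m,n\ge0$ and $i_1,\dots,i_n\in\{1,\dots,5\}$. For $n\ge0$ let $\bar V_n$ be the infinite cable system whose edges are the segments $3^{m-n}\psi_{i_1}\circ\cdots\circ\psi_{i_m}([q_1,q_j])$, $m\ge1$, $2\le j\le5$ (all of length $3^{-n}$); its vertices are the end points of the edges. Let $\mathcal S=\bigcup_{n\ge0}\bar V_n$ be the skeleton of $X$ and $\nu$ the length measure on $\mathcal S$. For vertices $u,v$ joined by an edge $\mathbf e(u,v)$ of $\bar V_n$, write $u\le v$ if $u$ is closer than $v$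 to $0$ in the geodesic distance of $\bar V_n$. A function $f\in C(X)$ has the weak gradient $\partial f$ if $\partial f$ is a measurable function on $\mathcal S$, $\nu$-integrable on every edge, such that $f(v)-f(u)=\int_{\mathbf e(u,v)}\partial f\,d\nu$ for all $n\ge0$ and all adjacent vertices $u\le v$ of $\bar V_n$. Let $W^{1,2}(X)$ be the space of all $f\in C(X)\cap L^2(X,\mu)$ (real-valued) with a weak gradient $\partial f\in L^2(\mathcal S,\nu)$, and regard $\partial$ as an unbounded operator from $L^2(X,\mu)$ to $L^2(\mathcal S,\nu)$ with domain $W^{1,2}(X)$; let $\partial^*$ be its adjoint. Let $\Delta$ be the generator of the form $\mathcal E(f,g)=\int_{\mathcal S}\partial f\,\partial g\,d\nu$ with domain $W^{1,2}(X)$: $f\in\operatorname{dom}\Delta$ and $\Delta f=h\in L^2(X,\mu)$ if and only if $f\in W^{1,2}(X)$ and $\mathcal E(f,g)=-\int_X g\,h\,d\mu$ for all $g\in W^{1,2}(X)$. Let $\vec\Delta=-\partial\partial^*$, with domain $\{\eta\in\operatorname{dom}\partial^*:\partial^*\eta\in W^{1,2}(X)\}$. **Theorem.** There is exactly one strongly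 continuous semigroup $(P_t)_{t\ge0}$ of bounded operators on $L^2(X,\mu)$ with generator $\Delta$ (the heat semigroup $e^{t\Delta}$), and exactly one strongly continuous semigroup $(\vec P_t)_{t\ge0}$ of bounded operators on $L^2(\mathcal S,\nu)$ with generator $\vec\Delta$ (the Hodge semigroup $e^{t\vec\Delta}$). For every $f\in W^{1,2}(X)$ and every $t\ge0$ one has $P_tf\in W^{1,2}(X)$ and $$\partial P_tf=\vec P_t\,\partial f .$$ -/

import Mathlib

open MeasureTheory Filter Topology
open scoped NNReal ENNReal Pointwise LinearPMap

noncomputable section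

namespace Vicsek

/-! ### The unbounded Vicsek set and its self-similar measure -/

/-- The center `0` and the four corners of the square (each at distance `1` from the center). -/
def q : Fin 5 → ℂ :=
  ![0, ⟨-(√2 / 2), √2 / 2⟩, ⟨√2 / 2, √2 / 2⟩, ⟨√2 / 2, -(√2 / 2)⟩, ⟨-(√2 / 2), -(√2 / 2)⟩]

/-- The contractions `ψ i` of ratio `1/3` fixing `q i`. -/
def ψ (i : Fin 5) (z : ℂ) : ℂ := (1 / 3 : ℂ) * (z - q i) + q i

/-- The coding map: the point `lim ψ (w 0) ∘ ⋯ ∘ ψ (w n) (0)` of the infinite word `w`. -/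
def coding (w : ℕ → Fin 5) : ℂ := ∑' k, (1 / 3 : ℂ) ^ k * ((2 / 3 : ℂ) * q (w k))

/-- The bounded Vicsek set `K`, the unique non-empty compact set with `K = ⋃ i, ψ i '' K`. -/
def K : Set ℂ := Set.range coding

theorem norm_q_le (i : Fin 5) : ‖q i‖ ≤ 1 := by
  have h2 : √2 * √2 = 2 := Real.mul_self_sqrt (by norm_num)
  rw [Complex.norm_def, Real.sqrt_le_one, Complex.normSq_apply]
  fin_cases i <;> simp [q] <;> nlinarith

theorem norm_coding_term_le (w : ℕ → Fin 5) (k : ℕ) :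
    ‖(1 / 3 : ℂ) ^ k * ((2 / 3 : ℂ) * q (w k))‖ ≤ (1 / 3 : ℝ) ^ k := by
  have h := norm_q_le (w k)
  have h3 : (0 : ℝ) < (1 / 3) ^ k := by positivity
  rw [norm_mul, norm_mul, norm_pow]
  norm_num only [norm_div, norm_one, Complex.norm_ofNat] at h3 ⊢
  nlinarith [norm_nonneg (q (w k))]

theorem summable_bound : Summable fun k : ℕ => (1 / 3 : ℝ) ^ k :=
  summable_geometric_of_lt_one (by norm_num) (by norm_num)

theorem continuous_coding : Continuous coding := by
  refine continuous_tsum (fun k => ?_) summable_bound fun k w => norm_coding_term_le w k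
  have : Continuous q := continuous_of_discreteTopology
  fun_prop

theorem coding_eq (w : ℕ → Fin 5) : coding w = ψ (w 0) (coding fun k => w (k + 1)) := by
  have hs : Summable fun k => (1 / 3 : ℂ) ^ k * ((2 / 3 : ℂ) * q (w k)) :=
    Summable.of_norm_bounded summable_bound (norm_coding_term_le w)
  simp only [coding, ψ]
  rw [hs.tsum_eq_zero_add]
  simp only [pow_succ', mul_assoc, tsum_mul_left]
  ring

theorem isCompact_K : IsCompact K := isCompact_range continuous_coding

theorem nonempty_K : K.Nonempty := Set.range_nonempty _

theorem K_eq_iUnion : K = ⋃ i, ψ i '' K := by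
  ext z
  simp only [K, Set.mem_iUnion, Set.mem_image, Set.mem_range]
  constructor
  · rintro ⟨w, rfl⟩
    exact ⟨w 0, _, ⟨fun k => w (k + 1), rfl⟩, (coding_eq w).symm⟩
  · rintro ⟨i, _, ⟨w, rfl⟩, rfl⟩
    let w' : ℕ → Fin 5 := fun k => Nat.casesOn k i w
    have h : coding w' = ψ i (coding w) := coding_eq w'
    exact ⟨w', h⟩

/-- The increasing sequence of blow-ups `3 ^ m K` of `K`. -/
def blowUp (m : ℕ) : Set ℂ := (fun z : ℂ => (3 : ℂ) ^ m * z) '' K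

/-- The unbounded Vicsek set. -/
def X : Set ℂ := ⋃ m : ℕ, blowUp m

/-- The self-similar probability measure on `K`, giving mass `5 ^ (-n)` to each of the `5 ^ n`
cells `ψ i₁ ∘ ⋯ ∘ ψ iₙ (K)`: the law of the point coded by a uniformly distributed word. -/
def μK : Measure ℂ :=
  (Measure.infinitePi fun _ : ℕ => (PMF.uniformOfFintype (Fin 5)).toMeasure).map coding

/-- The (normalized Hausdorff) measure on `X` which gives mass `5 ^ (m - n)` to each of the sets
`3 ^ m ψ i₁ ∘ ⋯ ∘ ψ iₙ (K)`: on `3 ^ m K`, hence in particular on `3 ^ m K ∖ 3 ^ (m - 1) K`, it is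
`5 ^ m` times the image of `μK` under `z ↦ 3 ^ m z`. -/
def μ : Measure ℂ :=
  Measure.sum fun m : ℕ =>
    ((5 : ℝ≥0∞) ^ m • μK.map fun z : ℂ => (3 : ℂ) ^ m * z).restrict (disjointed blowUp m)

/-! ### Cable systems, skeleton, length measure -/

/-- The edges of the cable system of level `n` inside `K`, as pairs of end points: the images under
the maps `ψ i₁ ∘ ⋯ ∘ ψ iₙ` of the four edges joining the center to the corners. -/
def edgesK : ℕ → Set (ℂ × ℂ)
  | 0 => {e | ∃ i : Fin 5, i ≠ 0 ∧ e = (q 0, q i)}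
  | n + 1 => {e | ∃ i : Fin 5, ∃ e' ∈ edgesK n, e = (ψ i e'.1, ψ i e'.2)}

/-- The edges of the infinite cable system of level `n`: the union over `m` of the (increasing)
sets of edges of level `m` inside `K`, scaled by `3 ^ (m - n)`. All of them have length
`3 ^ (-n)`. -/
def edges (n : ℕ) : Set (ℂ × ℂ) :=
  {e | ∃ m : ℕ, ∃ e' ∈ edgesK m,
    e = ((3 : ℂ) ^ ((m : ℤ) - (n : ℤ)) * e'.1, (3 : ℂ) ^ ((m : ℤ) - (n : ℤ)) * e'.2)}

/-- The infinite cable system of level `n`, as a subset of the plane. -/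
def cable (n : ℕ) : Set ℂ := ⋃ e ∈ edges n, segment ℝ e.1 e.2

/-- The skeleton of `X`. -/
def skeleton : Set ℂ := ⋃ n : ℕ, cable n

/-- The length measure on the skeleton; Hausdorff measure of dimension one agrees with Lebesgue
measure along segments, so that an edge of level `n` has mass `3 ^ (-n)`. -/
def ν : Measure ℂ := (Measure.hausdorffMeasure 1).restrict skeleton

/-- The adjacency of vertices in the infinite cable system of level `n`. -/
def graph (n : ℕ) : SimpleGraph ℂ := SimpleGraph.fromRel fun u v => (u, v) ∈ edges n

/-- The geodesic distance from the center to the vertex `u` in the cable system of level `n`,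
all of whose edges have length `3 ^ (-n)`. -/
def distCenter (n : ℕ) (u : ℂ) : ℝ := ((3 : ℝ) ^ n)⁻¹ * (graph n).dist 0 u

/-! ### Weak gradients, the gradient operator -/

/-- `g` is a weak gradient of `f`: it is measurable, integrable along every edge, and
`f v - f u = ∫ g` along every edge joining `u` to `v`, where `u` is closer to the center. -/
structure IsWeakGradient (f g : ℂ → ℝ) : Prop where
  aestronglyMeasurable : AEStronglyMeasurable g ν
  integrableOn : ∀ n u v, (graph n).Adj u v → IntegrableOn g (segment ℝ u v) ν
  sub_eq : ∀ n u v, (graph n).Adj u v → distCenter n u < distCenter n v →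
    f v - f u = ∫ x in segment ℝ u v, g x ∂ν

/-- The graph of the weak gradient on `W^{1,2}(X)`: pairs `(f, g)` in `L²(X, μ) × L²(𝒮, ν)` such
that `f` has a representative continuous on `X` with weak gradient `g`. -/
def gradGraph : Submodule ℝ (Lp ℝ 2 μ × Lp ℝ 2 ν) where
  carrier := {p | ∃ φ : ℂ → ℝ, ContinuousOn φ X ∧ φ =ᵐ[μ] p.1 ∧ IsWeakGradient φ p.2}
  zero_mem' := by
    have h0 : ((0 : Lp ℝ 2 ν) : ℂ → ℝ) =ᵐ[ν] fun _ => (0 : ℝ) := Lp.coeFn_zero _ _ _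
    refine ⟨fun _ => 0, continuousOn_const, (Lp.coeFn_zero _ _ _).symm, ?_, ?_, ?_⟩
    · exact Lp.aestronglyMeasurable _
    · intro n u v _
      exact (integrable_zero ℂ ℝ _).congr (ae_restrict_of_ae h0.symm)
    · intro n u v _ _
      change (0 : ℝ) - 0 = ∫ x in segment ℝ u v, ((0 : Lp ℝ 2 ν) : ℂ → ℝ) x ∂ν
      rw [integral_congr_ae (ae_restrict_of_ae h0)]
      simp
  add_mem' := by
    rintro ⟨f, g⟩ ⟨f', g'⟩ ⟨φ, hφ, hf, hg⟩ ⟨φ', hφ', hf', hg'⟩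
    have h := Lp.coeFn_add g g'
    refine ⟨φ + φ', hφ.add hφ', (hf.add hf').trans (Lp.coeFn_add f f').symm, ?_, ?_, ?_⟩
    · exact Lp.aestronglyMeasurable _
    · intro n u v huv
      exact ((hg.integrableOn n u v huv).add (hg'.integrableOn n u v huv)).congr
        (ae_restrict_of_ae h.symm)
    · intro n u v huv hlt
      change φ v + φ' v - (φ u + φ' u) = ∫ x in segment ℝ u v, (g + g' : Lp ℝ 2 ν) x ∂ν
      rw [integral_congr_ae (ae_restrict_of_ae h)]
      have h2 := integral_add (hg.integrableOn n u v huv) (hg'.integrableOn n u v huv)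
      simp only [Pi.add_apply] at h2 ⊢
      rw [h2, ← hg.sub_eq n u v huv hlt, ← hg'.sub_eq n u v huv hlt]
      ring
  smul_mem' := by
    rintro c ⟨f, g⟩ ⟨φ, hφ, hf, hg⟩
    have h := Lp.coeFn_smul c g
    refine ⟨c • φ, hφ.const_smul c, (hf.const_smul c).trans (Lp.coeFn_smul c f).symm, ?_, ?_, ?_⟩
    · exact Lp.aestronglyMeasurable _
    · intro n u v huv
      exact ((hg.integrableOn n u v huv).smul c).congr (ae_restrict_of_ae h.symm)
    · intro n u v huv hlt
      change c * φ v - c * φ u = ∫ x in segment ℝ u v, (c • g : Lp ℝ 2 ν) x ∂ν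
      rw [integral_congr_ae (ae_restrict_of_ae h)]
      simp only [Pi.smul_apply]
      rw [integral_smul, ← hg.sub_eq n u v huv hlt, smul_eq_mul]
      ring

/-- The weak gradient `∂` as an unbounded operator from `L²(X, μ)` to `L²(𝒮, ν)`. -/
def grad : Lp ℝ 2 μ →ₗ.[ℝ] Lp ℝ 2 ν := gradGraph.toLinearPMap

/-- The Sobolev space `W^{1,2}(X)` as a subspace of `L²(X, μ)`. -/
def W12 : Submodule ℝ (Lp ℝ 2 μ) := grad.domain

/-! ### Unbounded operators and their semigroups -/

section Operators

variable {E F : Type*} [NormedAddCommGroup E] [InnerProductSpace ℝ E]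
  [NormedAddCommGroup F] [InnerProductSpace ℝ F]

/-- The graph of the generator of the quadratic form `⟪T f, T g⟫` with domain `dom T`: the pairs
`(f, h)` with `f ∈ dom T` and `⟪T f, T g⟫ = -⟪g, h⟫` for all `g ∈ dom T`. -/
def formGeneratorGraph (T : E →ₗ.[ℝ] F) : Submodule ℝ (E × E) where
  carrier := {p | ∃ f : T.domain, (f : E) = p.1 ∧
    ∀ g : T.domain, inner ℝ (T f) (T g) = -inner ℝ (g : E) p.2}
  zero_mem' := ⟨0, by simp, by simp⟩
  add_mem' := by
    rintro ⟨a, b⟩ ⟨a', b'⟩ ⟨f, hf, h⟩ ⟨f', hf', h'⟩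
    refine ⟨f + f', by simp_all, fun g => ?_⟩
    simp only [LinearPMap.map_add, inner_add_left, Prod.snd_add, inner_add_right]
    rw [h g, h' g]
    ring
  smul_mem' := by
    rintro c ⟨a, b⟩ ⟨f, hf, h⟩
    refine ⟨c • f, by simp_all, fun g => ?_⟩
    simp only [LinearPMap.map_smul, inner_smul_left, Prod.smul_snd, inner_smul_right]
    rw [h g]
    simp

/-- The composition of unbounded operators, with domain `{x ∈ dom T | T x ∈ dom S}`. -/
def compOp {G : Type*} [NormedAddCommGroup G] [InnerProductSpace ℝ G]
    (S : F →ₗ.[ℝ] G) (T : E →ₗ.[ℝ] F) : E →ₗ.[ℝ] G :=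
  S.comp (T.domRestrict ((S.domain.comap T.toFun).map T.domain.subtype)) (by
    rintro ⟨x, hx⟩
    obtain ⟨y, hy, hyx⟩ := (Submodule.mem_inf.mp hx).1
    have : (T.domRestrict ((S.domain.comap T.toFun).map T.domain.subtype)) ⟨x, hx⟩ = T y :=
      LinearPMap.domRestrict_apply (by simpa using hyx.symm)
    rw [this]
    exact hy)

/-- `P` is a strongly continuous semigroup of bounded operators with infinitesimal generator `A`
(the domain of `A` being exactly the set of `x` for which `(P t x - x) / t` converges as
`t → 0⁺`). -/
structure IsSemigroupGeneratedBy (A : E →ₗ.[ℝ] E) (P : ℝ≥0 → E →L[ℝ] E) : Prop where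
  map_zero : P 0 = 1
  map_add : ∀ s t, P (s + t) = P s * P t
  continuous : ∀ x, Continuous fun t => P t x
  generator : ∀ x y, (x, y) ∈ A.graph ↔
    Tendsto (fun t : ℝ≥0 => (t : ℝ)⁻¹ • (P t x - x)) (𝓝[>] 0) (𝓝 y)

/-- The semigroup `e^{tA}` generated by `A` (an arbitrary value if `A` generates none). -/
def semigroup (A : E →ₗ.[ℝ] E) : ℝ≥0 → E →L[ℝ] E :=
  Classical.epsilon (IsSemigroupGeneratedBy A)

end Operators

/-- The Laplacian `Δ`: the generator in `L²(X, μ)` of the Dirichlet form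
`𝓔(f, g) = ∫ ∂f ∂g dν` with domain `W^{1,2}(X)`. -/
def laplacian : Lp ℝ 2 μ →ₗ.[ℝ] Lp ℝ 2 μ := (formGeneratorGraph grad).toLinearPMap

/-- The Hodge Laplacian `-∂∂*` in `L²(𝒮, ν)`. -/
def hodgeLaplacian : Lp ℝ 2 ν →ₗ.[ℝ] Lp ℝ 2 ν := -compOp grad grad†

/-- The heat semigroup `P_t = e^{tΔ}`. -/
def heatSemigroup : ℝ≥0 → Lp ℝ 2 μ →L[ℝ] Lp ℝ 2 μ := semigroup laplacian

/-- The Hodge semigroup generated by `-∂∂*`. -/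
def hodgeSemigroup : ℝ≥0 → Lp ℝ 2 ν →L[ℝ] Lp ℝ 2 ν := semigroup hodgeLaplacian

end Vicsek

end

/-! The theorem is a fact about any closed, densely defined operator `T` between Hilbert spaces,
here `T = ∂`. Solving the resolvent equation of `-T*T` or of `-TT*` amounts to projecting `(x, 0)`
or `(0, y)` orthogonally onto the graph of a multiple of `T`. Hence both operators are maximal
dissipative, and by the Hille–Yosida theorem each generates exactly one semigroup, `P` and `Q`.

The formal identity `T(-T*T) = (-TT*)T` is made rigorous with the resolvent `R` of `-T*T` at `1`.
The operator `S = TR` is bounded and carries solutions of `u' = -T*T u` to solutions of `v' = -TT*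
v`, so that `T P_t R = Q_t T R` by uniqueness. The pairs `(R a, T R a)` are dense in the graph of
`T`, and closedness extends the identity to all of `dom T` (`mem_graph_semigroup_apply`).

It remains to see that `∂` is single-valued, closed and densely defined. All cable systems are
copies of one graph on `ℤ²`, in which refinement is multiplication by `3`. Single-valued: `μ`
charges every open set meeting `X`, so a function vanishing almost everywhere has vanishing
continuous representative on `X`. Its gradient then has integral zero over every triadic piece of
every edge (`gradGraph_snd_eq_zero`). Closed: by Cauchy–Schwarz a function varies by at most `3 ^
(-n / 2) ‖∂f‖` along an edge of level `n`. Chaining through nested cells bounds it on each `3 ^ m K`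
by its graph norm, so limits in the graph norm are locally uniform (`exists_abs_le`,
`isClosed_gradGraph`). Dense: a compactly supported continuous function is uniformly close to the
function that interpolates its values at the vertices of level `N` affinely and is constant on all
finer branches. The gradient of the latter is a finite step function (`isWeakGradient_extend`,
`dense_grad_domain`). -/

noncomputable section

namespace Vicsek

/-! ### Resolvents of maximal dissipative operators and exponentials of bounded ones -/

section Generation

variable {E : Type*} [NormedAddCommGroup E] [InnerProductSpace ℝ E]

/-- An unbounded operator `A` on a Hilbert space is maximal dissipative if `⟪A x, x⟫ ≤ 0` for all
`x ∈ dom A` and `l - A` is onto for all `l > 0`. -/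
structure IsMaxDissipative (A : E →ₗ.[ℝ] E) : Prop where
  inner_nonpos : ∀ x y, (x, y) ∈ A.graph → inner ℝ y x ≤ 0
  surj : ∀ l : ℝ, 0 < l → ∀ z, ∃ x y, (x, y) ∈ A.graph ∧ l • x - y = z

namespace IsMaxDissipative

variable {A : E →ₗ.[ℝ] E}

/-- Dissipativity gives `l ‖x‖² ≤ ⟪l x - y, x⟫`, and Cauchy–Schwarz turns this into injectivity of
`l - A` and the bound `1 / l` for its inverse. -/
theorem norm_le (hA : IsMaxDissipative A) {l : ℝ} {x y : E} (h : (x, y) ∈ A.graph) :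
    l * ‖x‖ ≤ ‖l • x - y‖ := by
  have h1 := hA.inner_nonpos x y h
  have h2 : inner ℝ (l • x - y) x ≤ ‖l • x - y‖ * ‖x‖ := real_inner_le_norm _ _
  rw [inner_sub_left, real_inner_smul_left, real_inner_self_eq_norm_sq] at h2
  rcases (norm_nonneg x).eq_or_lt with h0 | h0
  · rw [← h0]; simp
  · nlinarith

theorem resolvent_unique (hA : IsMaxDissipative A) {l : ℝ} (hl : 0 < l) {x y x' y' : E}
    (h : (x, y) ∈ A.graph) (h' : (x', y') ∈ A.graph) (e : l • x - y = l • x' - y') : x = x' := by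
  have h1 := hA.norm_le (l := l) (A.graph.sub_mem h h')
  have h2 : l • (x - x') - (y - y') = 0 := by
    rw [smul_sub, ← sub_eq_zero.mpr e]; abel
  simp only [h2, norm_zero] at h1
  have : ‖x - x'‖ ≤ 0 := by
    by_contra h3
    push Not at h3
    have := mul_pos hl h3
    linarith
  exact sub_eq_zero.mp (norm_le_zero_iff.mp this)

theorem exists_resolvent (hA : IsMaxDissipative A) {l : ℝ} (hl : 0 < l) :
    ∃ R : E →L[ℝ] E, (∀ z, (R z, l • R z - z) ∈ A.graph) ∧ ∀ z, l * ‖R z‖ ≤ ‖z‖ := by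
  choose r s hrs he using hA.surj l hl
  have key : ∀ {x y}, (x, y) ∈ A.graph → r (l • x - y) = x := fun h =>
    hA.resolvent_unique hl (hrs _) h (he _)
  have hs : ∀ z, s z = l • r z - z := fun z => by
    have := he z
    rw [eq_sub_iff_add_eq, ← sub_eq_iff_eq_add'.mp this]
  have hadd : ∀ a b, r (a + b) = r a + r b := fun a b => by
    have := key (A.graph.add_mem (hrs a) (hrs b))
    rw [← this]
    congr 1
    conv_lhs => rw [← he a, ← he b]
    simp only [smul_add]
    abel
  have hsm : ∀ (c : ℝ) a, r (c • a) = c • r a := fun c a => by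
    have := key (A.graph.smul_mem c (hrs a))
    rw [← this]
    congr 1
    conv_lhs => rw [← he a]
    simp only [smul_sub, smul_comm c l]
  have hb : ∀ z, l * ‖r z‖ ≤ ‖z‖ := fun z => by
    have := hA.norm_le (l := l) (hrs z)
    rwa [he] at this
  refine ⟨LinearMap.mkContinuous ⟨⟨r, hadd⟩, hsm⟩ l⁻¹ fun z => ?_, fun z => ?_, fun z => ?_⟩
  · rw [inv_mul_eq_div, le_div_iff₀' hl]; exact hb z
  · change (r z, l • r z - z) ∈ A.graph
    rw [← hs]; exact hrs z
  · exact hb z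

/-- Let `z` be orthogonal to `dom A` and write `z = x - A x`. Then `0 = ⟪x, x - A x⟫ ≥ ‖x‖²`, so `x
= 0` and `z = 0`. -/
theorem dense [CompleteSpace E] (hA : IsMaxDissipative A) :
    Dense (A.domain : Set E) := by
  rw [Submodule.dense_iff_topologicalClosure_eq_top, Submodule.topologicalClosure_eq_top_iff,
    Submodule.eq_bot_iff]
  intro z hz
  obtain ⟨x, y, hxy, e⟩ := hA.surj 1 one_pos z
  have h0 : inner ℝ x z = 0 := (Submodule.mem_orthogonal _ _).mp hz x (A.mem_domain_of_mem_graph hxy)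
  have h1 := hA.inner_nonpos x y hxy
  rw [← e, one_smul, inner_sub_right, real_inner_self_eq_norm_sq, real_inner_comm] at h0
  have hx : x = 0 := by
    have : ‖x‖ ^ 2 ≤ 0 := by linarith
    have := pow_eq_zero_iff (two_ne_zero) |>.mp (le_antisymm this (sq_nonneg _))
    simpa using this
  have hy : y = 0 := A.graph_fst_eq_zero_snd hxy hx
  rw [← e, hx, hy]; simp


end IsMaxDissipative

section BoundedExp

variable [CompleteSpace E]

theorem hasDerivAt_exp_smul_apply (B : E →L[ℝ] E) (x : E) (t : ℝ) :
    HasDerivAt (fun s : ℝ => NormedSpace.exp (s • B) x) (NormedSpace.exp (t • B) (B x)) t := by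
  have h := hasDerivAt_exp_smul_const (𝕂 := ℝ) B t
  simpa using h.clm_apply (hasDerivAt_const t x)

/-- The squared norm of `exp (s B) x` has derivative `2 ⟪B u, u⟫ ≤ 0` with `u = exp (s B) x`. -/
theorem norm_exp_smul_apply_le {B : E →L[ℝ] E} (hB : ∀ x, inner ℝ (B x) x ≤ 0) {t : ℝ}
    (ht : 0 ≤ t) (x : E) : ‖NormedSpace.exp (t • B) x‖ ≤ ‖x‖ := by
  have hd : ∀ s : ℝ, HasDerivAt (fun s : ℝ => ‖NormedSpace.exp (s • B) x‖ ^ 2)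
      (2 * inner ℝ (NormedSpace.exp (s • B) x) (NormedSpace.exp (s • B) (B x))) s := fun s =>
    (hasDerivAt_exp_smul_apply B x s).norm_sq
  have hc : ∀ s : ℝ, NormedSpace.exp (s • B) (B x) = B (NormedSpace.exp (s • B) x) := fun s => by
    have h : Commute (s • B) B := (Commute.refl B).smul_left s
    exact DFunLike.congr_fun (h.exp_left).eq x
  have ha : Antitone fun s : ℝ => ‖NormedSpace.exp (s • B) x‖ ^ 2 :=
    antitone_of_deriv_nonpos (fun s => (hd s).differentiableAt) fun s => by
      rw [(hd s).deriv, hc, real_inner_comm]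
      have := hB (NormedSpace.exp (s • B) x)
      linarith
  have := ha ht
  simp only [zero_smul, NormedSpace.exp_zero, one_apply_eq_self] at this
  exact le_of_sq_le_sq this (norm_nonneg x)

theorem exp_add_smul (B : E →L[ℝ] E) (s t : ℝ) :
    NormedSpace.exp ((s + t) • B) = NormedSpace.exp (s • B) * NormedSpace.exp (t • B) := by
  let _ : NormedAlgebra ℚ (E →L[ℝ] E) := NormedAlgebra.restrictScalars ℚ ℝ _
  rw [add_smul]
  exact NormedSpace.exp_add_of_commute (((Commute.refl B).smul_left s).smul_right t)

/-- Interpolate by `s ↦ exp (s B) exp ((t - s) C) x`. As `B` and `C` commute, its derivative is a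
product of contractions applied to `B x - C x`. -/
theorem norm_exp_smul_sub_exp_smul_le {B C : E →L[ℝ] E} (hB : ∀ x, inner ℝ (B x) x ≤ 0)
    (hC : ∀ x, inner ℝ (C x) x ≤ 0) (hBC : Commute B C) {t : ℝ} (ht : 0 ≤ t) (x : E) :
    ‖NormedSpace.exp (t • B) x - NormedSpace.exp (t • C) x‖ ≤ t * ‖B x - C x‖ := by
  let f : ℝ → E := fun s => NormedSpace.exp (s • B) (NormedSpace.exp ((t - s) • C) x)
  have hd : ∀ s, HasDerivAt f
      (NormedSpace.exp (s • B) (NormedSpace.exp ((t - s) • C) (B x - C x))) s := fun s => by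
    have h1 := hasDerivAt_exp_smul_const (𝕂 := ℝ) B s
    have h2 : HasDerivAt (fun s : ℝ => NormedSpace.exp ((t - s) • C) x)
        (-(NormedSpace.exp ((t - s) • C) (C x))) s := by
      have := (hasDerivAt_exp_smul_apply C x (t - s)).scomp s ((hasDerivAt_id s).const_sub t)
      simpa [Function.comp_def] using this
    convert! h1.clm_apply h2 using 1
    have hc : Commute ((t - s) • C) B := hBC.symm.smul_left _
    have := DFunLike.congr_fun (hc.exp_left).eq x
    simp only [mul_apply_eq_comp] at this ⊢
    rw [← this, map_neg, map_sub, map_sub, sub_eq_add_neg]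
  have := norm_image_sub_le_of_norm_deriv_le_segment' (f := f) (a := 0) (b := t)
    (C := ‖B x - C x‖) (fun s _ => (hd s).hasDerivWithinAt) (fun s hs =>
      (norm_exp_smul_apply_le hB hs.1 _).trans (norm_exp_smul_apply_le hC (by linarith [hs.2]) _))
    t ⟨ht, le_rfl⟩
  simpa [f, mul_comm] using this

theorem norm_exp_smul_sub_le {B : E →L[ℝ] E} (hB : ∀ x, inner ℝ (B x) x ≤ 0) {s t : ℝ}
    (hs : 0 ≤ s) (ht : 0 ≤ t) (x : E) :
    ‖NormedSpace.exp (t • B) x - NormedSpace.exp (s • B) x‖ ≤ |t - s| * ‖B x‖ := by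
  wlog hst : s ≤ t generalizing s t
  · rw [norm_sub_rev, abs_sub_comm]
    exact this ht hs (le_of_not_ge hst)
  have := norm_image_sub_le_of_norm_deriv_le_segment'
    (f := fun s : ℝ => NormedSpace.exp (s • B) x) (a := s) (b := t)
    (C := ‖B x‖) (fun r _ => (hasDerivAt_exp_smul_apply B x r).hasDerivWithinAt) (fun r hr =>
      norm_exp_smul_apply_le hB (hs.trans hr.1) _) t ⟨hst, le_rfl⟩
  rwa [abs_of_nonneg (sub_nonneg.mpr hst), mul_comm]

/-- A first-order Taylor estimate at `0`, meant for Yosida approximations `B` and `z = A x`. Since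
`z` need not lie in `dom A`, the norm `‖B z‖` may blow up; a nearby `y ∈ dom A` replaces it. -/
theorem norm_exp_smul_sub_sub_le {B : E →L[ℝ] E} (hB : ∀ x, inner ℝ (B x) x ≤ 0) {t : ℝ}
    (ht : 0 ≤ t) (x y z : E) :
    ‖NormedSpace.exp (t • B) x - x - t • z‖ ≤
      t * (‖B x - z‖ + 2 * ‖z - y‖ + t * ‖B y‖) := by
  have hd : ∀ s : ℝ, HasDerivAt (fun s : ℝ => NormedSpace.exp (s • B) x - s • z)
      (NormedSpace.exp (s • B) (B x) - z) s := fun s => by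
    have := (hasDerivAt_exp_smul_apply B x s).sub ((hasDerivAt_id s).smul_const z)
    simpa using! this
  have := norm_image_sub_le_of_norm_deriv_le_segment'
    (f := fun s : ℝ => NormedSpace.exp (s • B) x - s • z) (a := 0) (b := t)
    (C := ‖B x - z‖ + 2 * ‖z - y‖ + t * ‖B y‖) (fun r _ => (hd r).hasDerivWithinAt)
    (fun r hr => ?_) t ⟨ht, le_rfl⟩
  · simp only [zero_smul, NormedSpace.exp_zero, one_apply_eq_self, sub_zero] at this
    rw [mul_comm]
    convert! this using 2
    abel
  · have e : NormedSpace.exp (r • B) (B x) - z = NormedSpace.exp (r • B) (B x - z)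
        + NormedSpace.exp (r • B) (z - y) + (NormedSpace.exp (r • B) y - y) - (z - y) := by
      simp only [map_sub]; abel
    have h1 := norm_exp_smul_apply_le hB hr.1 (B x - z)
    have h2 := norm_exp_smul_apply_le hB hr.1 (z - y)
    have h3 := norm_exp_smul_sub_le hB le_rfl hr.1 y
    simp only [zero_smul, NormedSpace.exp_zero, one_apply_eq_self, sub_zero,
      abs_of_nonneg hr.1] at h3
    have h4 : r * ‖B y‖ ≤ t * ‖B y‖ := mul_le_mul_of_nonneg_right hr.2.le (norm_nonneg _)
    rw [e]
    refine (norm_sub_le _ _).trans ?_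
    have h5 := norm_add₃_le (a := NormedSpace.exp (r • B) (B x - z))
      (b := NormedSpace.exp (r • B) (z - y)) (c := NormedSpace.exp (r • B) y - y)
    linarith

end BoundedExp

theorem tendsto_zero_of_dense {ι : Type*} {f : Filter ι} {S : ι → E →L[ℝ] E} {c : ℝ}
    (hc : 0 ≤ c) (hS : ∀ i x, ‖S i x‖ ≤ c * ‖x‖) {D : Set E} (hD : Dense D)
    (h : ∀ x ∈ D, Tendsto (fun i => S i x) f (𝓝 0)) (x : E) :
    Tendsto (fun i => S i x) f (𝓝 0) := by
  rw [Metric.tendsto_nhds]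
  intro ε hε
  obtain ⟨y, hy, hyx⟩ := hD.exists_dist_lt x (show 0 < ε / (2 * (c + 1)) by positivity)
  filter_upwards [Metric.tendsto_nhds.mp (h y hy) (ε / 2) (by positivity)] with i hi
  rw [dist_zero_right] at hi ⊢
  have h1 := hS i (x - y)
  rw [dist_eq_norm, lt_div_iff₀ (by positivity)] at hyx
  have h2 : ‖S i x‖ ≤ ‖S i (x - y)‖ + ‖S i y‖ := by
    rw [map_sub]; exact norm_le_norm_sub_add _ _
  nlinarith [norm_nonneg (x - y)]

end Generation

/-! ### The Hille–Yosida theorem for maximal dissipative operators -/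

section Semigroup

variable {E : Type*} [NormedAddCommGroup E] [InnerProductSpace ℝ E]
  {A : E →ₗ.[ℝ] E}

namespace IsMaxDissipative

/-- This follows from the resolvent identity `R - S = (l - k) R S` and the one with the roles of `R`
and `S` exchanged. -/
theorem resolvent_comm (hA : IsMaxDissipative A) {k l : ℝ} (hk : 0 < k) (hl : 0 < l)
    {R S : E →L[ℝ] E} (hR : ∀ z, (R z, k • R z - z) ∈ A.graph)
    (hS : ∀ z, (S z, l • S z - z) ∈ A.graph) : Commute R S := by
  have key : ∀ {k l : ℝ}, 0 < k → 0 < l → ∀ {R S : E →L[ℝ] E},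
      (∀ z, (R z, k • R z - z) ∈ A.graph) → (∀ z, (S z, l • S z - z) ∈ A.graph) →
      ∀ z, R z - S z = (l - k) • R (S z) := by
    intro k l hk hl R S hR hS z
    have h : R ((k - l) • S z + z) = S z := by
      refine hA.resolvent_unique hk (hR _) (hS z) ?_
      rw [sub_smul]; abel
    rw [map_add, map_smul] at h
    calc R z - S z = R z - ((k - l) • R (S z) + R z) := by rw [h]
      _ = (l - k) • R (S z) := by simp only [sub_smul]; abel
  ext z
  change R (S z) = S (R z)
  rcases eq_or_ne k l with rfl | hne
  · have : R = S := by
      ext z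
      exact hA.resolvent_unique hk (hR z) (hS z) (by abel)
    rw [this]
  · have h1 := key hk hl hR hS z
    have h2 := key hl hk hS hR z
    have h3 : (l - k) • R (S z) = (l - k) • S (R z) := by
      rw [← h1, ← neg_sub (S z), h2, ← neg_smul, neg_sub]
    exact smul_right_injective E (sub_ne_zero.mpr hne.symm) h3

/-- A maximal dissipative operator is a limit of commuting bounded dissipative operators. -/
theorem exists_yosida [CompleteSpace E] (hA : IsMaxDissipative A) :
    ∃ B : ℕ → E →L[ℝ] E, (∀ n x, inner ℝ (B n x) x ≤ 0) ∧ (∀ m n, Commute (B m) (B n)) ∧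
      ∀ x y, (x, y) ∈ A.graph → Tendsto (fun n => B n x) atTop (𝓝 y) := by
  have hl : ∀ n : ℕ, (0 : ℝ) < n + 1 := fun n => by positivity
  choose R hR hRle using fun n : ℕ => hA.exists_resolvent (hl n)
  let l : ℕ → ℝ := fun n => n + 1
  have hc : ∀ m n, Commute (R m) (R n) := fun m n => hA.resolvent_comm (hl m) (hl n) (hR m) (hR n)
  have key : ∀ n x y, (x, y) ∈ A.graph → l n • R n x - x = R n y := fun n x y h => by
    have : R n (l n • x - y) = x := hA.resolvent_unique (hl n) (hR n _) h (by abel)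
    rw [map_sub, map_smul] at this
    rw [sub_eq_iff_eq_add', ← sub_eq_iff_eq_add, this]
  have hbd : ∀ n x, ‖l n • R n x‖ ≤ ‖x‖ := fun n x => by
    rw [norm_smul, Real.norm_of_nonneg (hl n).le]; exact hRle n x
  -- On `dom A` the difference `l R x - x = R (A x)` is `O(1 / l)`; the operators `l R` are
  -- contractions, so density gives convergence everywhere.
  have hone : ∀ x, Tendsto (fun n => l n • R n x) atTop (𝓝 x) := fun x => by
    have := tendsto_zero_of_dense (S := fun n => l n • R n - 1) (f := atTop) (c := 2)
      two_pos.le (fun n x => ?_) hA.dense (fun x hx => ?_) x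
    · simpa using this.add_const x
    · have h1 := norm_sub_le (l n • R n x) x
      have h2 := hbd n x
      change ‖l n • R n x - x‖ ≤ _
      linarith
    · have hxy := A.mem_graph ⟨x, hx⟩
      have h1 : ∀ n, ‖(l n • R n - 1) x‖ ≤ ‖A ⟨x, hx⟩‖ * (1 / ((n : ℝ) + 1)) := fun n => by
        change ‖l n • R n x - x‖ ≤ _
        rw [key n _ _ hxy, mul_one_div, le_div_iff₀ (hl n), mul_comm]
        exact hRle n _
      refine squeeze_zero_norm h1 ?_
      simpa using tendsto_one_div_add_atTop_nhds_zero_nat.const_mul ‖A ⟨x, hx⟩‖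
  -- The Yosida approximation `l (l R - 1)`, which equals `l R A` on `dom A`.
  refine ⟨fun n => l n • (l n • R n - 1), fun n x => ?_, fun m n => ?_, fun x y h => ?_⟩
  · change inner ℝ (l n • (l n • R n x - x)) x ≤ 0
    rw [real_inner_smul_left, inner_sub_left, real_inner_self_eq_norm_sq]
    have h1 := real_inner_le_norm (l n • R n x) x
    have h2 := hbd n x
    have h3 : inner ℝ (l n • R n x) x - ‖x‖ ^ 2 ≤ 0 := by nlinarith [norm_nonneg x]
    exact mul_nonpos_of_nonneg_of_nonpos (hl n).le h3
  · refine Commute.smul_left (Commute.smul_right ?_ _) _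
    refine Commute.sub_left (Commute.sub_right ?_ (Commute.one_right _)) (Commute.one_left _)
    exact ((hc m n).smul_left _).smul_right _
  · have : ∀ n, (l n • (l n • R n - 1)) x = l n • R n y := fun n => by
      change l n • (l n • R n x - x) = _
      rw [key n x y h]
    simp only [this]
    exact hone y

end IsMaxDissipative

/-- The function `‖w‖²` starts at `0` and has non-positive right derivative `2 ⟪w', w⟫`. Right
derivatives suffice, and they are what the one-sided limit defining a generator provides. -/
theorem eq_zero_of_hasDerivWithinAt_dissipative
    (hA : ∀ x y, (x, y) ∈ A.graph → inner ℝ y x ≤ 0) {w w' : ℝ → E}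
    (hc : ContinuousOn w (Set.Ici 0)) (hd : ∀ t, 0 ≤ t → HasDerivWithinAt w (w' t) (Set.Ici t) t)
    (hw : ∀ t, 0 ≤ t → (w t, w' t) ∈ A.graph) (h0 : w 0 = 0) {t : ℝ} (ht : 0 ≤ t) : w t = 0 := by
  have := image_le_of_deriv_right_le_deriv_boundary (f := fun s => ‖w s‖ ^ 2)
    (f' := fun s => 2 * inner ℝ (w s) (w' s)) (a := 0) (b := t) (B := fun _ => 0)
    (B' := fun _ => 0) ((hc.mono Set.Icc_subset_Ici_self).norm.pow 2)
    (fun s hs => (hd s hs.1).norm_sq) (by simp [h0]) continuousOn_const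
    (fun s _ => hasDerivWithinAt_const _ _ _) (fun s hs => ?_) (x := t) ⟨ht, le_rfl⟩
  · have h2 := pow_eq_zero_iff two_ne_zero |>.mp (le_antisymm this (sq_nonneg _))
    simpa using h2
  · have := hA _ _ (hw s hs.1)
    rw [real_inner_comm]; linarith


namespace IsSemigroupGeneratedBy

variable {P : ℝ≥0 → E →L[ℝ] E}

theorem map_add_apply (hP : IsSemigroupGeneratedBy A P) (s t : ℝ≥0) (x : E) :
    P (s + t) x = P s (P t x) := by
  rw [hP.map_add]; rfl

theorem mem_graph_map (hP : IsSemigroupGeneratedBy A P) {x y : E} (h : (x, y) ∈ A.graph)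
    (t : ℝ≥0) : (P t x, P t y) ∈ A.graph := by
  rw [hP.generator] at h ⊢
  have h2 := ((P t).continuous.tendsto y).comp h
  refine h2.congr fun s => ?_
  simp only [Function.comp_apply, map_smul, map_sub]
  rw [← hP.map_add_apply, ← hP.map_add_apply, add_comm]

/-- For `s > t`, `P s x - P t x = P t (P (s - t) x - x)`, which moves the difference quotient at `t`
to the one at `0`. -/
theorem hasDerivWithinAt (hP : IsSemigroupGeneratedBy A P) {x y : E} (h : (x, y) ∈ A.graph)
    {t : ℝ} (ht : 0 ≤ t) : HasDerivWithinAt (fun s : ℝ => P s.toNNReal x) (P t.toNNReal y)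
      (Set.Ici t) t := by
  rw [← hasDerivWithinAt_Ioi_iff_Ici, hasDerivWithinAt_iff_tendsto_slope' (by simp)]
  rw [hP.generator] at h
  have h1 : Tendsto (fun s : ℝ => (s - t).toNNReal) (𝓝[>] t) (𝓝[>] 0) := by
    rw [tendsto_nhdsWithin_iff]
    constructor
    · have : Continuous fun s : ℝ => (s - t).toNNReal := by fun_prop
      have := this.tendsto t
      simp only [sub_self, Real.toNNReal_zero] at this
      exact this.mono_left nhdsWithin_le_nhds
    · filter_upwards [self_mem_nhdsWithin] with s hs
      simpa using hs
  have h2 := (((P t.toNNReal).continuous.tendsto y).comp h).comp h1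
  refine h2.congr' ?_
  filter_upwards [self_mem_nhdsWithin] with s hs
  have hs' : 0 ≤ s - t := sub_nonneg.mpr (le_of_lt hs)
  simp only [Function.comp_apply, map_smul, map_sub, slope_def_module, Real.coe_toNNReal _ hs']
  rw [← hP.map_add_apply, ← Real.toNNReal_add ht hs', add_sub_cancel]

theorem continuous_toNNReal (hP : IsSemigroupGeneratedBy A P) (x : E) :
    Continuous fun s : ℝ => P s.toNNReal x :=
  (hP.continuous x).comp continuous_real_toNNReal

/-- Solutions of `v' = A v` with `A` dissipative are given by the semigroup. -/
theorem eq_of_hasDerivWithinAt (hP : IsSemigroupGeneratedBy A P)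
    (hA : ∀ x y, (x, y) ∈ A.graph → inner ℝ y x ≤ 0) {v v' : ℝ → E}
    (hc : ContinuousOn v (Set.Ici 0)) (hd : ∀ t, 0 ≤ t → HasDerivWithinAt v (v' t) (Set.Ici t) t)
    (hv : ∀ t, 0 ≤ t → (v t, v' t) ∈ A.graph) (t : ℝ≥0) : v t = P t (v 0) := by
  have h := eq_zero_of_hasDerivWithinAt_dissipative hA
    (w := fun s => v s - P s.toNNReal (v 0)) (w' := fun s => v' s - P s.toNNReal (v' 0))
    (hc.sub (hP.continuous_toNNReal _).continuousOn)
    (fun s hs => (hd s hs).sub (hP.hasDerivWithinAt (hv 0 le_rfl) hs))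
    (fun s hs => A.graph.sub_mem (hv s hs) (hP.mem_graph_map (hv 0 le_rfl) _))
    (by simp [hP.map_zero]) t.2
  simpa [sub_eq_zero] using h

end IsSemigroupGeneratedBy

namespace IsMaxDissipative

variable [CompleteSpace E]

/-- For `x ∈ dom A` the orbit of `P` solves `v' = A v`, hence is the orbit of `Q`; the domain is
dense. -/
theorem semigroup_unique (hA : IsMaxDissipative A) {P Q : ℝ≥0 → E →L[ℝ] E}
    (hP : IsSemigroupGeneratedBy A P) (hQ : IsSemigroupGeneratedBy A Q) : P = Q := by
  funext t
  refine ContinuousLinearMap.ext_on (s := A.domain) (by simpa using hA.dense) fun x hx => ?_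
  have hxy := A.mem_graph ⟨x, hx⟩
  have := hQ.eq_of_hasDerivWithinAt hA.inner_nonpos (v := fun s => P s.toNNReal x)
    (hP.continuous_toNNReal x).continuousOn (fun s hs => hP.hasDerivWithinAt hxy hs)
    (fun s hs => hP.mem_graph_map hxy _) t
  simpa [hP.map_zero] using this

/-- The exponentials of the Yosida approximations are contractions that converge on `dom A` because
the approximations commute, hence everywhere. The generator of the limit extends `A`; it is
dissipative as well, and a maximal dissipative operator has no proper dissipative extension. -/
theorem exists_semigroup (hA : IsMaxDissipative A) : ∃ P, IsSemigroupGeneratedBy A P := by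
  obtain ⟨B, hB, hBc, hBA⟩ := hA.exists_yosida
  let S : ℕ → ℝ≥0 → E →L[ℝ] E := fun n t => NormedSpace.exp ((t : ℝ) • B n)
  have hS : ∀ n t x, ‖S n t x‖ ≤ ‖x‖ := fun n t x => norm_exp_smul_apply_le (hB n) t.2 x
  have hcau : ∀ t x, CauchySeq fun n => S n t x := fun t x => by
    rw [cauchySeq_iff_tendsto_dist_atTop_0]
    have := tendsto_zero_of_dense (S := fun n : ℕ × ℕ => S n.1 t - S n.2 t) (f := atTop) (c := 2)
      two_pos.le (fun n x => ?_) hA.dense (fun x hx => ?_) x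
    · simpa [dist_eq_norm] using this.norm
    · have h1 := norm_sub_le (S n.1 t x) (S n.2 t x)
      have h2 := hS n.1 t x
      have h3 := hS n.2 t x
      change ‖S n.1 t x - S n.2 t x‖ ≤ _
      linarith
    · refine squeeze_zero_norm (a := fun n : ℕ × ℕ => t * dist (B n.1 x) (B n.2 x))
        (fun n => ?_) ?_
      · rw [dist_eq_norm]
        exact norm_exp_smul_sub_exp_smul_le (hB _) (hB _) (hBc _ _) t.2 x
      · have := cauchySeq_iff_tendsto_dist_atTop_0.mp
          (hBA x _ (A.mem_graph ⟨x, hx⟩)).cauchySeq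
        simpa using this.const_mul (t : ℝ)
  choose p hp using fun t x => cauchySeq_tendsto_of_complete (hcau t x)
  have hple : ∀ t x, ‖p t x‖ ≤ 1 * ‖x‖ := fun t x => by
    rw [one_mul]
    exact le_of_tendsto (hp t x).norm (Eventually.of_forall fun n => hS n t x)
  let P : ℝ≥0 → E →L[ℝ] E := fun t => LinearMap.mkContinuous
    ⟨⟨p t, fun x y => tendsto_nhds_unique (hp t _)
      (((hp t x).add (hp t y)).congr fun n => (map_add _ _ _).symm)⟩,
      fun c x => tendsto_nhds_unique (hp t _)
      (((hp t x).const_smul c).congr fun n => (map_smul _ _ _).symm)⟩ 1 (hple t)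
  have hP : ∀ t x, Tendsto (fun n => S n t x) atTop (𝓝 (P t x)) := hp
  have hPle : ∀ t x, ‖P t x‖ ≤ ‖x‖ := fun t x => (hple t x).trans_eq (one_mul _)
  have hgen : ∀ x y, (x, y) ∈ A.graph →
      Tendsto (fun t : ℝ≥0 => (t : ℝ)⁻¹ • (P t x - x)) (𝓝[>] 0) (𝓝 y) := by
    intro x y hxy
    rw [Metric.tendsto_nhds]
    intro ε hε
    obtain ⟨z, hz, hyz⟩ := hA.dense.exists_dist_lt y (show 0 < ε / 4 by positivity)
    have hzA := A.mem_graph ⟨z, hz⟩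
    -- The bound `b` is the limit of `‖B n z‖`, so the Taylor estimate survives the limit in `n`;
    -- afterwards `t` is chosen small depending on `b`.
    set b := ‖A ⟨z, hz⟩‖
    have hle : ∀ t : ℝ≥0, ‖P t x - x - (t : ℝ) • y‖ ≤ t * (2 * ‖y - z‖ + t * b) := fun t => by
      refine le_of_tendsto_of_tendsto (((hP t x).sub_const x).sub_const _).norm
        (b := atTop) (g := fun n => (t : ℝ) * (‖B n x - y‖ + 2 * ‖y - z‖ + t * ‖B n z‖)) ?_
        (Eventually.of_forall fun n => norm_exp_smul_sub_sub_le (hB n) t.2 x z y)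
      have h1 : Tendsto (fun n => ‖B n x - y‖) atTop (𝓝 0) := by
        simpa using ((hBA x y hxy).sub_const y).norm
      have h2 := (hBA z _ hzA).norm
      simpa using ((h1.add_const (2 * ‖y - z‖)).add (h2.const_mul (t : ℝ))).const_mul (t : ℝ)
    have hsmall : ∀ᶠ t : ℝ≥0 in 𝓝[>] 0, (t : ℝ) * b < ε / 4 := by
      have : Tendsto (fun t : ℝ≥0 => (t : ℝ) * b) (𝓝[>] 0) (𝓝 0) := by
        have h : Continuous fun t : ℝ≥0 => (t : ℝ) * b := by fun_prop
        simpa using (h.tendsto 0).mono_left nhdsWithin_le_nhds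
      exact this.eventually_lt_const (by positivity)
    filter_upwards [hsmall, self_mem_nhdsWithin] with t ht ht0
    have ht0' : (0 : ℝ) < t := ht0
    have e : (t : ℝ)⁻¹ • (P t x - x) - y = (t : ℝ)⁻¹ • (P t x - x - (t : ℝ) • y) := by
      rw [smul_sub _ _ ((t : ℝ) • y), smul_smul, inv_mul_cancel₀ ht0'.ne', one_smul]
    rw [dist_eq_norm, e, norm_smul, norm_inv, Real.norm_of_nonneg ht0'.le]
    rw [dist_eq_norm] at hyz
    rw [inv_mul_lt_iff₀ ht0']
    refine (hle t).trans_lt (mul_lt_mul_of_pos_left ?_ ht0')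
    linarith
  refine ⟨P, ?_, fun s t => ?_, fun x => ?_, fun x y => ⟨hgen x y, fun h => ?_⟩⟩
  · ext x
    refine tendsto_nhds_unique (hP 0 x) ?_
    simp [S]
  · ext x
    refine tendsto_nhds_unique (hP (s + t) x) ?_
    have h1 : ∀ n, S n (s + t) x = S n s (S n t x - P t x) + S n s (P t x) := fun n => by
      rw [map_sub, sub_add_cancel]
      simp only [S, NNReal.coe_add, exp_add_smul]
      rfl
    have h2 : Tendsto (fun n => S n s (S n t x - P t x)) atTop (𝓝 0) := by
      refine squeeze_zero_norm (fun n => hS n s _) ?_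
      simpa using ((hP t x).sub_const (P t x)).norm
    simp only [h1]
    simpa using h2.add (hP s (P t x))
  -- Orbits of points of `dom A` are Lipschitz, and every orbit is a uniform limit of such orbits,
  -- since the `P t` are contractions.
  · have hlip : ∀ x (hx : x ∈ A.domain), Continuous fun t => P t x := fun x hx => by
      have hb : ∀ s t : ℝ≥0, dist (P t x) (P s x) ≤ ‖A ⟨x, hx⟩‖ * dist t s := fun s t => by
        rw [dist_eq_norm, NNReal.dist_eq, mul_comm]
        refine le_of_tendsto_of_tendsto ((hP t x).sub (hP s x)).norm
          ((hBA x _ (A.mem_graph ⟨x, hx⟩)).norm.const_mul _)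
          (Eventually.of_forall fun n => norm_exp_smul_sub_le (hB n) s.2 t.2 x)
      exact (LipschitzWith.of_dist_le_mul (K := ‖A ⟨x, hx⟩‖₊) fun t s => hb s t).continuous
    refine continuous_of_uniform_approx_of_continuous fun u hu => ?_
    obtain ⟨ε, hε, hεu⟩ := Metric.mem_uniformity_dist.mp hu
    obtain ⟨z, hz, hxz⟩ := hA.dense.exists_dist_lt x hε
    refine ⟨_, hlip z hz, fun t => hεu ?_⟩
    rw [dist_eq_norm, ← map_sub]
    exact (hPle t _).trans_lt (by rwa [← dist_eq_norm])
  -- Choose `x' ∈ dom A` with `x' - A x' = x - y`. Then the generator maps `x - x'` to itself, and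
  -- dissipativity forces `x = x'`.
  · obtain ⟨x', y', hxy', e⟩ := hA.surj 1 one_pos (x - y)
    have h1 : Tendsto (fun t : ℝ≥0 => (t : ℝ)⁻¹ • (P t (x - x') - (x - x'))) (𝓝[>] 0)
        (𝓝 (y - y')) := by
      refine (h.sub (hgen _ _ hxy')).congr fun t => ?_
      rw [map_sub, ← smul_sub]; congr 1; abel
    have h2 : inner ℝ (y - y') (x - x') ≤ 0 := by
      refine le_of_tendsto (h1.inner tendsto_const_nhds) (Eventually.of_forall fun t => ?_)
      rw [real_inner_smul_left, inner_sub_left, real_inner_self_eq_norm_sq]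
      refine mul_nonpos_of_nonneg_of_nonpos (inv_nonneg.mpr t.2) ?_
      have := real_inner_le_norm (P t (x - x')) (x - x')
      nlinarith [hPle t (x - x'), norm_nonneg (x - x')]
    have e2 : y - y' = x - x' := by
      rw [one_smul] at e
      rw [sub_eq_iff_eq_add] at e ⊢
      rw [e]; abel
    rw [e2, real_inner_self_eq_norm_sq] at h2
    have h3 : x - x' = 0 := by
      have := pow_eq_zero_iff (two_ne_zero) |>.mp (le_antisymm h2 (sq_nonneg _))
      simpa using this
    rw [h3, sub_eq_zero] at e2
    rw [sub_eq_zero] at h3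
    rw [h3, e2]; exact hxy'

theorem existsUnique_semigroup (hA : IsMaxDissipative A) : ∃! P, IsSemigroupGeneratedBy A P := by
  obtain ⟨P, hP⟩ := hA.exists_semigroup
  exact ⟨P, hP, fun Q hQ => hA.semigroup_unique hQ hP⟩

theorem semigroup_spec (hA : IsMaxDissipative A) : IsSemigroupGeneratedBy A (semigroup A) :=
  Classical.epsilon_spec hA.exists_semigroup

end IsMaxDissipative

end Semigroup

/-! ### The operators `-T*T` and `-TT*` of a closed operator, and their intertwining -/

section ClosedOperators

variable {E F : Type*} [NormedAddCommGroup E] [InnerProductSpace ℝ E]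
  [NormedAddCommGroup F] [InnerProductSpace ℝ F] {T : E →ₗ.[ℝ] F}

/-- The orthogonal projection of `(x, y)` onto the graph of `c T`. -/
theorem exists_graph_projection [CompleteSpace E] [CompleteSpace F]
    (hT : IsClosed (T.graph : Set (E × F))) {c : ℝ} (hc : c ≠ 0) (x : E) (y : F) :
    ∃ f : T.domain, ∀ g : T.domain,
      inner ℝ (x - f) (g : E) + c * inner ℝ (y - c • T f) (T g) = 0 := by
  -- The `ℓ²` product is a Hilbert space, unlike the sup-normed `E × F`. The factor `c⁻¹` makes the
  -- preimage of the graph of `T` the graph of `c T`.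
  let L : WithLp 2 (E × F) →ₗ[ℝ] E × F :=
    { toFun := fun p => (p.fst, c⁻¹ • p.snd)
      map_add' := fun p q => by simp
      map_smul' := fun a p => by simp [smul_comm a] }
  have hL : Continuous L := by
    change Continuous fun p : WithLp 2 (E × F) => (p.fst, c⁻¹ • p.snd)
    fun_prop
  let G : Submodule ℝ (WithLp 2 (E × F)) := T.graph.comap L
  have hG : IsClosed (G : Set (WithLp 2 (E × F))) := hT.preimage hL
  have : CompleteSpace G := hG.completeSpace_coe
  let z : WithLp 2 (E × F) := WithLp.toLp 2 (x, y)
  obtain ⟨p, hp, q, hq, hz⟩ := G.exists_add_mem_mem_orthogonal z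
  obtain ⟨f, hf1, hf2⟩ := (LinearPMap.mem_graph_iff _).mp hp
  refine ⟨f, fun g => ?_⟩
  have hg : WithLp.toLp 2 ((g : E), c • T g) ∈ G := by
    change ((g : E), c⁻¹ • c • T g) ∈ T.graph
    rw [inv_smul_smul₀ hc]
    exact T.mem_graph g
  have h0 := (Submodule.mem_orthogonal' _ _).mp hq _ hg
  have hq' : q = z - p := by rw [hz]; abel
  have hpf : p.fst = f := hf1.symm
  have hps : p.snd = c • T f := by
    rw [hf2]
    change _ = c • c⁻¹ • p.snd
    rw [smul_inv_smul₀ hc]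
  rw [hq', WithLp.prod_inner_apply] at h0
  change inner ℝ (x - p.fst) (g : E) + inner ℝ (y - p.snd) (c • T g) = 0 at h0
  rwa [hpf, hps, real_inner_smul_right] at h0

theorem formGeneratorGraph_snd_eq_zero (hd : Dense (T.domain : Set E)) (p : E × E)
    (hp : p ∈ formGeneratorGraph T) (h0 : p.1 = 0) : p.2 = 0 := by
  obtain ⟨f, hf, h⟩ := hp
  have hf0 : f = 0 := Subtype.ext (hf.trans h0)
  subst hf0
  refine hd.eq_zero_of_inner_left (𝕜 := ℝ) (S := T.domain) fun g hg => ?_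
  have := h ⟨g, hg⟩
  simp only [LinearPMap.map_zero, inner_zero_left] at this
  rw [real_inner_comm]
  linarith

theorem mem_graph_formGenerator (hd : Dense (T.domain : Set E)) {x y : E} :
    (x, y) ∈ (formGeneratorGraph T).toLinearPMap.graph ↔
      ∃ f : T.domain, (f : E) = x ∧ ∀ g : T.domain, inner ℝ (T f) (T g) = -inner ℝ (g : E) y := by
  rw [Submodule.toLinearPMap_graph_eq _ (formGeneratorGraph_snd_eq_zero hd)]
  rfl

theorem isMaxDissipative_formGenerator [CompleteSpace E] [CompleteSpace F]
    (hd : Dense (T.domain : Set E)) (hT : IsClosed (T.graph : Set (E × F))) :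
    IsMaxDissipative (formGeneratorGraph T).toLinearPMap where
  inner_nonpos x y h := by
    obtain ⟨f, rfl, hf⟩ := (mem_graph_formGenerator hd).mp h
    have := hf f
    rw [real_inner_comm]
    have h2 : 0 ≤ inner ℝ (T f) (T f) := real_inner_self_nonneg
    linarith
  surj l hl z := by
    have hc : (√l)⁻¹ ≠ 0 := inv_ne_zero (Real.sqrt_pos.mpr hl).ne'
    -- Projecting `(l⁻¹ z, 0)` onto the graph of `T / √l` yields the weak equation `l ⟪f, g⟫ + ⟪T f,
    -- T g⟫ = ⟪z, g⟫`.
    obtain ⟨f, hf⟩ := exists_graph_projection hT hc (l⁻¹ • z) 0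
    refine ⟨f, l • (f : E) - z, (mem_graph_formGenerator hd).mpr ⟨f, rfl, fun g => ?_⟩, by abel⟩
    have := hf g
    have h2 : (√l)⁻¹ * (√l)⁻¹ = l⁻¹ := by
      rw [← mul_inv, Real.mul_self_sqrt hl.le]
    rw [zero_sub, inner_neg_left, real_inner_smul_left, mul_neg, ← mul_assoc, h2,
      inner_sub_left, real_inner_smul_left] at this
    rw [real_inner_comm _ (g : E), inner_sub_left, real_inner_smul_left]
    field_simp at this
    linarith

theorem mem_graph_compOp {G : Type*} [NormedAddCommGroup G] [InnerProductSpace ℝ G]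
    {S : F →ₗ.[ℝ] G} {x : E} {z : G} :
    (x, z) ∈ (compOp S T).graph ↔ ∃ y, (x, y) ∈ T.graph ∧ (y, z) ∈ S.graph := by
  simp only [LinearPMap.mem_graph_iff]
  constructor
  · rintro ⟨⟨a, ha⟩, rfl, rfl⟩
    obtain ⟨b, hb, hba⟩ := (Submodule.mem_inf.mp ha).1
    have h : (T.domRestrict ((S.domain.comap T.toFun).map T.domain.subtype)) ⟨a, ha⟩ = T b :=
      LinearPMap.domRestrict_apply (by simpa using hba.symm)
    refine ⟨T b, ⟨b, hba, rfl⟩, ⟨T b, hb⟩, rfl, ?_⟩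
    change S _ = S ⟨_, _⟩
    congr 1
    exact Subtype.ext h.symm
  · rintro ⟨_, ⟨b, rfl, rfl⟩, c, hc, rfl⟩
    have hb : b ∈ S.domain.comap T.toFun := by
      change T b ∈ S.domain
      rw [← hc]; exact c.2
    have ha : (b : E) ∈ (compOp S T).domain := Submodule.mem_inf.mpr ⟨⟨b, hb, rfl⟩, b.2⟩
    refine ⟨⟨b, ha⟩, rfl, ?_⟩
    have h : (T.domRestrict ((S.domain.comap T.toFun).map T.domain.subtype)) ⟨b, ha⟩ = T b :=
      LinearPMap.domRestrict_apply rfl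
    change S ⟨_, _⟩ = S _
    congr 1
    exact Subtype.ext (h.trans hc.symm)

theorem mem_graph_adjoint [CompleteSpace E] (hd : Dense (T.domain : Set E)) {y : F} {x : E} :
    (y, x) ∈ T†.graph ↔ ∀ f : T.domain, inner ℝ x (f : E) = inner ℝ y (T f) := by
  constructor
  · intro h f
    obtain ⟨w, rfl, rfl⟩ := (LinearPMap.mem_graph_iff _).mp h
    exact LinearPMap.adjoint_isFormalAdjoint hd w f
  · intro h
    have hy : y ∈ T†.domain := LinearPMap.mem_adjoint_domain_of_exists y ⟨x, h⟩
    rw [LinearPMap.mem_graph_iff]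
    exact ⟨⟨y, hy⟩, rfl, LinearPMap.adjoint_apply_eq hd ⟨y, hy⟩ h⟩

theorem mem_graph_neg_compOp_adjoint {w z : F} [CompleteSpace E] :
    (w, z) ∈ (-compOp T T†).graph ↔ ∃ x, (w, x) ∈ T†.graph ∧ (x, -z) ∈ T.graph := by
  rw [← mem_graph_compOp]
  simp only [LinearPMap.mem_graph_iff, LinearPMap.neg_apply]
  constructor
  · rintro ⟨a, h1, h2⟩
    exact ⟨a, h1, by rw [← h2]; simp⟩
  · rintro ⟨a, h1, h2⟩
    exact ⟨a, h1, by rw [h2, neg_neg]⟩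

theorem isMaxDissipative_neg_compOp_adjoint [CompleteSpace E] [CompleteSpace F]
    (hd : Dense (T.domain : Set E)) (hT : IsClosed (T.graph : Set (E × F))) :
    IsMaxDissipative (-compOp T T†) where
  inner_nonpos w z h := by
    obtain ⟨x, h1, h2⟩ := mem_graph_neg_compOp_adjoint.mp h
    obtain ⟨f, rfl, hf⟩ := (LinearPMap.mem_graph_iff _).mp h2
    have := (mem_graph_adjoint hd).mp h1 f
    rw [hf, inner_neg_right] at this
    have h2 : 0 ≤ inner ℝ (f : E) (f : E) := real_inner_self_nonneg
    rw [real_inner_comm]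
    linarith
  surj l hl z := by
    have hc : 0 < √l := Real.sqrt_pos.mpr hl
    have hll : √l * √l = l := Real.mul_self_sqrt hl.le
    -- Projecting `(0, l⁻¹ z)` onto the graph of `T / √l` leaves the second residual `w = l⁻¹ z - T
    -- f / √l`. Orthogonality says `T* w = √l f`, so `l w + T T* w = z`.
    obtain ⟨f, hf⟩ := exists_graph_projection hT (inv_ne_zero hc.ne') 0 (l⁻¹ • z)
    refine ⟨l⁻¹ • z - (√l)⁻¹ • T f, -(√l • T f), mem_graph_neg_compOp_adjoint.mpr
      ⟨√l • (f : E), (mem_graph_adjoint hd).mpr fun g => ?_, ?_⟩, ?_⟩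
    · have := hf g
      rw [zero_sub, inner_neg_left, neg_add_eq_zero] at this
      rw [real_inner_smul_left, this, mul_inv_cancel_left₀ hc.ne']
    · rw [neg_neg]
      exact T.graph.smul_mem (√l) (T.mem_graph f)
    · rw [smul_sub, smul_inv_smul₀ hl.ne', smul_smul]
      have : l * (√l)⁻¹ = √l := by
        rw [← div_eq_mul_inv, div_eq_iff hc.ne', hll]
      rw [this]; abel

/-- The semigroups generated by `-T* T` and `-T T*` are intertwined by `T`. -/
theorem mem_graph_semigroup_apply [CompleteSpace E] [CompleteSpace F]
    (hd : Dense (T.domain : Set E)) (hT : IsClosed (T.graph : Set (E × F)))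
    {P : ℝ≥0 → E →L[ℝ] E} {Q : ℝ≥0 → F →L[ℝ] F}
    (hP : IsSemigroupGeneratedBy (formGeneratorGraph T).toLinearPMap P)
    (hQ : IsSemigroupGeneratedBy (-compOp T T†) Q) (t : ℝ≥0) {x : E} {y : F}
    (h : (x, y) ∈ T.graph) : (P t x, Q t y) ∈ T.graph := by
  set A := (formGeneratorGraph T).toLinearPMap with hAdef
  have hA : IsMaxDissipative A := isMaxDissipative_formGenerator hd hT
  obtain ⟨R, hR, hRle⟩ := hA.exists_resolvent one_pos
  simp only [one_smul] at hR
  have hform : ∀ {x y : E} {s : F}, (x, y) ∈ A.graph → (x, s) ∈ T.graph → ∀ g : T.domain,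
      inner ℝ s (T g) = -inner ℝ (g : E) y := by
    intro x y s hxy hxs g
    obtain ⟨f, rfl, hf⟩ := (mem_graph_formGenerator hd).mp hxy
    rw [← T.mem_graph_snd_inj (T.mem_graph f) hxs rfl]
    exact hf g
  have hex : ∀ x, ∃ s, (R x, s) ∈ T.graph := fun x => by
    obtain ⟨f, hf, -⟩ := (mem_graph_formGenerator hd).mp (hR x)
    exact ⟨T f, by rw [← hf]; exact T.mem_graph f⟩
  choose S₀ hS₀ using hex
  -- The form identity for `R x` tested with itself gives `‖S x‖² = ⟪R x, x⟫ - ‖R x‖² ≤ ‖x‖²`.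
  have hS₀le : ∀ x, ‖S₀ x‖ ≤ 1 * ‖x‖ := fun x => by
    obtain ⟨f, hf1, hf2⟩ := (LinearPMap.mem_graph_iff _).mp (hS₀ x)
    change (f : E) = R x at hf1
    change T f = S₀ x at hf2
    have h1 := hform (hR x) (hS₀ x) f
    rw [hf1, hf2, inner_sub_right, real_inner_self_eq_norm_sq, real_inner_self_eq_norm_sq] at h1
    have h2 := real_inner_le_norm (R x) x
    have h3 := hRle x
    rw [one_mul] at h3 ⊢
    refine le_of_sq_le_sq ?_ (norm_nonneg x)
    nlinarith [norm_nonneg x, norm_nonneg (R x), sq_nonneg ‖R x‖]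
  let S : E →L[ℝ] F := LinearMap.mkContinuous
    ⟨⟨S₀, fun a b => T.mem_graph_snd_inj (hS₀ _) (T.graph.add_mem (hS₀ a) (hS₀ b)) (map_add R a b)⟩,
      fun c a => T.mem_graph_snd_inj (hS₀ _) (T.graph.smul_mem c (hS₀ a)) (map_smul R c a)⟩ _ hS₀le
  have hS : ∀ x, (R x, S x) ∈ T.graph := hS₀
  have hcomm : ∀ x y, (x, y) ∈ A.graph → R x - x = R y := fun x y hxy => by
    have : R (x - y) = x := hA.resolvent_unique one_pos (hR _) hxy (by simp)
    rw [map_sub] at this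
    rw [sub_eq_iff_eq_add', ← sub_eq_iff_eq_add, this]
  have hPR : ∀ x, P t (R x) = R (P t x) := fun x =>
    hA.resolvent_unique one_pos (hP.mem_graph_map (hR x) t) (hR _) (by simp)
  -- For `x ∈ dom A`, `T* S x = T* T R x = -R A x`, and applying `T` gives `-T T* S x = S A x`.
  have hA2 : ∀ x y, (x, y) ∈ A.graph → (S x, S y) ∈ (-compOp T T†).graph := by
    intro x y hxy
    refine mem_graph_neg_compOp_adjoint.mpr ⟨-R y, (mem_graph_adjoint hd).mpr fun f => ?_,
      T.graph.neg_mem (hS y)⟩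
    rw [hform (hR x) (hS x) f, hcomm x y hxy, inner_neg_left, real_inner_comm]
  -- The curve `s ↦ S (P s x)` solves `v' = -T T* v`, so it is `Q s (S x)`; as `R` commutes with `P
  -- t`, it is also `T (P t (R x))` at time `t`.
  have hdom : ∀ x y, (x, y) ∈ A.graph → (P t (R x), Q t (S x)) ∈ T.graph := by
    intro x y hxy
    have := hQ.eq_of_hasDerivWithinAt (isMaxDissipative_neg_compOp_adjoint hd hT).inner_nonpos
      (v := fun s => S (P s.toNNReal x)) (v' := fun s => S (P s.toNNReal y))
      (S.continuous.comp (hP.continuous_toNNReal x)).continuousOn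
      (fun s hs => S.hasFDerivAt.comp_hasDerivWithinAt s (hP.hasDerivWithinAt hxy hs))
      (fun s _ => hA2 _ _ (hP.mem_graph_map hxy _)) t
    simp only [Real.toNNReal_coe, Real.toNNReal_zero, hP.map_zero, one_apply_eq_self] at this
    rw [← this, hPR]
    exact hS _
  have hall : ∀ x, (P t (R x), Q t (S x)) ∈ T.graph := fun x => by
    have hcl : IsClosed {x | (P t (R x), Q t (S x)) ∈ T.graph} :=
      hT.preimage (f := fun x => (P t (R x), Q t (S x))) (by fun_prop)
    have hsub : (A.domain : Set E) ⊆ {x | (P t (R x), Q t (S x)) ∈ T.graph} := fun x hx =>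
      hdom x _ (A.mem_graph ⟨x, hx⟩)
    exact hcl.closure_subset_iff.mpr hsub (hA.dense x)
  let L : WithLp 2 (E × F) →ₗ[ℝ] E × F :=
    { toFun := fun p => (P t p.fst, Q t p.snd)
      map_add' := fun p q => by simp
      map_smul' := fun a p => by simp }
  let L₀ : WithLp 2 (E × F) →ₗ[ℝ] E × F :=
    { toFun := fun p => (p.fst, p.snd)
      map_add' := fun p q => by simp
      map_smul' := fun a p => by simp }
  have hL : Continuous L := by
    change Continuous fun p : WithLp 2 (E × F) => (P t p.fst, Q t p.snd)
    fun_prop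
  have hL₀ : Continuous L₀ := by
    change Continuous fun p : WithLp 2 (E × F) => (p.fst, p.snd)
    fun_prop
  -- `G` is the closed part of the graph of `T` on which the claim holds. It contains all `(R a, S
  -- a)`. An element `(q, T q)` orthogonal to these has `0 = ⟪R a, q⟫ + ⟪T R a, T q⟫ = ⟪a, q⟫` for
  -- every `a`, so `G` is the whole graph.
  let G : Submodule ℝ (WithLp 2 (E × F)) := T.graph.comap L₀ ⊓ T.graph.comap L
  have hG : IsClosed (G : Set (WithLp 2 (E × F))) := (hT.preimage hL₀).inter (hT.preimage hL)
  have : CompleteSpace G := hG.completeSpace_coe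
  obtain ⟨p, hp, q, hq, hz⟩ := G.exists_add_mem_mem_orthogonal (WithLp.toLp 2 (x, y))
  have hqT : (q.fst, q.snd) ∈ T.graph := by
    have hq' : q = WithLp.toLp 2 (x, y) - p := by rw [hz]; abel
    rw [hq']
    exact T.graph.sub_mem h hp.1
  have hq0 : ∀ a, inner ℝ a q.fst = 0 := fun a => by
    have h1 := (Submodule.mem_orthogonal _ _).mp hq (WithLp.toLp 2 (R a, S a)) ⟨hS a, hall a⟩
    rw [WithLp.prod_inner_apply] at h1
    change inner ℝ (R a) q.fst + inner ℝ (S a) q.snd = 0 at h1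
    obtain ⟨f, hf1, hf2⟩ := (LinearPMap.mem_graph_iff _).mp hqT
    have h2 := hform (hR a) (hS a) f
    change T f = q.snd at hf2
    change (f : E) = q.fst at hf1
    rw [hf1, hf2, inner_sub_right, real_inner_comm (R a), real_inner_comm a] at h2
    linarith
  have hq1 : q.fst = 0 := inner_self_eq_zero.mp (hq0 q.fst)
  have hq2 : q.snd = 0 := T.graph_fst_eq_zero_snd hqT hq1
  have hzp : p = WithLp.toLp 2 (x, y) := by
    have : q = 0 := by
      apply (WithLp.ofLp_injective 2)
      exact Prod.ext hq1 hq2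
    rw [hz, this, add_zero]
  have h3 := hp.2
  rw [hzp] at h3
  exact h3

end ClosedOperators

/-! ### The cable systems as one graph on `ℤ²`, and its subdivision by three -/

section Lattice

/-- The integer coordinates of the points `q i` with respect to the basis `q 2, q 1`. -/
def unit : Fin 5 → ℤ × ℤ := ![(0, 0), (0, 1), (1, 0), (0, -1), (-1, 0)]

/-- The centers of the cells of size one of `X`, in integer coordinates, indexed by the generation
of the blow-up containing the cell. -/
inductive IsCenterIn : ℕ → ℤ × ℤ → Prop
  | zero : IsCenterIn 0 0
  | step (m : ℕ) (c : ℤ × ℤ) (i : Fin 5) :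
      IsCenterIn m c → IsCenterIn (m + 1) ((3 : ℤ) • c + (2 : ℤ) • unit i)

/-- The centers of the cells of size one of `X`, in integer coordinates. -/
def IsCenter (c : ℤ × ℤ) : Prop := ∃ m, IsCenterIn m c

theorem unit_zero : unit 0 = 0 := rfl

theorem isCenter_zero : IsCenter 0 := ⟨0, .zero⟩

theorem IsCenter.step {c : ℤ × ℤ} (h : IsCenter c) (i : Fin 5) :
    IsCenter ((3 : ℤ) • c + (2 : ℤ) • unit i) :=
  h.imp' (· + 1) fun m hm => .step m c i hm

theorem IsCenter.three_smul {c : ℤ × ℤ} (h : IsCenter c) : IsCenter ((3 : ℤ) • c) := by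
  have := h.step 0
  rwa [unit_zero, smul_zero, add_zero] at this

/-- `IsCenterIn.step` appends the finest digit of the word of a cell, this lemma the coarsest; the
latter is how `ψ i` acts in the recursion for `edgesK`. -/
theorem IsCenterIn.add_top {m : ℕ} {c : ℤ × ℤ} (h : IsCenterIn m c) (i : Fin 5) :
    IsCenterIn (m + 1) (c + (2 * 3 ^ m : ℤ) • unit i) := by
  induction h with
  | zero => simpa using IsCenterIn.step 0 0 i .zero
  | step m c j h ih =>
    convert! IsCenterIn.step _ _ j ih using 1
    rw [pow_succ]
    module

theorem IsCenterIn.exists_top {m : ℕ} {c : ℤ × ℤ} (h : IsCenterIn (m + 1) c) :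
    ∃ c' i, IsCenterIn m c' ∧ c = c' + (2 * 3 ^ m : ℤ) • unit i := by
  induction m generalizing c with
  | zero =>
    obtain _ | ⟨_, c', i, h'⟩ := h
    cases h'
    exact ⟨0, i, .zero, by simp⟩
  | succ m ih =>
    obtain _ | ⟨_, c', i, h'⟩ := h
    obtain ⟨c'', j, h'', rfl⟩ := ih h'
    exact ⟨_, j, .step _ _ i h'', by rw [pow_succ]; module⟩

theorem IsCenter.even {c : ℤ × ℤ} (h : IsCenter c) : Even c.1 ∧ Even c.2 := by
  obtain ⟨m, h⟩ := h
  induction h with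
  | zero => simp
  | step m c i h ih =>
    simp only [Prod.fst_add, Prod.snd_add, Prod.smul_fst, Prod.smul_snd, smul_eq_mul]
    exact ⟨(ih.1.mul_left 3).add (even_two_mul _), (ih.2.mul_left 3).add (even_two_mul _)⟩

/-- The opposite direction. -/
def opp : Fin 5 → Fin 5 := ![0, 3, 4, 1, 2]

theorem unit_opp (i : Fin 5) : unit (opp i) = -unit i := by fin_cases i <;> simp [unit, opp]

theorem unit_ne_zero {i : Fin 5} (h : i ≠ 0) : unit i ≠ 0 := by
  fin_cases i <;> simp_all [unit]

theorem opp_ne_zero {i : Fin 5} (h : i ≠ 0) : opp i ≠ 0 := by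
  fin_cases i <;> simp_all [opp]

/-- The cable system of level zero as a graph, in integer coordinates. -/
def latticeGraph : SimpleGraph (ℤ × ℤ) :=
  SimpleGraph.fromRel fun a b => IsCenter a ∧ ∃ j : Fin 5, j ≠ 0 ∧ b = a + unit j

theorem latticeGraph_adj_center {c : ℤ × ℤ} (hc : IsCenter c) {j : Fin 5} (hj : j ≠ 0) :
    latticeGraph.Adj c (c + unit j) := by
  rw [latticeGraph, SimpleGraph.fromRel_adj]
  exact ⟨by simpa using unit_ne_zero hj, Or.inl ⟨hc, j, hj, rfl⟩⟩

/-- To prove a symmetric property of all edges, it suffices to consider those from a center to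
a corner. -/
theorem latticeGraph_adj_induction {p : ℤ × ℤ → ℤ × ℤ → Prop} (hs : ∀ a b, p a b → p b a)
    (h : ∀ c j, IsCenter c → j ≠ 0 → p c (c + unit j)) {a b : ℤ × ℤ}
    (hab : latticeGraph.Adj a b) : p a b := by
  rw [latticeGraph, SimpleGraph.fromRel_adj] at hab
  obtain ⟨-, ⟨ha, j, hj, rfl⟩ | ⟨hb, j, hj, rfl⟩⟩ := hab
  · exact h _ j ha hj
  · exact hs _ _ (h _ j hb hj)

/-- The edge from `c` to `c + u` becomes the path `3c, 3c + u, 3c + 2u, 3c + 3u`. Here `3c` and `3c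
+ 2u` are centers of subcells, and `3c + u` is the corner which they share. -/
theorem latticeGraph_adj_thirds {a b : ℤ × ℤ} (h : latticeGraph.Adj a b) :
    latticeGraph.Adj ((3 : ℤ) • a) ((2 : ℤ) • a + b) ∧
    latticeGraph.Adj ((2 : ℤ) • a + b) (a + (2 : ℤ) • b) ∧
    latticeGraph.Adj (a + (2 : ℤ) • b) ((3 : ℤ) • b) := by
  refine latticeGraph_adj_induction (p := fun a b =>
    latticeGraph.Adj ((3 : ℤ) • a) ((2 : ℤ) • a + b) ∧
    latticeGraph.Adj ((2 : ℤ) • a + b) (a + (2 : ℤ) • b) ∧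
    latticeGraph.Adj (a + (2 : ℤ) • b) ((3 : ℤ) • b)) ?_ ?_ h
  · rintro a b ⟨h1, h2, h3⟩
    rw [add_comm a, add_comm _ b] at *
    exact ⟨h3.symm, h2.symm, h1.symm⟩
  · intro c j hc hj
    have h1 := latticeGraph_adj_center hc.three_smul hj
    have h2 := latticeGraph_adj_center (hc.step j) (opp_ne_zero hj)
    have h3 := latticeGraph_adj_center (hc.step j) hj
    rw [unit_opp] at h2
    refine ⟨?_, ?_, ?_⟩
    · convert! h1 using 1; module
    · convert! h2.symm using 1 <;> module
    · convert! h3 using 1 <;> module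

theorem reachable_three_smul {a b : ℤ × ℤ} (h : latticeGraph.Reachable a b) :
    latticeGraph.Reachable ((3 : ℤ) • a) ((3 : ℤ) • b) := by
  obtain ⟨w⟩ := h
  induction w with
  | nil => rfl
  | cons h _ ih =>
    obtain ⟨h1, h2, h3⟩ := latticeGraph_adj_thirds h
    exact (h1.reachable.trans (h2.reachable.trans h3.reachable)).trans ih

theorem IsCenter.reachable {c : ℤ × ℤ} (h : IsCenter c) : latticeGraph.Reachable 0 c := by
  obtain ⟨m, h⟩ := h
  induction h with
  | zero => rfl
  | step m c i h ih =>
    have hc : IsCenter c := ⟨m, h⟩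
    have h0 : latticeGraph.Reachable 0 ((3 : ℤ) • c) := by simpa using reachable_three_smul ih
    rcases eq_or_ne i 0 with rfl | hi
    · rwa [unit_zero, smul_zero, add_zero]
    have h1 := latticeGraph_adj_center hc.three_smul hi
    have h2 := latticeGraph_adj_center (hc.step i) (opp_ne_zero hi)
    rw [unit_opp] at h2
    have e : (3 : ℤ) • c + (2 : ℤ) • unit i + -unit i = (3 : ℤ) • c + unit i := by module
    rw [e] at h2
    exact h0.trans (h1.reachable.trans h2.symm.reachable)

theorem reachable_of_adj {a b : ℤ × ℤ} (h : latticeGraph.Adj a b) :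
    latticeGraph.Reachable 0 a := by
  have := latticeGraph_adj_induction (p := fun a b => latticeGraph.Reachable 0 a ∧
    latticeGraph.Reachable 0 b) (fun a b h => h.symm) (fun c j hc hj =>
      ⟨hc.reachable, hc.reachable.trans (latticeGraph_adj_center hc hj).reachable⟩) h
  exact this.1

theorem le_mul_dist {V : Type*} {G : SimpleGraph V} {f : V → ℝ} {L : ℝ}
    (hf : ∀ a b, G.Adj a b → |f a - f b| ≤ L) {a b : V} (h : G.Reachable a b) :
    |f b - f a| ≤ L * G.dist a b := by
  obtain ⟨w, hw⟩ := h.exists_walk_length_eq_dist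
  rw [← hw]
  clear hw h
  induction w with
  | nil => simp
  | @cons u v w h p ih =>
    have h1 := hf _ _ h
    rw [abs_sub_comm] at h1
    have h2 := abs_sub_le (f w) (f v) (f u)
    rw [SimpleGraph.Walk.length_cons]
    push_cast
    linarith

/-- The graph distance to the center. -/
def latticeDist (a : ℤ × ℤ) : ℕ := latticeGraph.dist 0 a

theorem latticeDist_zero : latticeDist 0 = 0 := SimpleGraph.dist_self

theorem latticeDist_adj_le {a b : ℤ × ℤ} (h : latticeGraph.Adj a b) :
    latticeDist b ≤ latticeDist a + 1 := by
  have := (reachable_of_adj h).dist_triangle_left b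
  rwa [SimpleGraph.dist_eq_one_iff_adj.mpr h] at this

/-- The graph is bipartite: every edge changes the parity of the coordinate sum. Therefore adjacent
vertices are never equidistant from `0`, and each edge has an orientation. -/
theorem even_latticeDist {a b : ℤ × ℤ} (h : latticeGraph.Adj a b) :
    Even (latticeDist a) ↔ Even (a.1 + a.2) := by
  obtain ⟨w, hw⟩ := (reachable_of_adj h).exists_walk_length_eq_dist
  have key : ∀ {a b : ℤ × ℤ} (w : latticeGraph.Walk a b),
      (Even w.length ↔ (Even (a.1 + a.2) ↔ Even (b.1 + b.2))) := by
    intro a b w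
    induction w with
    | nil => simp
    | @cons u v _ h p ih =>
      have : Even (u.1 + u.2) ↔ ¬ Even (v.1 + v.2) :=
        latticeGraph_adj_induction (p := fun u v => Even (u.1 + u.2) ↔ ¬ Even (v.1 + v.2))
          (fun a b h => by tauto) (fun c j hc hj => by
            fin_cases j <;> simp [unit] at hj ⊢ <;> grind) h
      rw [SimpleGraph.Walk.length_cons, Nat.even_add_one, ih]
      tauto
  rw [latticeDist, ← hw, key w]
  simp

theorem latticeDist_adj_ne {a b : ℤ × ℤ} (h : latticeGraph.Adj a b) :
    latticeDist a ≠ latticeDist b := by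
  intro he
  have h1 := even_latticeDist h
  have h2 := even_latticeDist h.symm
  have : Even (a.1 + a.2) ↔ ¬ Even (b.1 + b.2) :=
    latticeGraph_adj_induction (p := fun u v => Even (u.1 + u.2) ↔ ¬ Even (v.1 + v.2))
      (fun a b h => by tauto) (fun c j hc hj => by
        fin_cases j <;> simp [unit] at hj ⊢ <;> grind) h
  rw [he] at h1
  tauto

theorem latticeDist_adj {a b : ℤ × ℤ} (h : latticeGraph.Adj a b) :
    latticeDist b = latticeDist a + 1 ∨ latticeDist a = latticeDist b + 1 := by
  have h1 := latticeDist_adj_le h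
  have h2 := latticeDist_adj_le h.symm
  have h3 := latticeDist_adj_ne h
  omega

/-- The extension of a function from the vertices of a cable system to those of the next level:
affine along edges, and constant on the new branches. The coordinates of the new level are three
times those of the old one. -/
def subdivide (h : ℤ × ℤ → ℝ) (p : ℤ × ℤ) : ℝ :=
  -- Centers have even coordinates, so their triples lie in `(6ℤ)²`, and rounding to the nearest
  -- multiple of `6` finds the cell. Comparing `|s|` with `|r|` projects a branch onto its arm. At a
  -- corner the rounding is ambiguous but harmless, because weight `|r| / 3 = 1` just returns the
  -- value there.
  let a := (p.1 + 3) / 6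
  let b := (p.2 + 3) / 6
  let r := p.1 - 6 * a
  let s := p.2 - 6 * b
  h (2 * a, 2 * b) + if |s| < |r|
    then (|r| : ℤ) / 3 * (h (2 * a + r.sign, 2 * b) - h (2 * a, 2 * b))
    else (|s| : ℤ) / 3 * (h (2 * a, 2 * b + s.sign) - h (2 * a, 2 * b))

theorem subdivide_six_mul_add (h : ℤ × ℤ → ℝ) (a b r s : ℤ) :
    subdivide h (6 * a + r, 6 * b + s) =
      subdivide (fun p => h (2 * a + p.1, 2 * b + p.2)) (r, s) := by
  have h1 : (6 * a + r + 3) / 6 = a + (r + 3) / 6 := by omega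
  have h2 : (6 * b + s + 3) / 6 = b + (s + 3) / 6 := by omega
  have h3 : ∀ m, 6 * a + r - 6 * (a + m) = r - 6 * m := fun m => by ring
  have h4 : ∀ m, 6 * b + s - 6 * (b + m) = s - 6 * m := fun m => by ring
  simp only [subdivide, h1, h2, h3, h4]
  simp only [mul_add, add_assoc]

theorem subdivide_three_smul_add {c : ℤ × ℤ} (hc : IsCenter c) (h : ℤ × ℤ → ℝ) (p : ℤ × ℤ) :
    subdivide h ((3 : ℤ) • c + p) = subdivide (fun p => h (c + p)) p := by
  obtain ⟨⟨a, ha⟩, ⟨b, hb⟩⟩ := hc.even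
  obtain ⟨x, y⟩ := c
  obtain ⟨r, s⟩ := p
  simp only at ha hb
  obtain rfl : x = 2 * a := by omega
  obtain rfl : y = 2 * b := by omega
  convert! subdivide_six_mul_add h a b r s using 2
  ext <;> simp <;> ring

theorem subdivide_arm {c : ℤ × ℤ} (hc : IsCenter c) (h : ℤ × ℤ → ℝ) (i : Fin 5) {k : ℤ}
    (hk0 : 0 ≤ k) (hk3 : k ≤ 3) :
    subdivide h ((3 : ℤ) • c + k • unit i) = h c + k / 3 * (h (c + unit i) - h c) := by
  have h0 : h c = h (c + 0) := by rw [add_zero]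
  rw [subdivide_three_smul_add hc, h0]
  have s2 : Int.sign 2 = 1 := rfl
  have s3 : Int.sign 3 = 1 := rfl
  have z : c + (0, 0) = c := add_zero c
  fin_cases i <;> interval_cases k <;> norm_num [subdivide, unit, s2, s3, z]

theorem subdivide_branch {c : ℤ × ℤ} (hc : IsCenter c) (h : ℤ × ℤ → ℝ) {i j : Fin 5} (hi : i ≠ 0)
    (hj : j ≠ 0) (hij : j ≠ i) (hij' : j ≠ opp i) :
    subdivide h ((3 : ℤ) • c + ((2 : ℤ) • unit i + unit j)) =
      subdivide h ((3 : ℤ) • c + (2 : ℤ) • unit i) := by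
  rw [subdivide_three_smul_add hc, subdivide_three_smul_add hc]
  fin_cases i <;> fin_cases j <;> simp [opp] at hi hj hij hij' <;>
    norm_num [subdivide, unit]

theorem subdivide_center {c : ℤ × ℤ} (hc : IsCenter c) (h : ℤ × ℤ → ℝ) :
    subdivide h ((3 : ℤ) • c) = h c := by
  simpa using subdivide_arm hc h 0 (k := 0) le_rfl (by norm_num)

theorem subdivide_corner {c : ℤ × ℤ} (hc : IsCenter c) (h : ℤ × ℤ → ℝ) (i : Fin 5) :
    subdivide h ((3 : ℤ) • (c + unit i)) = h (c + unit i) := by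
  have := subdivide_arm hc h i (k := 3) (by norm_num) le_rfl
  rw [smul_add, this]
  push_cast
  ring

/-- The sign with which the edge of direction `j` of the `i`-th subcell lies on an edge of the
previous level, or zero if it does not. -/
def subSign (i j : Fin 5) : ℝ := if i = 0 ∨ j = i then 1 else if j = opp i then -1 else 0

/-- The direction of the edge of the previous level containing the edge of direction `j` of the
`i`-th subcell. -/
def subArm (i j : Fin 5) : Fin 5 := if i = 0 then j else i

theorem abs_subSign_le (i j : Fin 5) : |subSign i j| ≤ 1 := by
  unfold subSign
  split_ifs <;> simp

theorem subdivide_sub {c : ℤ × ℤ} (hc : IsCenter c) (h : ℤ × ℤ → ℝ) (i : Fin 5) {j : Fin 5}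
    (hj : j ≠ 0) :
    subdivide h ((3 : ℤ) • c + (2 : ℤ) • unit i + unit j) -
      subdivide h ((3 : ℤ) • c + (2 : ℤ) • unit i) =
      subSign i j / 3 * (h (c + unit (subArm i j)) - h c) := by
  unfold subSign subArm
  have h2 := subdivide_arm hc h i (k := 2) (by norm_num) (by norm_num)
  rcases eq_or_ne i 0 with rfl | hi
  · have h1 := subdivide_arm hc h j (k := 1) (by norm_num) (by norm_num)
    rw [one_smul] at h1
    rw [unit_zero, smul_zero, add_zero, h1, subdivide_center hc]
    simp
  rcases eq_or_ne j i with rfl | hji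
  · have h3 := subdivide_arm hc h j (k := 3) (by norm_num) (by norm_num)
    have e : (3 : ℤ) • c + (2 : ℤ) • unit j + unit j = (3 : ℤ) • c + (3 : ℤ) • unit j := by module
    rw [h2, e, h3]
    simp [hi]
    ring
  rcases eq_or_ne j (opp i) with rfl | hji'
  · have h1 := subdivide_arm hc h i (k := 1) (by norm_num) (by norm_num)
    have e : (3 : ℤ) • c + (2 : ℤ) • unit i + unit (opp i) = (3 : ℤ) • c + (1 : ℤ) • unit i := by
      rw [unit_opp]; module
    rw [h2, e, h1]
    simp [hi, hji]
    ring
  · rw [add_assoc, subdivide_branch hc h hi hj hji hji']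
    simp [hi, hji, hji']

/-- Increments along edges shrink by the factor `3` under subdivision: a subedge carries a third of
the increment of an old edge, up to sign, or zero. -/
theorem abs_subdivide_sub_le {c : ℤ × ℤ} (hc : IsCenter c) {h : ℤ × ℤ → ℝ} {L : ℝ}
    (hL : ∀ j, |h (c + unit j) - h c| ≤ L) (i j : Fin 5) :
    |subdivide h ((3 : ℤ) • c + (2 : ℤ) • unit i + unit j) -
      subdivide h ((3 : ℤ) • c + (2 : ℤ) • unit i)| ≤ L / 3 := by
  have hL0 : 0 ≤ L := (abs_nonneg _).trans (hL 0)
  rcases eq_or_ne j 0 with rfl | hj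
  · rw [unit_zero, add_zero, sub_self, abs_zero]; positivity
  rw [subdivide_sub hc h i hj, abs_mul, abs_div, abs_of_pos (show (0 : ℝ) < 3 by norm_num)]
  have h1 := abs_subSign_le i j
  have h2 := hL (subArm i j)
  have h3 := mul_le_mul h1 h2 (abs_nonneg _) zero_le_one
  calc _ = |subSign i j| * |h (c + unit (subArm i j)) - h c| / 3 := by ring
    _ ≤ _ := by linarith

theorem IsCenter.exists_eq {c : ℤ × ℤ} (hc : IsCenter c) :
    ∃ c' i, IsCenter c' ∧ c = (3 : ℤ) • c' + (2 : ℤ) • unit i := by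
  obtain ⟨m, h⟩ := hc
  cases h with
  | zero => exact ⟨0, 0, isCenter_zero, by simp [unit_zero]⟩
  | step m c' i h => exact ⟨c', i, ⟨m, h⟩, rfl⟩

/-- Subdividing a path gives `≤`. For `≥`, the subdivision of the distance function is
`1/3`-Lipschitz on the refined graph and keeps its values at old vertices: the new branches create
no shortcuts. -/
theorem latticeDist_three_smul {a b : ℤ × ℤ} (h : latticeGraph.Adj a b) :
    latticeDist ((3 : ℤ) • a) = 3 * latticeDist a := by
  have hlip : ∀ {a b}, latticeGraph.Adj a b → |(latticeDist a : ℝ) - latticeDist b| ≤ 1 := by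
    intro a b hab
    have h1 : (latticeDist a : ℝ) ≤ latticeDist b + 1 := by
      exact_mod_cast latticeDist_adj_le hab.symm
    have h2 : (latticeDist b : ℝ) ≤ latticeDist a + 1 := by
      exact_mod_cast latticeDist_adj_le hab
    rw [abs_le]; constructor <;> linarith
  have hra := reachable_of_adj h
  apply le_antisymm
  · have := le_mul_dist (G := latticeGraph) (f := fun a => (latticeDist ((3 : ℤ) • a) : ℝ)) (L := 3)
      (fun a b hab => by
        obtain ⟨h1, h2, h3⟩ := latticeGraph_adj_thirds hab
        have h1' := hlip h1
        have h2' := hlip h2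
        have h3' := hlip h3
        rw [abs_le] at *
        constructor <;> linarith) hra
    simp only [smul_zero, latticeDist_zero, Nat.cast_zero, sub_zero] at this
    rw [abs_of_nonneg (by positivity)] at this
    exact_mod_cast this
  · let f : ℤ × ℤ → ℝ := fun a => latticeDist a
    have hf : ∀ c, IsCenter c → ∀ j, |f (c + unit j) - f c| ≤ 1 := fun c hc j => by
      rcases eq_or_ne j 0 with rfl | hj
      · simp [unit_zero]
      · exact hlip (latticeGraph_adj_center hc hj).symm
    have hsub : subdivide f ((3 : ℤ) • a) = f a := by
      refine (latticeGraph_adj_induction (p := fun a b => subdivide f ((3 : ℤ) • a) = f a ∧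
        subdivide f ((3 : ℤ) • b) = f b) (fun a b h => h.symm) (fun c j hc hj =>
          ⟨subdivide_center hc f, subdivide_corner hc f j⟩) h).1
    have h3 : latticeGraph.Reachable 0 ((3 : ℤ) • a) := by simpa using reachable_three_smul hra
    have := le_mul_dist (G := latticeGraph) (f := subdivide f) (L := 1 / 3)
      (fun a b hab => by
        refine latticeGraph_adj_induction (p := fun a b => |subdivide f a - subdivide f b| ≤ 1 / 3)
          (fun a b h => by rwa [abs_sub_comm]) (fun c j hc hj => ?_) hab
        obtain ⟨c', i, hc', rfl⟩ := hc.exists_eq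
        rw [abs_sub_comm]
        exact abs_subdivide_sub_le hc' (hf c' hc') i j) h3
    have h0 : subdivide f 0 = 0 := by
      have := subdivide_center isCenter_zero f
      simpa [f, latticeDist_zero] using this
    rw [hsub, h0, sub_zero] at this
    have h4 : f a ≤ 1 / 3 * latticeDist ((3 : ℤ) • a) := (le_abs_self _).trans this
    have h5 : (3 : ℝ) * latticeDist a ≤ latticeDist ((3 : ℤ) • a) := by
      change (latticeDist a : ℝ) ≤ _ at h4
      linarith
    exact_mod_cast h5

/-- The orientation away from the center is compatible with subdivision. -/
theorem latticeDist_thirds {a b : ℤ × ℤ} (h : latticeGraph.Adj a b)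
    (hlt : latticeDist a < latticeDist b) :
    latticeDist ((3 : ℤ) • a) < latticeDist ((2 : ℤ) • a + b) ∧
    latticeDist ((2 : ℤ) • a + b) < latticeDist (a + (2 : ℤ) • b) ∧
    latticeDist (a + (2 : ℤ) • b) < latticeDist ((3 : ℤ) • b) := by
  obtain ⟨h1, h2, h3⟩ := latticeGraph_adj_thirds h
  -- The distances at the two ends differ by at least `3`, while each of the three steps changes the
  -- distance by exactly one, so all three increase it.
  have e1 := latticeDist_three_smul h
  have e2 := latticeDist_three_smul h.symm
  have k1 := latticeDist_adj h1
  have k2 := latticeDist_adj h2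
  have k3 := latticeDist_adj h3
  omega

end Lattice

/-! ### Dictionary between the lattice and the cable systems in the plane -/

section Embedding

/-- The point of the plane with given coordinates with respect to the basis `q 2, q 1`. -/
def plane (x y : ℝ) : ℂ := x * q 2 + y * q 1

theorem normSq_plane (x y : ℝ) : ‖plane x y‖ ^ 2 = x ^ 2 + y ^ 2 := by
  have h2 : √2 * √2 = 2 := Real.mul_self_sqrt (by norm_num)
  rw [← Complex.normSq_eq_norm_sq, Complex.normSq_apply]
  simp [plane, q]
  linear_combination (x ^ 2 + y ^ 2) / 2 * h2

theorem plane_sub (x y x' y' : ℝ) : plane x y - plane x' y' = plane (x - x') (y - y') := by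
  simp [plane]; ring

theorem plane_inj {x y x' y' : ℝ} (h : plane x y = plane x' y') : x = x' ∧ y = y' := by
  have h1 := normSq_plane (x - x') (y - y')
  rw [← plane_sub, h, sub_self, norm_zero] at h1
  constructor <;> nlinarith [sq_nonneg (x - x'), sq_nonneg (y - y')]

/-- The embedding of the lattice in the plane at level `n`. -/
def emb (n : ℕ) (p : ℤ × ℤ) : ℂ := ((3 : ℂ) ^ n)⁻¹ * plane p.1 p.2

theorem emb_add (n : ℕ) (p r : ℤ × ℤ) : emb n (p + r) = emb n p + emb n r := by
  simp [emb, plane]; ring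

theorem emb_zsmul (n : ℕ) (k : ℤ) (p : ℤ × ℤ) : emb n (k • p) = k * emb n p := by
  simp [emb, plane]; ring

theorem emb_zero_apply (n : ℕ) : emb n 0 = 0 := by simp [emb, plane]

theorem emb_succ (n : ℕ) (p : ℤ × ℤ) : emb (n + 1) ((3 : ℤ) • p) = emb n p := by
  rw [emb_zsmul, emb, emb, pow_succ]
  push_cast
  field_simp

theorem emb_unit (n : ℕ) (i : Fin 5) : emb n (unit i) = ((3 : ℂ) ^ n)⁻¹ * q i := by
  have : plane (unit i).1 (unit i).2 = q i := by
    fin_cases i <;> apply Complex.ext <;> simp [plane, unit, q]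
  rw [emb, this]

theorem emb_injective (n : ℕ) : Function.Injective (emb n) := fun p r h => by
  have h1 : plane p.1 p.2 = plane r.1 r.2 :=
    mul_left_cancel₀ (inv_ne_zero (pow_ne_zero n (by norm_num))) h
  obtain ⟨h2, h3⟩ := plane_inj h1
  exact Prod.ext (by exact_mod_cast h2) (by exact_mod_cast h3)

theorem ψ_emb (m : ℕ) (p : ℤ × ℤ) (i : Fin 5) :
    ψ i (emb m p) = emb (m + 1) (p + (2 * 3 ^ m : ℤ) • unit i) := by
  rw [emb_add, emb_zsmul, emb_unit, ψ, emb, emb, pow_succ]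
  push_cast
  field_simp
  ring

theorem mem_edgesK_iff {m : ℕ} {e : ℂ × ℂ} : e ∈ edgesK m ↔
    ∃ c j, IsCenterIn m c ∧ j ≠ 0 ∧ e = (emb m c, emb m (c + unit j)) := by
  induction m generalizing e with
  | zero =>
    have hq : ∀ j, ((q 0, q j) : ℂ × ℂ) = (emb 0 0, emb 0 (0 + unit j)) := fun j => by
      rw [zero_add, emb_unit, emb_zero_apply]; simp [q]
    constructor
    · rintro ⟨j, hj, rfl⟩
      exact ⟨0, j, .zero, hj, hq j⟩
    · rintro ⟨c, j, hc, hj, rfl⟩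
      cases hc
      exact ⟨j, hj, (hq j).symm⟩
  | succ m ih =>
    constructor
    · rintro ⟨i, e', he', rfl⟩
      obtain ⟨c, j, hc, hj, rfl⟩ := ih.mp he'
      refine ⟨_, j, hc.add_top i, hj, ?_⟩
      rw [ψ_emb, ψ_emb, add_right_comm]
    · rintro ⟨c, j, hc, hj, rfl⟩
      obtain ⟨c', i, hc', rfl⟩ := hc.exists_top
      refine ⟨i, _, ih.mpr ⟨c', j, hc', hj, rfl⟩, ?_⟩
      rw [ψ_emb, ψ_emb, add_right_comm]

theorem zpow_mul_emb (m n : ℕ) (p : ℤ × ℤ) :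
    (3 : ℂ) ^ ((m : ℤ) - (n : ℤ)) * emb m p = emb n p := by
  rw [emb, emb, zpow_sub₀ (by norm_num)]
  simp only [zpow_natCast]
  field_simp

theorem mem_edges_iff {n : ℕ} {e : ℂ × ℂ} : e ∈ edges n ↔
    ∃ c j, IsCenter c ∧ j ≠ 0 ∧ e = (emb n c, emb n (c + unit j)) := by
  constructor
  · rintro ⟨m, e', he', rfl⟩
    obtain ⟨c, j, hc, hj, rfl⟩ := mem_edgesK_iff.mp he'
    exact ⟨c, j, ⟨m, hc⟩, hj, by simp only [zpow_mul_emb]⟩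
  · rintro ⟨c, j, ⟨m, hc⟩, hj, rfl⟩
    exact ⟨m, _, mem_edgesK_iff.mpr ⟨c, j, hc, hj, rfl⟩, by simp only [zpow_mul_emb]⟩

theorem graph_adj_emb {n : ℕ} {a b : ℤ × ℤ} (h : latticeGraph.Adj a b) :
    (graph n).Adj (emb n a) (emb n b) := by
  refine latticeGraph_adj_induction (p := fun a b => (graph n).Adj (emb n a) (emb n b))
    (fun a b h => h.symm) (fun c j hc hj => ?_) h
  rw [graph, SimpleGraph.fromRel_adj]
  exact ⟨(emb_injective n).ne (latticeGraph_adj_center hc hj).ne,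
    Or.inl (mem_edges_iff.mpr ⟨c, j, hc, hj, rfl⟩)⟩

theorem exists_of_graph_adj {n : ℕ} {u v : ℂ} (h : (graph n).Adj u v) :
    ∃ a b, latticeGraph.Adj a b ∧ u = emb n a ∧ v = emb n b := by
  rw [graph, SimpleGraph.fromRel_adj] at h
  obtain ⟨-, h | h⟩ := h
  · obtain ⟨c, j, hc, hj, he⟩ := mem_edges_iff.mp h
    obtain ⟨rfl, rfl⟩ := Prod.mk.inj he
    exact ⟨_, _, latticeGraph_adj_center hc hj, rfl, rfl⟩
  · obtain ⟨c, j, hc, hj, he⟩ := mem_edges_iff.mp h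
    obtain ⟨rfl, rfl⟩ := Prod.mk.inj he
    exact ⟨_, _, (latticeGraph_adj_center hc hj).symm, rfl, rfl⟩

theorem dist_map_le {V W : Type*} {G : SimpleGraph V} {H : SimpleGraph W} (f : G →g H) {a b : V}
    (h : G.Reachable a b) : H.dist (f a) (f b) ≤ G.dist a b := by
  obtain ⟨w, hw⟩ := h.exists_walk_length_eq_dist
  rw [← hw, ← SimpleGraph.Walk.length_map f]
  exact SimpleGraph.dist_le _

/-- Graph homomorphisms do not increase distances, and `emb n` has one as left inverse. Reachability
is carried along because `dist` is `0` between vertices in different components. -/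
theorem graph_dist_emb (n : ℕ) {a b : ℤ × ℤ} (hab : latticeGraph.Adj a b) :
    (graph n).dist 0 (emb n a) = latticeDist a := by
  let f : latticeGraph →g graph n := ⟨emb n, graph_adj_emb⟩
  let g : graph n →g latticeGraph := ⟨Function.invFun (emb n), fun {u v} h => by
    obtain ⟨a, b, hab, rfl, rfl⟩ := exists_of_graph_adj h
    rwa [Function.leftInverse_invFun (emb_injective n), Function.leftInverse_invFun
      (emb_injective n)]⟩
  have hg : ∀ a, g (emb n a) = a := Function.leftInverse_invFun (emb_injective n)
  have hf0 : f 0 = 0 := emb_zero_apply n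
  have hg0 : g 0 = 0 := by
    have := hg 0
    rwa [emb_zero_apply] at this
  have hr := reachable_of_adj hab
  apply le_antisymm
  · have := dist_map_le f hr
    rwa [hf0] at this
  · have hr' : (graph n).Reachable 0 (emb n a) := by
      have := hr.map f
      rwa [hf0] at this
    have := dist_map_le g hr'
    rwa [hg0, hg] at this

theorem distCenter_lt_iff (n : ℕ) {a b : ℤ × ℤ} (hab : latticeGraph.Adj a b) :
    distCenter n (emb n a) < distCenter n (emb n b) ↔ latticeDist a < latticeDist b := by
  rw [distCenter, distCenter, graph_dist_emb n hab, graph_dist_emb n hab.symm,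
    mul_lt_mul_iff_right₀ (by positivity)]
  exact_mod_cast Iff.rfl

end Embedding

/-! ### Length measure on edges, and functions with vanishing integral on all edges -/

section Segments

/-- The line through `u` with direction `d`. -/
def line (u d : ℂ) (s : ℝ) : ℂ := u + s * d

theorem isometry_line (u : ℂ) {d : ℂ} (hd : ‖d‖ = 1) : Isometry (line u d) := by
  refine Isometry.of_dist_eq fun s t => ?_
  rw [line, line, dist_add_left, dist_eq_norm, ← sub_mul, norm_mul, hd, mul_one,
    ← Complex.ofReal_sub, Complex.norm_real, Real.dist_eq, Real.norm_eq_abs]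

theorem image_line_Icc (u d : ℂ) {s t : ℝ} (hst : s ≤ t) :
    line u d '' Set.Icc s t = segment ℝ (line u d s) (line u d t) := by
  have : line u d = AffineMap.lineMap u (u + d) := by
    ext1 s
    simp [line, AffineMap.lineMap_apply, add_comm]
  rw [this, ← image_segment, segment_eq_Icc hst]

/-- The arc length parametrisation is an isometry, and on `ℝ` the one-dimensional Hausdorff measure
is Lebesgue measure. -/
theorem restrict_segment (u : ℂ) {d : ℂ} (hd : ‖d‖ = 1) {s t : ℝ} (hst : s ≤ t) :
    (Measure.hausdorffMeasure 1).restrict (segment ℝ (line u d s) (line u d t)) =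
      (volume.restrict (Set.Icc s t)).map (line u d) := by
  have hi := isometry_line u hd
  have hS : MeasurableSet (segment ℝ (line u d s) (line u d t)) := by
    rw [← image_line_Icc u d hst]
    exact (isCompact_Icc.image hi.continuous).measurableSet
  have h1 := hi.map_hausdorffMeasure (d := 1) (Or.inl zero_le_one)
  have h2 : line u d ⁻¹' segment ℝ (line u d s) (line u d t) = Set.Icc s t := by
    rw [← image_line_Icc u d hst, Set.preimage_image_eq _ hi.injective]
  rw [hausdorffMeasure_real] at h1
  rw [← h2, ← Measure.restrict_map hi.continuous.measurable hS, h1,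
    Measure.restrict_restrict hS, Set.inter_eq_left.mpr]
  rw [← image_line_Icc u d hst]
  exact Set.image_subset_range _ _

theorem measurableEmbedding_line (u : ℂ) {d : ℂ} (hd : ‖d‖ = 1) : MeasurableEmbedding (line u d) :=
  (isometry_line u hd).isClosedEmbedding.measurableEmbedding

theorem measurableSet_segment (u v : ℂ) : MeasurableSet (segment ℝ u v) := by
  rw [segment_eq_image_lineMap]
  exact (isCompact_Icc.image AffineMap.lineMap_continuous).measurableSet

/-- The direction of an edge. -/
def dir (n : ℕ) (a b : ℤ × ℤ) : ℂ := 3 ^ n * (emb n b - emb n a)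

theorem norm_emb_sub {n : ℕ} {a b : ℤ × ℤ} (h : latticeGraph.Adj a b) :
    ‖emb n b - emb n a‖ = ((3 : ℝ) ^ n)⁻¹ := by
  refine latticeGraph_adj_induction (p := fun a b => ‖emb n b - emb n a‖ = ((3 : ℝ) ^ n)⁻¹)
    (fun a b h => by rwa [norm_sub_rev]) (fun c j hc hj => ?_) h
  have : ‖plane (unit j).1 (unit j).2‖ = 1 := by
    rw [← sq_eq_sq₀ (norm_nonneg _) zero_le_one, normSq_plane]
    fin_cases j <;> simp [unit] at hj ⊢
  rw [emb_add, add_sub_cancel_left, emb, norm_mul, this]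
  simp

theorem norm_dir {n : ℕ} {a b : ℤ × ℤ} (h : latticeGraph.Adj a b) : ‖dir n a b‖ = 1 := by
  rw [dir, norm_mul, norm_emb_sub h]
  simp

theorem line_dir (n : ℕ) (a b : ℤ × ℤ) (s : ℝ) :
    line (emb n a) (dir n a b) (s * ((3 : ℝ) ^ n)⁻¹) = emb n a + s * (emb n b - emb n a) := by
  rw [line, dir]
  push_cast
  field_simp

theorem line_dir_zero (n : ℕ) (a b : ℤ × ℤ) : line (emb n a) (dir n a b) 0 = emb n a := by
  simp [line]

theorem line_dir_one (n : ℕ) (a b : ℤ × ℤ) :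
    line (emb n a) (dir n a b) ((3 : ℝ) ^ n)⁻¹ = emb n b := by
  have := line_dir n a b 1
  simpa using this

theorem segment_subset_skeleton {n : ℕ} {a b : ℤ × ℤ} (h : latticeGraph.Adj a b) :
    segment ℝ (emb n a) (emb n b) ⊆ skeleton := by
  refine latticeGraph_adj_induction (p := fun a b => segment ℝ (emb n a) (emb n b) ⊆ skeleton)
    (fun a b h => by rwa [segment_symm]) (fun c j hc hj => ?_) h
  intro x hx
  exact Set.mem_iUnion.mpr ⟨n, Set.mem_iUnion₂.mpr ⟨_, mem_edges_iff.mpr ⟨c, j, hc, hj, rfl⟩, hx⟩⟩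

theorem ν_restrict_segment {n : ℕ} {a b : ℤ × ℤ} (h : latticeGraph.Adj a b) :
    ν.restrict (segment ℝ (emb n a) (emb n b)) =
      (Measure.hausdorffMeasure 1).restrict (segment ℝ (emb n a) (emb n b)) := by
  rw [ν, Measure.restrict_restrict (measurableSet_segment _ _),
    Set.inter_eq_left.mpr (segment_subset_skeleton h)]

theorem ν_segment {n : ℕ} {a b : ℤ × ℤ} (h : latticeGraph.Adj a b) :
    ν (segment ℝ (emb n a) (emb n b)) = ENNReal.ofReal ((3 : ℝ) ^ n)⁻¹ := by
  rw [← Measure.restrict_apply_self, ν_restrict_segment h, Measure.restrict_apply_self,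
    hausdorffMeasure_segment, edist_dist, dist_comm, dist_eq_norm, norm_emb_sub h]

/-- The restriction of the length measure to part of an edge, as the image of Lebesgue measure. -/
theorem ν_restrict_line {n : ℕ} {a b : ℤ × ℤ} (h : latticeGraph.Adj a b) {s t : ℝ} (hs : 0 ≤ s)
    (hst : s ≤ t) (ht : t ≤ ((3 : ℝ) ^ n)⁻¹) :
    ν.restrict (segment ℝ (line (emb n a) (dir n a b) s) (line (emb n a) (dir n a b) t)) =
      (volume.restrict (Set.Icc s t)).map (line (emb n a) (dir n a b)) := by
  rw [← restrict_segment _ (norm_dir h) hst, ν, Measure.restrict_restrict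
    (measurableSet_segment _ _), Set.inter_eq_left.mpr]
  refine Set.Subset.trans ?_ (segment_subset_skeleton (n := n) h)
  have h2 := image_line_Icc (emb n a) (dir n a b) (hs.trans (hst.trans ht))
  rw [line_dir_zero, line_dir_one] at h2
  rw [← image_line_Icc _ _ hst, ← h2]
  exact Set.image_mono (Set.Icc_subset_Icc hs ht)

theorem setIntegral_line {n : ℕ} {a b : ℤ × ℤ} (h : latticeGraph.Adj a b) {s t : ℝ} (hs : 0 ≤ s)
    (hst : s ≤ t) (ht : t ≤ ((3 : ℝ) ^ n)⁻¹) (g : ℂ → ℝ) :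
    ∫ x in segment ℝ (line (emb n a) (dir n a b) s) (line (emb n a) (dir n a b) t), g x ∂ν =
      ∫ r in s..t, g (line (emb n a) (dir n a b) r) := by
  rw [ν_restrict_line h hs hst ht, (measurableEmbedding_line _ (norm_dir h)).integral_map,
    intervalIntegral.integral_of_le hst, integral_Icc_eq_integral_Ioc]

theorem intervalIntegrable_line {n : ℕ} {a b : ℤ × ℤ} (h : latticeGraph.Adj a b) {g : ℂ → ℝ}
    (hg : IntegrableOn g (segment ℝ (emb n a) (emb n b)) ν) :
    IntervalIntegrable (fun r => g (line (emb n a) (dir n a b) r)) volume 0 ((3 : ℝ) ^ n)⁻¹ := by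
  have h0 : (0 : ℝ) ≤ ((3 : ℝ) ^ n)⁻¹ := by positivity
  have h1 := ν_restrict_line h le_rfl h0 le_rfl
  rw [line_dir_zero, line_dir_one] at h1
  rw [IntegrableOn, h1, (measurableEmbedding_line _ (norm_dir h)).integrable_map_iff] at hg
  rw [intervalIntegrable_iff_integrableOn_Icc_of_le h0]
  exact hg

/-- Additivity of the integral under subdivision of an edge. -/
theorem setIntegral_thirds {n : ℕ} {a b : ℤ × ℤ} (h : latticeGraph.Adj a b) {g : ℂ → ℝ}
    (hg : IntegrableOn g (segment ℝ (emb n a) (emb n b)) ν) :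
    ∫ x in segment ℝ (emb n a) (emb n b), g x ∂ν =
      (∫ x in segment ℝ (emb (n + 1) ((3 : ℤ) • a)) (emb (n + 1) ((2 : ℤ) • a + b)), g x ∂ν) +
      (∫ x in segment ℝ (emb (n + 1) ((2 : ℤ) • a + b)) (emb (n + 1) (a + (2 : ℤ) • b)),
        g x ∂ν) +
      ∫ x in segment ℝ (emb (n + 1) (a + (2 : ℤ) • b)) (emb (n + 1) ((3 : ℤ) • b)), g x ∂ν := by
  set L := ((3 : ℝ) ^ n)⁻¹ with hL
  have hL0 : 0 < L := by positivity
  have hi := intervalIntegrable_line h hg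
  have hthird : ∀ (p : ℤ × ℤ), emb (n + 1) p = (1 / 3 : ℂ) * emb n p := fun p => by
    rw [emb, emb, pow_succ]; field_simp
  have e0 : emb (n + 1) ((3 : ℤ) • a) = line (emb n a) (dir n a b) 0 := by
    rw [emb_succ, line_dir_zero]
  have e1 : emb (n + 1) ((2 : ℤ) • a + b) = line (emb n a) (dir n a b) (1 / 3 * L) := by
    rw [line_dir, hthird, emb_add, emb_zsmul]; push_cast; ring
  have e2 : emb (n + 1) (a + (2 : ℤ) • b) = line (emb n a) (dir n a b) (2 / 3 * L) := by
    rw [line_dir, hthird, emb_add, emb_zsmul]; push_cast; ring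
  have e3 : emb (n + 1) ((3 : ℤ) • b) = line (emb n a) (dir n a b) L := by
    rw [emb_succ, line_dir_one]
  have h0 := setIntegral_line h le_rfl hL0.le le_rfl g
  rw [line_dir_zero, line_dir_one] at h0
  rw [h0, e0, e1, e2, e3, setIntegral_line h le_rfl (by linarith) (by linarith),
    setIntegral_line h (by linarith) (by linarith) (by linarith),
    setIntegral_line h (by linarith) (by linarith) le_rfl]
  have hsub : ∀ {s t : ℝ}, 0 ≤ s → s ≤ t → t ≤ L →
      IntervalIntegrable (fun r => g (line (emb n a) (dir n a b) r)) volume s t :=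
    fun hs hst ht => hi.mono_set (by
      rw [Set.uIcc_of_le hst, Set.uIcc_of_le hL0.le]
      exact Set.Icc_subset_Icc hs ht)
  rw [intervalIntegral.integral_add_adjacent_intervals, intervalIntegral.integral_add_adjacent_intervals]
  all_goals apply hsub <;> linarith

theorem ae_eq_zero_of_intervalIntegral_eq_zero {f : ℝ → ℝ} {L : ℝ}
    (hf : IntervalIntegrable f volume 0 L) (h : ∀ t ∈ Set.Icc 0 L, ∫ r in (0 : ℝ)..t, f r = 0) :
    ∀ᵐ r ∂(volume.restrict (Set.Icc 0 L)), f r = 0 := by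
  rcases le_or_gt L 0 with hL | hL
  · rcases hL.eq_or_lt with rfl | hL
    · simp
    · simp [Set.Icc_eq_empty_of_lt hL]
  rw [← restrict_Ioo_eq_restrict_Icc, ae_restrict_iff' measurableSet_Ioo]
  filter_upwards [hf.ae_hasDerivAt_integral] with x hx hxL
  rw [Set.uIcc_of_le hL.le] at hx
  have h1 := hx ⟨hxL.1.le, hxL.2.le⟩ 0 ⟨le_rfl, hL.le⟩
  have h2 : HasDerivAt (fun x => ∫ t in (0 : ℝ)..x, f t) 0 x := by
    refine (hasDerivAt_const x (0 : ℝ)).congr_of_eventuallyEq ?_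
    filter_upwards [isOpen_Ioo.mem_nhds hxL] with y hy
    exact h y ⟨hy.1.le, hy.2.le⟩
  exact h1.unique h2

/-- The vertices of level `m` on an edge. -/
def subVertex (m : ℕ) (a b : ℤ × ℤ) (k : ℤ) : ℤ × ℤ := (3 ^ m - k : ℤ) • a + k • b

theorem subVertex_adj {a b : ℤ × ℤ} (h : latticeGraph.Adj a b) (m : ℕ) {k : ℤ} (hk : 0 ≤ k)
    (hk' : k < 3 ^ m) : latticeGraph.Adj (subVertex m a b k) (subVertex m a b (k + 1)) := by
  induction m generalizing k with
  | zero =>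
    obtain rfl : k = 0 := by simp at hk'; omega
    simpa [subVertex] using h
  | succ m ih =>
    have hp : (3 : ℤ) ^ (m + 1) = 3 * 3 ^ m := by ring
    obtain ⟨l, r, hr0, hr3, rfl⟩ : ∃ l r : ℤ, 0 ≤ r ∧ r < 3 ∧ k = 3 * l + r :=
      ⟨k / 3, k % 3, by omega, by omega, by omega⟩
    obtain ⟨h1, h2, h3⟩ := latticeGraph_adj_thirds (ih (k := l) (by omega) (by omega))
    simp only [subVertex, hp] at *
    interval_cases r
    · convert! h1 using 1 <;> module
    · convert! h2 using 1 <;> module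
    · convert! h3 using 1 <;> module

theorem emb_subVertex (n m : ℕ) (a b : ℤ × ℤ) (k : ℤ) :
    emb (n + m) (subVertex m a b k) =
      line (emb n a) (dir n a b) (k / 3 ^ m * ((3 : ℝ) ^ n)⁻¹) := by
  rw [line_dir, subVertex, emb_add, emb_zsmul, emb_zsmul]
  simp only [emb, pow_add]
  push_cast
  field_simp
  ring

/-- The primitive of `g` along the edge vanishes at all triadic points, the vertices of finer
levels, hence everywhere by continuity. Lebesgue differentiation then gives `g = 0`. -/
theorem ae_eq_zero_on_segment {n : ℕ} {a b : ℤ × ℤ} (h : latticeGraph.Adj a b) {g : ℂ → ℝ}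
    (hg : IntegrableOn g (segment ℝ (emb n a) (emb n b)) ν)
    (h0 : ∀ n a b, latticeGraph.Adj a b → ∫ x in segment ℝ (emb n a) (emb n b), g x ∂ν = 0) :
    ∀ᵐ x ∂(ν.restrict (segment ℝ (emb n a) (emb n b))), g x = 0 := by
  have hi := intervalIntegrable_line h hg
  set L := ((3 : ℝ) ^ n)⁻¹ with hL
  have hL0 : 0 < L := by positivity
  set f : ℝ → ℝ := fun r => g (line (emb n a) (dir n a b) r) with hf
  have hsub : ∀ {s t : ℝ}, 0 ≤ s → s ≤ t → t ≤ L → IntervalIntegrable f volume s t :=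
    fun hs hst ht => hi.mono_set (by
      rw [Set.uIcc_of_le hst, Set.uIcc_of_le hL0.le]
      exact Set.Icc_subset_Icc hs ht)
  have hle : ∀ (m k : ℕ), k ≤ 3 ^ m → (k : ℝ) / 3 ^ m * L ≤ L := fun m k hk => by
    have : (k : ℝ) / 3 ^ m ≤ 1 := by
      rw [div_le_one (by positivity)]; exact_mod_cast hk
    nlinarith
  have htri : ∀ (m k : ℕ), k ≤ 3 ^ m → ∫ r in (0 : ℝ)..(k / 3 ^ m * L), f r = 0 := by
    intro m k hk
    induction k with
    | zero => simp
    | succ k ih =>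
      have h1 : (k : ℝ) / 3 ^ m * L ≤ ((k + 1 : ℕ) : ℝ) / 3 ^ m * L := by
        push_cast; gcongr; linarith
      have hk0 : 0 ≤ (k : ℝ) / 3 ^ m * L := by positivity
      have h2 := setIntegral_line h hk0 h1 (hle m _ hk) g
      have h3 := h0 (n + m) _ _ (subVertex_adj h m (k := k) (by positivity) (by exact_mod_cast hk))
      rw [emb_subVertex, emb_subVertex] at h3
      push_cast at h2 h3
      rw [h2] at h3
      have h4 := hle m _ hk
      push_cast at h1 h4 ⊢
      rw [← intervalIntegral.integral_add_adjacent_intervals (hsub le_rfl hk0 (h1.trans h4))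
        (hsub hk0 h1 h4), ih (by omega), h3, add_zero]
  have hall : ∀ t ∈ Set.Icc 0 L, ∫ r in (0 : ℝ)..t, f r = 0 := by
    intro t ht
    have hc : ContinuousOn (fun t => ∫ r in (0 : ℝ)..t, f r) (Set.Icc 0 L) := by
      have := intervalIntegral.continuousOn_primitive_interval' hi Set.left_mem_uIcc
      rwa [Set.uIcc_of_le hL0.le] at this
    have h3 : Tendsto (fun m : ℕ => ((3 : ℝ) ^ m)) atTop atTop :=
      tendsto_pow_atTop_atTop_of_one_lt (by norm_num)
    -- The triadic points of the edge approximating `t` from below.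
    have hlim : Tendsto (fun m : ℕ => (⌊t / L * 3 ^ m⌋₊ : ℝ) / 3 ^ m * L) atTop (𝓝 t) := by
      have h4 := ((tendsto_nat_floor_mul_div_atTop (R := ℝ) (div_nonneg ht.1 hL0.le)).comp
        h3).mul_const L
      rw [div_mul_cancel₀ _ hL0.ne'] at h4
      exact h4
    have hfl : ∀ m : ℕ, ⌊t / L * 3 ^ m⌋₊ ≤ 3 ^ m := fun m => by
      refine Nat.floor_le_of_le ?_
      push_cast
      have : t / L ≤ 1 := (div_le_one hL0).mpr ht.2
      have h5 : (0 : ℝ) < 3 ^ m := by positivity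
      nlinarith
    have hlim' : Tendsto (fun m : ℕ => (⌊t / L * 3 ^ m⌋₊ : ℝ) / 3 ^ m * L) atTop
        (𝓝[Set.Icc 0 L] t) := by
      rw [tendsto_nhdsWithin_iff]
      exact ⟨hlim, Eventually.of_forall fun m => ⟨by positivity, hle m _ (hfl m)⟩⟩
    have h6 := (hc t ht).tendsto.comp hlim'
    refine tendsto_nhds_unique h6 ?_
    refine tendsto_const_nhds.congr fun m => ?_
    exact (htri m _ (hfl m)).symm
  have hae := ae_eq_zero_of_intervalIntegral_eq_zero hi hall
  have h1 := ν_restrict_line h le_rfl hL0.le le_rfl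
  rw [line_dir_zero, line_dir_one] at h1
  rw [h1, (measurableEmbedding_line _ (norm_dir h)).ae_map_iff]
  exact hae

theorem skeleton_eq : skeleton = ⋃ (n : ℕ) (e : {e : (ℤ × ℤ) × (ℤ × ℤ) // latticeGraph.Adj e.1 e.2}),
    segment ℝ (emb n e.1.1) (emb n e.1.2) := by
  apply Set.Subset.antisymm
  · rintro x hx
    obtain ⟨n, hx⟩ := Set.mem_iUnion.mp hx
    obtain ⟨e, he, hx⟩ := Set.mem_iUnion₂.mp hx
    obtain ⟨c, j, hc, hj, rfl⟩ := mem_edges_iff.mp he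
    exact Set.mem_iUnion₂.mpr ⟨n, ⟨(c, c + unit j), latticeGraph_adj_center hc hj⟩, hx⟩
  · refine Set.iUnion₂_subset fun n e => segment_subset_skeleton e.2

/-- A property holds almost everywhere on the skeleton if it does on every edge. -/
theorem ae_ν_of_forall_segment {p : ℂ → Prop}
    (h : ∀ n a b, latticeGraph.Adj a b →
      ∀ᵐ x ∂(ν.restrict (segment ℝ (emb n a) (emb n b))), p x) : ∀ᵐ x ∂ν, p x := by
  have h1 : ν = ν.restrict skeleton := by
    have hm : MeasurableSet skeleton := by
      rw [skeleton_eq]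
      exact MeasurableSet.iUnion fun n => MeasurableSet.iUnion fun e => measurableSet_segment _ _
    rw [ν, Measure.restrict_restrict hm, Set.inter_self]
  rw [h1, skeleton_eq, ae_restrict_iUnion_iff]
  intro n
  rw [ae_restrict_iUnion_iff]
  exact fun e => h n _ _ e.2

end Segments

/-! ### Cells of `X` and how they meet -/

section Cells

theorem norm_q {i : Fin 5} (hi : i ≠ 0) : ‖q i‖ = 1 := by
  have h := norm_emb_sub (n := 0) (latticeGraph_adj_center isCenter_zero hi)
  simpa [emb_unit, emb_zero_apply] using h

theorem norm_coding_le (w : ℕ → Fin 5) : ‖coding w‖ ≤ 1 := by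
  have h1 : HasSum (fun k : ℕ => (2 / 3 : ℝ) * (1 / 3) ^ k) 1 := by
    have := (hasSum_geometric_of_lt_one (r := (1 / 3 : ℝ)) (by norm_num) (by norm_num)).mul_left
      (2 / 3 : ℝ)
    norm_num at this ⊢
    exact this
  refine tsum_of_norm_bounded h1 fun k => ?_
  rw [norm_mul, norm_mul, norm_pow]
  have h := norm_q_le (w k)
  have h3 : (0 : ℝ) < (1 / 3) ^ k := by positivity
  norm_num only [norm_div, norm_one, Complex.norm_ofNat] at h3 ⊢
  nlinarith [norm_nonneg (q (w k))]

theorem norm_le_of_mem_K {z : ℂ} (hz : z ∈ K) : ‖z‖ ≤ 1 := by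
  obtain ⟨w, rfl⟩ := hz
  exact norm_coding_le w

theorem ψ_mem_K {z : ℂ} (hz : z ∈ K) (i : Fin 5) : ψ i z ∈ K := by
  rw [K_eq_iUnion]
  exact Set.mem_iUnion.mpr ⟨i, z, hz, rfl⟩

theorem zero_mem_K : (0 : ℂ) ∈ K := ⟨fun _ => 0, by simp [coding, q]⟩

theorem q_mem_K (i : Fin 5) : q i ∈ K := by
  refine ⟨fun _ => i, ?_⟩
  have h := coding_eq fun _ => i
  simp only [ψ] at h
  linear_combination (3 / 2 : ℂ) * h

/-- The cell of level `n` centered at the lattice point `c`. -/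
def cell (n : ℕ) (c : ℤ × ℤ) : Set ℂ := (fun z => emb n c + ((3 : ℂ) ^ n)⁻¹ * z) '' K

theorem isCompact_cell (n : ℕ) (c : ℤ × ℤ) : IsCompact (cell n c) :=
  isCompact_K.image (by fun_prop)

theorem emb_mem_cell (n : ℕ) (c : ℤ × ℤ) (j : Fin 5) : emb n (c + unit j) ∈ cell n c :=
  ⟨q j, q_mem_K j, by rw [emb_add, emb_unit]⟩

theorem emb_center_mem_cell (n : ℕ) (c : ℤ × ℤ) : emb n c ∈ cell n c := by
  simpa [unit_zero] using emb_mem_cell n c 0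

theorem dist_le_of_mem_cell {n : ℕ} {c : ℤ × ℤ} {x : ℂ} (hx : x ∈ cell n c) :
    dist x (emb n c) ≤ ((3 : ℝ) ^ n)⁻¹ := by
  obtain ⟨z, hz, rfl⟩ := hx
  rw [dist_eq_norm, add_sub_cancel_left, norm_mul, norm_inv, norm_pow, Complex.norm_ofNat]
  have := norm_le_of_mem_K hz
  have h3 : (0 : ℝ) < ((3 : ℝ) ^ n)⁻¹ := by positivity
  nlinarith

theorem emb_succ_add_ψ (n : ℕ) (c : ℤ × ℤ) (i : Fin 5) (z : ℂ) :
    emb (n + 1) ((3 : ℤ) • c + (2 : ℤ) • unit i) + ((3 : ℂ) ^ (n + 1))⁻¹ * z =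
      emb n c + ((3 : ℂ) ^ n)⁻¹ * ψ i z := by
  rw [emb_add, emb_succ, emb_zsmul, emb_unit, ψ, pow_succ]
  push_cast
  field_simp
  ring

theorem cell_eq_iUnion (n : ℕ) (c : ℤ × ℤ) :
    cell n c = ⋃ i, cell (n + 1) ((3 : ℤ) • c + (2 : ℤ) • unit i) := by
  ext x
  simp only [cell, Set.mem_iUnion, Set.mem_image, emb_succ_add_ψ]
  constructor
  · rintro ⟨z, hz, rfl⟩
    rw [K_eq_iUnion] at hz
    obtain ⟨i, z', hz', rfl⟩ := Set.mem_iUnion.mp hz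
    exact ⟨i, z', hz', rfl⟩
  · rintro ⟨i, z, hz, rfl⟩
    exact ⟨_, ψ_mem_K hz i, rfl⟩

theorem cell_succ_subset (n : ℕ) (c : ℤ × ℤ) (i : Fin 5) :
    cell (n + 1) ((3 : ℤ) • c + (2 : ℤ) • unit i) ⊆ cell n c := by
  rw [cell_eq_iUnion n c]
  exact Set.subset_iUnion (fun i => cell (n + 1) ((3 : ℤ) • c + (2 : ℤ) • unit i)) i

/-- The center of the cell of generation `m` coded by `w`. -/
def wordCenter (w : ℕ → Fin 5) : ℕ → ℤ × ℤ
  | 0 => 0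
  | m + 1 => (3 : ℤ) • wordCenter w m + (2 : ℤ) • unit (w m)

theorem isCenterIn_wordCenter (w : ℕ → Fin 5) (m : ℕ) : IsCenterIn m (wordCenter w m) := by
  induction m with
  | zero => exact .zero
  | succ m ih => exact .step m _ _ ih

theorem coding_eq_wordCenter (w : ℕ → Fin 5) (m : ℕ) :
    coding w = emb m (wordCenter w m) + ((3 : ℂ) ^ m)⁻¹ * coding fun k => w (k + m) := by
  induction m with
  | zero => simp [wordCenter, emb_zero_apply]
  | succ m ih =>
    rw [ih, wordCenter, emb_succ_add_ψ, coding_eq fun k => w (k + m)]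
    simp only [zero_add, add_assoc, add_comm 1 m]

theorem pow_mul_emb (m n : ℕ) (p : ℤ × ℤ) : (3 : ℂ) ^ m * emb (m + n) p = emb n p := by
  rw [emb, emb, pow_add]
  field_simp

theorem mem_cell_of_coding (w : ℕ → Fin 5) (m n : ℕ) :
    (3 : ℂ) ^ m * coding w ∈ cell n (wordCenter w (m + n)) := by
  refine ⟨coding fun k => w (k + (m + n)), ⟨_, rfl⟩, ?_⟩
  simp only
  rw [coding_eq_wordCenter w (m + n), mul_add, pow_mul_emb, pow_add]
  field_simp

theorem blowUp_mono : Monotone blowUp := by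
  refine monotone_nat_of_le_succ fun m => ?_
  rintro _ ⟨z, hz, rfl⟩
  refine ⟨ψ 0 z, ψ_mem_K hz 0, ?_⟩
  simp only [ψ, q, pow_succ]
  simp
  ring

theorem isCompact_blowUp (m : ℕ) : IsCompact (blowUp m) := isCompact_K.image (by fun_prop)

theorem blowUp_subset_X (m : ℕ) : blowUp m ⊆ X := Set.subset_iUnion blowUp m

theorem exists_cell {x : ℂ} (hx : x ∈ X) (n : ℕ) : ∃ c, IsCenter c ∧ x ∈ cell n c := by
  obtain ⟨m, _, ⟨w, rfl⟩, rfl⟩ := Set.mem_iUnion.mp hx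
  exact ⟨_, ⟨_, isCenterIn_wordCenter w (m + n)⟩, mem_cell_of_coding w m n⟩

theorem three_mul_mem_X {x : ℂ} (hx : x ∈ X) : 3 * x ∈ X := by
  obtain ⟨m, z, hz, rfl⟩ := Set.mem_iUnion.mp hx
  refine Set.mem_iUnion.mpr ⟨m + 1, z, hz, ?_⟩
  simp only [pow_succ]
  ring

/-- Multiplication by `3` preserves `X` and maps the `i`-th subcell of a cell of level `n` onto the
next-generation cell of level `n`. -/
theorem cell_subset_X {c : ℤ × ℤ} (hc : IsCenter c) (n : ℕ) : cell n c ⊆ X := by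
  obtain ⟨m, hc⟩ := hc
  induction hc with
  | zero =>
    induction n with
    | zero =>
      rintro _ ⟨z, hz, rfl⟩
      exact blowUp_subset_X 0 ⟨z, hz, by simp [emb_zero_apply]⟩
    | succ n ih =>
      refine Set.Subset.trans ?_ ih
      simpa [unit_zero] using cell_succ_subset n 0 0
  | step m c i hc ih =>
    rintro _ ⟨z, hz, rfl⟩
    have h1 := three_mul_mem_X (ih (Set.mem_image_of_mem _ (ψ_mem_K hz i)))
    simp only at h1 ⊢
    rw [← emb_succ_add_ψ] at h1
    convert! h1 using 1
    rw [emb, emb, pow_succ]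
    field_simp

theorem emb_mem_X {a b : ℤ × ℤ} (h : latticeGraph.Adj a b) (n : ℕ) : emb n a ∈ X :=
  (latticeGraph_adj_induction (p := fun a b => emb n a ∈ X ∧ emb n b ∈ X) (fun _ _ h => h.symm)
    (fun c j hc _ => ⟨cell_subset_X hc n (emb_center_mem_cell n c),
      cell_subset_X hc n (emb_mem_cell n c j)⟩) h).1

/-- In units of the cell radius the two centers are at distance at most `2`, and their coordinates
are even. So distinct intersecting cells are neighbours, with `c + unit j` as a common corner. -/
theorem eq_or_eq_of_mem_cell {n : ℕ} {c c' : ℤ × ℤ} (hc : IsCenter c) (hc' : IsCenter c') {x : ℂ}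
    (hx : x ∈ cell n c) (hx' : x ∈ cell n c') : ∃ j, c' = c + (2 : ℤ) • unit j := by
  obtain ⟨z, hz, rfl⟩ := hx
  obtain ⟨z', hz', he⟩ := hx'
  have h3 : ((3 : ℂ) ^ n) ≠ 0 := pow_ne_zero n (by norm_num)
  have h1 : plane (c'.1 - c.1 : ℝ) (c'.2 - c.2 : ℝ) = z - z' := by
    rw [← plane_sub]
    simp only [emb] at he
    field_simp at he
    linear_combination he
  have h2 := normSq_plane (c'.1 - c.1 : ℝ) (c'.2 - c.2 : ℝ)
  have h4 : ‖z - z'‖ ≤ 2 := (norm_sub_le _ _).trans (by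
    linarith [norm_le_of_mem_K hz, norm_le_of_mem_K hz'])
  have h5 : ((c'.1 - c.1) ^ 2 + (c'.2 - c.2) ^ 2 : ℤ) ≤ 4 := by
    have : ((c'.1 - c.1) ^ 2 + (c'.2 - c.2) ^ 2 : ℝ) ≤ 4 := by
      rw [← h2, h1]; nlinarith [norm_nonneg (z - z')]
    exact_mod_cast this
  obtain ⟨⟨a, ha⟩, ⟨b, hb⟩⟩ := hc.even
  obtain ⟨⟨a', ha'⟩, ⟨b', hb'⟩⟩ := hc'.even
  have h6 : (a' - a) ^ 2 + (b' - b) ^ 2 ≤ 1 := by rw [ha, hb, ha', hb'] at h5; nlinarith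
  have h7 : -1 ≤ a' - a ∧ a' - a ≤ 1 := by constructor <;> nlinarith [sq_nonneg (b' - b)]
  have h8 : -1 ≤ b' - b ∧ b' - b ≤ 1 := by constructor <;> nlinarith [sq_nonneg (a' - a)]
  have : ∃ j, ((a' - a, b' - b) : ℤ × ℤ) = unit j := by
    obtain ⟨h7, h7'⟩ := h7
    obtain ⟨h8, h8'⟩ := h8
    generalize a' - a = r at *
    generalize b' - b = s at *
    interval_cases r <;> interval_cases s <;> first | (exfalso; revert h6; norm_num; done) | decide
  obtain ⟨j, hj⟩ := this
  refine ⟨j, ?_⟩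
  rw [← hj]
  ext <;> simp <;> omega

/-- The four outer copies of `3 ^ k K` in `3 ^ (k + 1) K` have centers of norm `2 * 3 ^ k`, so they
avoid the open ball of radius `3 ^ k`. Locally, `X` is thus one of the compact sets `3 ^ m K`. -/
theorem mem_blowUp_of_norm_lt {x : ℂ} (hx : x ∈ X) {m : ℕ} (hm : ‖x‖ < 3 ^ m) : x ∈ blowUp m := by
  have key : ∀ k, x ∈ blowUp (k + 1) → ‖x‖ < 3 ^ k → x ∈ blowUp k := by
    rintro k ⟨y, hy, rfl⟩ hk
    rw [K_eq_iUnion] at hy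
    obtain ⟨i, z, hz, rfl⟩ := Set.mem_iUnion.mp hy
    have e : (3 : ℂ) ^ (k + 1) * ψ i z = 3 ^ k * (z + 2 * q i) := by
      rw [ψ, pow_succ]; ring
    simp only at hk ⊢
    rw [e] at hk ⊢
    rcases eq_or_ne i 0 with rfl | hi
    · exact ⟨z, hz, by simp [q]⟩
    · exfalso
      rw [norm_mul, norm_pow, Complex.norm_ofNat] at hk
      have h1 : ‖2 * q i‖ = 2 := by rw [norm_mul, norm_q hi]; simp
      have h2 : ‖2 * q i‖ ≤ ‖z + 2 * q i‖ + ‖z‖ := by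
        have := norm_sub_le (z + 2 * q i) z
        rwa [add_sub_cancel_left] at this
      have h3 := norm_le_of_mem_K hz
      have h4 : (0 : ℝ) < 3 ^ k := by positivity
      nlinarith
  obtain ⟨k, hk⟩ := Set.mem_iUnion.mp hx
  rcases le_or_gt k m with hkm | hkm
  · exact blowUp_mono hkm hk
  · obtain ⟨d, rfl⟩ := Nat.exists_eq_add_of_le hkm.le
    clear hkm
    induction d with
    | zero => exact hk
    | succ d ih =>
      refine ih (key _ hk (hm.trans_le ?_))
      exact pow_le_pow_right₀ (by norm_num) (by omega)

end Cells

/-! ### Local finiteness and full support of `μ` -/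

section SelfSimilarMeasure

theorem measurableSet_blowUp (m : ℕ) : MeasurableSet (blowUp m) := (isCompact_blowUp m).measurableSet

instance isProbabilityMeasure_μK : IsProbabilityMeasure μK :=
  Measure.isProbabilityMeasure_map continuous_coding.measurable.aemeasurable

theorem μ_compl_X : μ Xᶜ = 0 := by
  have hX : MeasurableSet X := MeasurableSet.iUnion measurableSet_blowUp
  rw [μ, Measure.sum_apply _ hX.compl, ENNReal.tsum_eq_zero]
  intro m
  rw [Measure.restrict_apply hX.compl]
  have : Xᶜ ∩ disjointed blowUp m = ∅ := by
    rw [Set.eq_empty_iff_forall_notMem]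
    rintro x ⟨hx, hx'⟩
    exact hx (blowUp_subset_X m (disjointed_subset _ _ hx'))
  rw [this, measure_empty]

theorem μ_ball_lt_top (m : ℕ) : μ (Metric.ball 0 (3 ^ m)) < ⊤ := by
  rw [μ, Measure.sum_apply _ Metric.isOpen_ball.measurableSet]
  have hz : ∀ k, k ∉ Finset.range (m + 1) →
      (((5 : ℝ≥0∞) ^ k • μK.map fun z : ℂ => (3 : ℂ) ^ k * z).restrict (disjointed blowUp k))
        (Metric.ball 0 (3 ^ m)) = 0 := by
    intro k hk
    rw [Measure.restrict_apply Metric.isOpen_ball.measurableSet]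
    have : Metric.ball (0 : ℂ) (3 ^ m) ∩ disjointed blowUp k = ∅ := by
      rw [Set.eq_empty_iff_forall_notMem]
      rintro x ⟨hx, hx'⟩
      have h1 : x ∈ blowUp m :=
        mem_blowUp_of_norm_lt (blowUp_subset_X k (disjointed_subset _ _ hx')) (by simpa using hx)
      have h2 : m < k := by simpa using hk
      rw [disjointed_eq_inter_compl] at hx'
      exact Set.mem_iInter₂.mp hx'.2 m h2 h1
    rw [this, measure_empty]
  rw [tsum_eq_sum hz]
  refine ENNReal.sum_lt_top.mpr fun k _ => ?_
  refine (measure_mono (Set.subset_univ _)).trans_lt ?_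
  refine (Measure.restrict_apply_le _ _).trans_lt ?_
  rw [Measure.smul_apply, Measure.map_apply (by fun_prop) MeasurableSet.univ]
  simp

instance isLocallyFiniteMeasure_μ : IsLocallyFiniteMeasure μ := by
  refine ⟨fun x => ?_⟩
  obtain ⟨m, hm⟩ := pow_unbounded_of_one_lt ‖x‖ (show (1 : ℝ) < 3 by norm_num)
  exact ⟨_, Metric.isOpen_ball.mem_nhds (by simpa using hm), μ_ball_lt_top m⟩

theorem μK_pos {U : Set ℂ} (hU : IsOpen U) (h : (U ∩ K).Nonempty) : 0 < μK U := by
  obtain ⟨_, hw, w, rfl⟩ := h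
  rw [μK, Measure.map_apply continuous_coding.measurable hU.measurableSet]
  obtain ⟨I, t, ht, hsub⟩ := isOpen_pi_iff.mp (hU.preimage continuous_coding) w hw
  refine lt_of_lt_of_le ?_ (measure_mono hsub)
  rw [Measure.infinitePi_pi _ fun i hi => MeasurableSet.of_discrete]
  refine pos_iff_ne_zero.mpr (Finset.prod_ne_zero_iff.mpr fun i hi h0 => ?_)
  have h1 := measure_mono_null (Set.singleton_subset_iff.mpr (ht i hi).2) h0
  rw [PMF.toMeasure_apply_singleton _ _ (measurableSet_singleton _)] at h1
  simp at h1

theorem μ_pos {U : Set ℂ} (hU : IsOpen U) (h : (U ∩ X).Nonempty) : 0 < μ U := by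
  classical
  -- With the least `m` for which `U` meets `3 ^ m K`, passing to the disjointed sets removes
  -- nothing from `U`.
  have hex : ∃ m, (U ∩ blowUp m).Nonempty := by
    obtain ⟨x, hx, hx'⟩ := h
    obtain ⟨m, hm⟩ := Set.mem_iUnion.mp hx'
    exact ⟨m, x, hx, hm⟩
  obtain ⟨x, hxU, hx⟩ := Nat.find_spec hex
  set m := Nat.find hex with hm
  have hmin : ∀ k < m, U ∩ blowUp k = ∅ := fun k hk =>
    Set.not_nonempty_iff_eq_empty.mp (Nat.find_min hex hk)
  have hle : ((5 : ℝ≥0∞) ^ m • μK.map fun z : ℂ => (3 : ℂ) ^ m * z).restrict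
      (disjointed blowUp m) U ≤ μ U := by
    rw [μ, Measure.sum_apply _ hU.measurableSet]
    exact ENNReal.le_tsum m
  refine lt_of_lt_of_le ?_ hle
  rw [Measure.restrict_apply hU.measurableSet]
  have he : U ∩ disjointed blowUp m = U ∩ blowUp m := by
    rw [disjointed_eq_inter_compl]
    ext y
    refine ⟨fun hy => ⟨hy.1, hy.2.1⟩, fun hy => ⟨hy.1, hy.2, Set.mem_iInter₂.mpr fun k hk hyk => ?_⟩⟩
    have := hmin k hk
    exact Set.notMem_empty y (this ▸ ⟨hy.1, hyk⟩)
  rw [he, Measure.smul_apply, Measure.map_apply (by fun_prop)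
    (hU.measurableSet.inter (measurableSet_blowUp m)), smul_eq_mul]
  refine ENNReal.mul_pos (by simp) ?_
  have h3 : (3 : ℂ) ^ m ≠ 0 := pow_ne_zero m (by norm_num)
  have hfull : μK Kᶜ = 0 := by
    rw [μK, Measure.map_apply continuous_coding.measurable isCompact_K.measurableSet.compl]
    simp [K, Set.preimage_compl]
  obtain ⟨z, hz, rfl⟩ := hx
  have hpos := μK_pos (hU.preimage (f := fun z : ℂ => (3 : ℂ) ^ m * z) (by fun_prop)) ⟨z, hxU, hz⟩
  have hsub : (fun z : ℂ => (3 : ℂ) ^ m * z) ⁻¹' U ⊆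
      ((fun z : ℂ => (3 : ℂ) ^ m * z) ⁻¹' (U ∩ blowUp m)) ∪ Kᶜ := by
    intro y hy
    by_cases hyK : y ∈ K
    · exact Or.inl ⟨hy, y, hyK, rfl⟩
    · exact Or.inr hyK
  have := measure_mono (μ := μK) hsub
  have h4 := this.trans (measure_union_le _ _)
  rw [hfull, add_zero] at h4
  exact (hpos.trans_le h4).ne'

/-- Continuous functions on `X` which agree almost everywhere agree on `X`. -/
theorem eqOn_of_ae_eq {φ φ' : ℂ → ℝ} (hφ : ContinuousOn φ X) (hφ' : ContinuousOn φ' X)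
    (h : φ =ᵐ[μ] φ') : Set.EqOn φ φ' X := by
  intro x hx
  by_contra hne
  have hc : ContinuousOn (fun x => φ x - φ' x) X := hφ.sub hφ'
  obtain ⟨U, hU, hUX⟩ := continuousOn_iff'.mp hc {0}ᶜ isOpen_compl_singleton
  have hxU : x ∈ U := by
    have : x ∈ (fun x => φ x - φ' x) ⁻¹' {0}ᶜ ∩ X := ⟨by simpa [sub_eq_zero] using hne, hx⟩
    rw [hUX] at this
    exact this.1
  have hpos := μ_pos hU ⟨x, hxU, hx⟩
  have hnull : μ U = 0 := by
    refine measure_mono_null (t := {x | ¬ φ x = φ' x} ∪ Xᶜ) (fun y hy => ?_)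
      (measure_union_null h μ_compl_X)
    by_cases hyX : y ∈ X
    · left
      have : y ∈ (fun x => φ x - φ' x) ⁻¹' {0}ᶜ ∩ X := hUX ▸ ⟨hy, hyX⟩
      simpa [sub_eq_zero] using this.1
    · exact Or.inr hyX
  exact hpos.ne' hnull

end SelfSimilarMeasure

/-! ### The gradient is a closed operator -/

section Gradient

theorem ν_segment_ne_top {n : ℕ} {a b : ℤ × ℤ} (h : latticeGraph.Adj a b) :
    ν (segment ℝ (emb n a) (emb n b)) ≠ ⊤ := by
  rw [ν_segment h]; exact ENNReal.ofReal_ne_top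

theorem integrableOn_segment (g : Lp ℝ 2 ν) {n : ℕ} {a b : ℤ × ℤ} (h : latticeGraph.Adj a b) :
    IntegrableOn g (segment ℝ (emb n a) (emb n b)) ν := by
  have : IsFiniteMeasure (ν.restrict (segment ℝ (emb n a) (emb n b))) :=
    ⟨by rw [Measure.restrict_apply_univ]; exact (ν_segment_ne_top h).lt_top⟩
  exact ((Lp.memLp g).restrict _).integrable (by norm_num)

/-- The rate at which functions of unit energy vary along edges. -/
def rate : ℝ := (√3)⁻¹

theorem rate_pos : 0 < rate := by unfold rate; positivity

theorem rate_lt_one : rate < 1 := by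
  unfold rate
  exact inv_lt_one_of_one_lt₀ (by rw [Real.lt_sqrt] <;> norm_num)

/-- Cauchy–Schwarz on an edge of length `3 ^ (-n)`, whose square root is `rate ^ n`. -/
theorem abs_setIntegral_segment_le (g : Lp ℝ 2 ν) {n : ℕ} {a b : ℤ × ℤ}
    (h : latticeGraph.Adj a b) :
    |∫ x in segment ℝ (emb n a) (emb n b), g x ∂ν| ≤ rate ^ n * ‖g‖ := by
  rw [← L2.inner_indicatorConstLp_one (𝕜 := ℝ) (measurableSet_segment _ _) (ν_segment_ne_top h) g]
  refine (abs_real_inner_le_norm _ _).trans ?_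
  rw [norm_indicatorConstLp (by norm_num) (by norm_num), norm_one, one_mul, Measure.real,
    ν_segment h, ENNReal.toReal_ofReal (by positivity)]
  refine le_of_eq ?_
  congr 1
  rw [rate, inv_pow, Real.inv_rpow (by positivity)]
  congr 1
  rw [Real.sqrt_eq_rpow, ← Real.rpow_natCast, ← Real.rpow_natCast, ← Real.rpow_mul (by norm_num),
    ← Real.rpow_mul (by norm_num), mul_comm]
  norm_num

theorem IsWeakGradient.sub_eq_or {φ g : ℂ → ℝ} (hg : IsWeakGradient φ g) {n : ℕ} {a b : ℤ × ℤ}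
    (h : latticeGraph.Adj a b) :
    φ (emb n b) - φ (emb n a) = ∫ x in segment ℝ (emb n a) (emb n b), g x ∂ν ∨
    φ (emb n a) - φ (emb n b) = ∫ x in segment ℝ (emb n a) (emb n b), g x ∂ν := by
  rcases lt_or_gt_of_ne (latticeDist_adj_ne h) with hlt | hlt
  · exact Or.inl (hg.sub_eq n _ _ (graph_adj_emb h) ((distCenter_lt_iff n h).mpr hlt))
  · refine Or.inr ?_
    rw [segment_symm]
    exact hg.sub_eq n _ _ (graph_adj_emb h.symm) ((distCenter_lt_iff n h.symm).mpr hlt)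

theorem gradGraph_snd_eq_zero (p : Lp ℝ 2 μ × Lp ℝ 2 ν) (hp : p ∈ gradGraph) (h0 : p.1 = 0) :
    p.2 = 0 := by
  obtain ⟨φ, hφ, hf, hg⟩ := hp
  have hzero : Set.EqOn φ (fun _ => 0) X := by
    refine eqOn_of_ae_eq hφ continuousOn_const (hf.trans ?_)
    rw [h0]
    exact Lp.coeFn_zero _ _ _
  rw [Lp.eq_zero_iff_ae_eq_zero]
  refine ae_ν_of_forall_segment fun n a b hab =>
    ae_eq_zero_on_segment hab (integrableOn_segment _ hab) fun n a b hab => ?_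
  have ha := hzero (emb_mem_X hab n)
  have hb := hzero (emb_mem_X hab.symm n)
  rcases hg.sub_eq_or (n := n) hab with h | h
  · rw [← h, ha, hb, sub_zero]
  · rw [← h, ha, hb, sub_zero]

theorem grad_graph : grad.graph = gradGraph :=
  Submodule.toLinearPMap_graph_eq _ gradGraph_snd_eq_zero

variable {φ : ℂ → ℝ} {g : Lp ℝ 2 ν}

theorem abs_sub_le_of_adj (hg : IsWeakGradient φ g) (n : ℕ) {a b : ℤ × ℤ}
    (h : latticeGraph.Adj a b) : |φ (emb n a) - φ (emb n b)| ≤ rate ^ n * ‖g‖ := by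
  have h1 := abs_setIntegral_segment_le g (n := n) h
  rcases hg.sub_eq_or (n := n) h with h2 | h2
  · rwa [abs_sub_comm, h2]
  · rwa [h2]

theorem IsCenter.exists_adj {c : ℤ × ℤ} (hc : IsCenter c) : ∃ b, latticeGraph.Adj c b :=
  ⟨_, latticeGraph_adj_center hc (j := 1) (by decide)⟩

theorem IsCenterIn.latticeDist_lt {m : ℕ} {c : ℤ × ℤ} (hc : IsCenterIn m c) :
    latticeDist c < 3 ^ m := by
  induction hc with
  | zero => simp [latticeDist_zero]
  | step m c i h ih =>
    have hc : IsCenter c := ⟨m, h⟩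
    obtain ⟨b, hb⟩ := hc.exists_adj
    have h0 := latticeDist_three_smul hb
    rcases eq_or_ne i 0 with rfl | hi
    · rw [unit_zero, smul_zero, add_zero, h0, pow_succ]; omega
    have h1 := latticeDist_adj_le (latticeGraph_adj_center hc.three_smul hi)
    have h2 := latticeDist_adj_le (latticeGraph_adj_center (hc.step i) (opp_ne_zero hi)).symm
    have e : (3 : ℤ) • c + (2 : ℤ) • unit i + unit (opp i) = (3 : ℤ) • c + unit i := by
      rw [unit_opp]; module
    rw [e] at h2
    rw [pow_succ]
    omega

theorem abs_sub_center_le (hg : IsWeakGradient φ g) {m : ℕ} {c : ℤ × ℤ} (hc : IsCenterIn m c) :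
    |φ (emb 0 c) - φ 0| ≤ 3 ^ m * ‖g‖ := by
  have h1 := le_mul_dist (G := latticeGraph) (f := fun a => φ (emb 0 a)) (L := ‖g‖)
    (fun a b hab => by simpa using abs_sub_le_of_adj hg 0 hab)
    (IsCenter.reachable ⟨m, hc⟩)
  simp only [emb_zero_apply] at h1
  refine h1.trans ?_
  rw [mul_comm]
  refine mul_le_mul_of_nonneg_right ?_ (norm_nonneg g)
  exact_mod_cast hc.latticeDist_lt.le

/-- The center of a cell and that of a subcell are joined by at most two edges of level `n + 1`. -/
theorem abs_sub_subcenter_le (hg : IsWeakGradient φ g) (n : ℕ) {c : ℤ × ℤ} (hc : IsCenter c)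
    (i : Fin 5) :
    |φ (emb (n + 1) ((3 : ℤ) • c + (2 : ℤ) • unit i)) - φ (emb n c)| ≤
      2 * rate ^ (n + 1) * ‖g‖ := by
  rw [← emb_succ n c]
  rcases eq_or_ne i 0 with rfl | hi
  · rw [unit_zero, smul_zero, add_zero, sub_self, abs_zero]
    have := rate_pos
    positivity
  have h1 := abs_sub_le_of_adj hg (n + 1) (latticeGraph_adj_center hc.three_smul hi)
  have h2 := abs_sub_le_of_adj hg (n + 1) (latticeGraph_adj_center (hc.step i) (opp_ne_zero hi))
  have e : (3 : ℤ) • c + (2 : ℤ) • unit i + unit (opp i) = (3 : ℤ) • c + unit i := by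
    rw [unit_opp]; module
  rw [e] at h2
  rw [abs_le] at *
  constructor <;> linarith

/-- A bound for the oscillation on `3 ^ m K` in terms of the energy. -/
def oscConst (m : ℕ) : ℝ := 3 ^ m + 2 * (1 - rate)⁻¹

/-- Chaining: go from `0` to the center of a unit cell along fewer than `3 ^ m` edges, then through
the centers of nested cells towards `x`. These steps are bounded by `2 * rate ^ (n + 1)`, a summable
series. -/
theorem abs_sub_zero_le (hφ : ContinuousOn φ X) (hg : IsWeakGradient φ g) {m : ℕ} {x : ℂ}
    (hx : x ∈ blowUp m) : |φ x - φ 0| ≤ oscConst m * ‖g‖ := by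
  have hxX := blowUp_subset_X m hx
  obtain ⟨_, ⟨w, rfl⟩, rfl⟩ := hx
  have hmem := mem_cell_of_coding w m
  set x := (3 : ℂ) ^ m * coding w
  have hc : ∀ n, IsCenter (wordCenter w (m + n)) := fun n => ⟨_, isCenterIn_wordCenter w _⟩
  have hr := rate_pos
  have hr1 := rate_lt_one
  have hn : ∀ n, |φ (emb n (wordCenter w (m + n))) - φ 0| ≤
      (3 ^ m + 2 * ∑ k ∈ Finset.range n, rate ^ (k + 1)) * ‖g‖ := fun n => by
    induction n with
    | zero => simpa using abs_sub_center_le hg (isCenterIn_wordCenter w m)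
    | succ n ih =>
      have h1 := abs_sub_subcenter_le hg n (hc n) (w (m + n))
      have h2 := abs_sub_le (φ (emb (n + 1) (wordCenter w (m + (n + 1)))))
        (φ (emb n (wordCenter w (m + n)))) (φ 0)
      change |φ (emb (n + 1) (wordCenter w (m + (n + 1)))) - _| ≤ _ at h1
      rw [Finset.sum_range_succ]
      linarith
  have hb : ∀ n, |φ (emb n (wordCenter w (m + n))) - φ 0| ≤ oscConst m * ‖g‖ := fun n => by
    refine (hn n).trans (mul_le_mul_of_nonneg_right ?_ (norm_nonneg g))
    unfold oscConst
    have h1 : ∑ k ∈ Finset.range n, rate ^ (k + 1) ≤ ∑ k ∈ Finset.range n, rate ^ k :=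
      Finset.sum_le_sum fun k _ => pow_le_pow_of_le_one hr.le hr1.le (Nat.le_succ k)
    have h2 := (summable_geometric_of_lt_one hr.le hr1).sum_le_tsum (Finset.range n)
      (fun k _ => by positivity)
    rw [tsum_geometric_of_lt_one hr.le hr1] at h2
    linarith
  have hlim : Tendsto (fun n => emb n (wordCenter w (m + n))) atTop (𝓝[X] x) := by
    rw [tendsto_nhdsWithin_iff]
    refine ⟨?_, Eventually.of_forall fun n => cell_subset_X (hc n) n (emb_center_mem_cell n _)⟩
    rw [tendsto_iff_dist_tendsto_zero]
    refine squeeze_zero (fun _ => dist_nonneg) (fun n => ?_)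
      (tendsto_pow_atTop_nhds_zero_of_lt_one (r := (3 : ℝ)⁻¹) (by norm_num) (by norm_num))
    rw [dist_comm, inv_pow]
    exact dist_le_of_mem_cell (hmem n)
  exact le_of_tendsto (((hφ x hxX).tendsto.comp hlim).sub_const _).abs
    (Eventually.of_forall hb)

theorem blowUp_zero : blowUp 0 = K := by simp [blowUp]

theorem measurableSet_X : MeasurableSet X := MeasurableSet.iUnion measurableSet_blowUp

theorem μ_K_pos : 0 < μ K := by
  have h1 := μ_pos (Metric.isOpen_ball (x := (0 : ℂ)) (ε := 3 ^ 0))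
    ⟨0, by simp, blowUp_subset_X 0 (by rw [blowUp_zero]; exact zero_mem_K)⟩
  refine h1.trans_le ?_
  rw [← measure_inter_add_sdiff (Metric.ball (0 : ℂ) (3 ^ 0)) measurableSet_X]
  have h2 : μ (Metric.ball (0 : ℂ) (3 ^ 0) \ X) = 0 :=
    measure_mono_null (fun x hx => hx.2) μ_compl_X
  rw [h2, add_zero]
  refine measure_mono fun x hx => ?_
  rw [← blowUp_zero]
  exact mem_blowUp_of_norm_lt hx.2 (by simpa using hx.1)

theorem μ_K_ne_top : μ K ≠ ⊤ := isCompact_K.measure_lt_top.ne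

/-- Functions in `W^{1,2}(X)` are bounded on `3 ^ m K` by their Sobolev norm. -/
theorem exists_abs_le (m : ℕ) : ∃ C, 0 ≤ C ∧ ∀ (f : Lp ℝ 2 μ) (g : Lp ℝ 2 ν) (φ : ℂ → ℝ),
    ContinuousOn φ X → φ =ᵐ[μ] f → IsWeakGradient φ g →
      ∀ x ∈ blowUp m, |φ x| ≤ C * (‖f‖ + ‖g‖) := by
  have hκ : 0 < μ.real K := ENNReal.toReal_pos μ_K_pos.ne' μ_K_ne_top
  set κ := μ.real K
  set s : ℝ := κ ^ (1 / (2 : ℝ≥0∞).toReal)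
  have hs : 0 ≤ s := by positivity
  have hosc : ∀ k, 0 ≤ oscConst k := fun k => by
    have := rate_lt_one
    have : 0 < (1 - rate)⁻¹ := by rw [inv_pos]; linarith
    unfold oscConst; positivity
  refine ⟨s / κ + oscConst 0 + oscConst m, by have := hosc 0; have := hosc m; positivity,
    fun f g φ hφ hf hg x hx => ?_⟩
  have hfin : IsFiniteMeasure (μ.restrict K) :=
    ⟨by rw [Measure.restrict_apply_univ]; exact μ_K_ne_top.lt_top⟩
  have hfi : IntegrableOn f K μ := ((Lp.memLp f).restrict _).integrable (by norm_num)
  have h1 : |∫ y in K, f y ∂μ| ≤ s * ‖f‖ := by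
    rw [← L2.inner_indicatorConstLp_one (𝕜 := ℝ) isCompact_K.measurableSet μ_K_ne_top f]
    refine (abs_real_inner_le_norm _ _).trans ?_
    rw [norm_indicatorConstLp (by norm_num) (by norm_num), norm_one, one_mul]
  have h2 : ‖∫ y in K, (f y - φ 0) ∂μ‖ ≤ oscConst 0 * ‖g‖ * κ := by
    refine norm_setIntegral_le_of_norm_le_const_ae μ_K_ne_top.lt_top ?_
    filter_upwards [ae_restrict_of_ae hf, ae_restrict_mem isCompact_K.measurableSet] with y hy hyK
    rw [← hy]
    exact abs_sub_zero_le hφ hg (by rwa [blowUp_zero])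
  rw [integral_sub hfi (integrable_const _), setIntegral_const, smul_eq_mul, Real.norm_eq_abs] at h2
  -- The value at `0` is compared with the mean over `K`, which is bounded by the `L²` norm; the
  -- oscillation on `K` is bounded by the energy.
  have h3 : κ * |φ 0| ≤ s * ‖f‖ + oscConst 0 * ‖g‖ * κ := by
    have : κ * |φ 0| = |κ * φ 0| := by rw [abs_mul, abs_of_pos hκ]
    rw [this]
    have h4 := abs_sub_abs_le_abs_sub (κ * φ 0) (∫ y in K, f y ∂μ)
    rw [abs_sub_comm] at h4
    linarith
  have h5 : |φ 0| ≤ s / κ * ‖f‖ + oscConst 0 * ‖g‖ := by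
    have h6 : κ * (s / κ * ‖f‖ + oscConst 0 * ‖g‖) = s * ‖f‖ + oscConst 0 * ‖g‖ * κ := by
      field_simp
    rw [← h6] at h3
    exact le_of_mul_le_mul_left h3 hκ
  have h7 := abs_sub_zero_le hφ hg hx
  have h8 : |φ x| ≤ |φ x - φ 0| + |φ 0| := by simpa using abs_sub_le (φ x) (φ 0) 0
  have h9 : 0 ≤ s / κ := by positivity
  nlinarith [norm_nonneg f, norm_nonneg g, hosc 0, hosc m, mul_nonneg h9 (norm_nonneg g),
    mul_nonneg (hosc 0) (norm_nonneg f), mul_nonneg (hosc m) (norm_nonneg f)]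

/-- By `exists_abs_le`, convergence in the graph norm forces uniform convergence on each `3 ^ m K`,
so the limit has a continuous representative. Increments pass to the limit because the integral over
an edge is an inner product with an indicator. -/
theorem isClosed_gradGraph : IsClosed (gradGraph : Set (Lp ℝ 2 μ × Lp ℝ 2 ν)) := by
  refine IsSeqClosed.isClosed fun p p₀ hp hlim => ?_
  choose φ hφ hf hg using hp
  have h1 : Tendsto (fun k => (p k).1) atTop (𝓝 p₀.1) := (continuous_fst.tendsto _).comp hlim
  have h2 : Tendsto (fun k => (p k).2) atTop (𝓝 p₀.2) := (continuous_snd.tendsto _).comp hlim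
  have hdiff : ∀ m, ∃ C, 0 ≤ C ∧ ∀ k l, ∀ x ∈ blowUp m, |φ k x - φ l x| ≤
      C * (‖(p k).1 - (p l).1‖ + ‖(p k).2 - (p l).2‖) := fun m => by
    obtain ⟨C, hC, h⟩ := exists_abs_le m
    refine ⟨C, hC, fun k l x hx => ?_⟩
    -- The difference of two members of the graph comes with its own continuous representative; full
    -- support of `μ` identifies it with `φ k - φ l` on `X`.
    obtain ⟨ψ, hψ, hψf, hψg⟩ := gradGraph.sub_mem ⟨φ k, hφ k, hf k, hg k⟩ ⟨φ l, hφ l, hf l, hg l⟩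
    have heq : Set.EqOn (fun x => φ k x - φ l x) ψ X := by
      refine eqOn_of_ae_eq ((hφ k).sub (hφ l)) hψ ?_
      refine EventuallyEq.trans ?_ hψf.symm
      exact ((hf k).sub (hf l)).trans (Lp.coeFn_sub _ _).symm
    have := h _ _ ψ hψ hψf hψg x hx
    rw [← heq (blowUp_subset_X m hx)] at this
    exact this
  have hconv : ∀ x ∈ X, ∃ y, Tendsto (fun k => φ k x) atTop (𝓝 y) := fun x hx => by
    obtain ⟨m, hm⟩ := Set.mem_iUnion.mp hx
    obtain ⟨C, hC, h⟩ := hdiff m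
    refine cauchySeq_tendsto_of_complete (cauchySeq_iff_tendsto_dist_atTop_0.mpr ?_)
    refine squeeze_zero (fun _ => dist_nonneg) (fun n => h n.1 n.2 x hm) ?_
    have e1 := cauchySeq_iff_tendsto_dist_atTop_0.mp h1.cauchySeq
    have e2 := cauchySeq_iff_tendsto_dist_atTop_0.mp h2.cauchySeq
    simpa [dist_eq_norm] using (e1.add e2).const_mul C
  choose! Φ hΦ using hconv
  have hunif : ∀ m, TendstoUniformlyOn φ Φ atTop (blowUp m) := fun m => by
    obtain ⟨C, hC, h⟩ := hdiff m
    have hb : ∀ k, ∀ x ∈ blowUp m, |φ k x - Φ x| ≤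
        C * (‖(p k).1 - p₀.1‖ + ‖(p k).2 - p₀.2‖) := fun k x hx => by
      refine le_of_tendsto_of_tendsto ((hΦ x (blowUp_subset_X m hx)).const_sub _).abs
        (((h1.const_sub _).norm.add (h2.const_sub _).norm).const_mul C)
        (Eventually.of_forall fun l => h k l x hx)
    have hz : Tendsto (fun k => C * (‖(p k).1 - p₀.1‖ + ‖(p k).2 - p₀.2‖)) atTop (𝓝 0) := by
      have e1 := (h1.sub_const p₀.1).norm
      have e2 := (h2.sub_const p₀.2).norm
      simpa using (e1.add e2).const_mul C
    rw [Metric.tendstoUniformlyOn_iff]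
    intro ε hε
    filter_upwards [hz.eventually_lt_const hε] with k hk x hx
    rw [dist_comm, Real.dist_eq]
    exact (hb k x hx).trans_lt hk
  refine ⟨Φ, fun x hx => ?_, ?_, Lp.aestronglyMeasurable _, ?_, ?_⟩
  · obtain ⟨m, hm⟩ := pow_unbounded_of_one_lt ‖x‖ (show (1 : ℝ) < 3 by norm_num)
    have hc : ContinuousOn Φ (blowUp m) := (hunif m).continuousOn
      (Frequently.of_forall fun k => (hφ k).mono (blowUp_subset_X m))
    refine (hc x (mem_blowUp_of_norm_lt hx hm)).mono_of_mem_nhdsWithin ?_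
    rw [mem_nhdsWithin]
    exact ⟨Metric.ball 0 (3 ^ m), Metric.isOpen_ball, by simpa using hm,
      fun y hy => mem_blowUp_of_norm_lt hy.2 (by simpa using hy.1)⟩
  · obtain ⟨ns, hmono, hns⟩ := (tendstoInMeasure_of_tendsto_Lp h1).exists_seq_tendsto_ae
    have hX : ∀ᵐ x ∂μ, x ∈ X := by
      rw [ae_iff]; exact μ_compl_X
    have hall : ∀ᵐ x ∂μ, ∀ k, φ k x = (p k).1 x := ae_all_iff.mpr hf
    filter_upwards [hns, hX, hall] with x hx hxX hxall
    refine tendsto_nhds_unique ((hΦ x hxX).comp hmono.tendsto_atTop) ?_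
    exact hx.congr fun k => (hxall _).symm
  · intro n u v huv
    obtain ⟨a, b, hab, rfl, rfl⟩ := exists_of_graph_adj huv
    exact integrableOn_segment _ hab
  · intro n u v huv hlt
    have huv' := huv
    obtain ⟨a, b, hab, rfl, rfl⟩ := exists_of_graph_adj huv
    have e1 := (hΦ _ (emb_mem_X hab.symm n)).sub (hΦ _ (emb_mem_X hab n))
    refine tendsto_nhds_unique e1 ?_
    have e2 : ∀ k, φ k (emb n b) - φ k (emb n a) = inner ℝ (indicatorConstLp 2
        (measurableSet_segment _ _) (ν_segment_ne_top hab) 1) (p k).2 := fun k => by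
      rw [L2.inner_indicatorConstLp_one]
      exact (hg k).sub_eq n _ _ huv' hlt
    simp only [e2]
    rw [← L2.inner_indicatorConstLp_one (𝕜 := ℝ) (measurableSet_segment _ _)
      (ν_segment_ne_top hab)]
    exact tendsto_const_nhds.inner h2

end Gradient

/-! ### Geometry of subdivided edges: thirds, branches, almost disjointness -/

section Subdivision

theorem adj_iff_exists_center {a b : ℤ × ℤ} : latticeGraph.Adj a b ↔
    ∃ c j, IsCenter c ∧ j ≠ 0 ∧ ((a = c ∧ b = c + unit j) ∨ (b = c ∧ a = c + unit j)) := by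
  constructor
  · intro h
    rw [latticeGraph, SimpleGraph.fromRel_adj] at h
    obtain ⟨-, ⟨ha, j, hj, rfl⟩ | ⟨hb, j, hj, rfl⟩⟩ := h
    · exact ⟨a, j, ha, hj, Or.inl ⟨rfl, rfl⟩⟩
    · exact ⟨b, j, hb, hj, Or.inr ⟨rfl, rfl⟩⟩
  · rintro ⟨c, j, hc, hj, ⟨rfl, rfl⟩ | ⟨rfl, rfl⟩⟩
    · exact latticeGraph_adj_center hc hj
    · exact (latticeGraph_adj_center hc hj).symm

theorem exists_eq_add_unit {a b : ℤ × ℤ} (h : latticeGraph.Adj a b) : ∃ j, b = a + unit j := by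
  obtain ⟨c, j, hc, hj, ⟨rfl, rfl⟩ | ⟨rfl, rfl⟩⟩ := adj_iff_exists_center.mp h
  · exact ⟨j, rfl⟩
  · exact ⟨opp j, by rw [unit_opp, add_neg_cancel_right]⟩

/-- The edge `(a', b')` is one of the three parts of the edge `(a, b)` of the previous level. -/
def IsThird (a b a' b' : ℤ × ℤ) : Prop :=
  (a' = (3 : ℤ) • a ∧ b' = (2 : ℤ) • a + b) ∨
  (a' = (2 : ℤ) • a + b ∧ b' = a + (2 : ℤ) • b) ∨
  (a' = a + (2 : ℤ) • b ∧ b' = (3 : ℤ) • b)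

theorem IsThird.symm {a b a' b' : ℤ × ℤ} (h : IsThird a b a' b') : IsThird b a b' a' := by
  rcases h with ⟨rfl, rfl⟩ | ⟨rfl, rfl⟩ | ⟨rfl, rfl⟩
  · exact Or.inr (Or.inr ⟨add_comm _ _, rfl⟩)
  · exact Or.inr (Or.inl ⟨add_comm _ _, add_comm _ _⟩)
  · exact Or.inl ⟨rfl, add_comm _ _⟩

theorem IsThird.adj {a b a' b' : ℤ × ℤ} (h : IsThird a b a' b') (hab : latticeGraph.Adj a b) :
    latticeGraph.Adj a' b' := by
  obtain ⟨h1, h2, h3⟩ := latticeGraph_adj_thirds hab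
  rcases h with ⟨rfl, rfl⟩ | ⟨rfl, rfl⟩ | ⟨rfl, rfl⟩ <;> assumption

theorem IsThird.lt {a b a' b' : ℤ × ℤ} (h : IsThird a b a' b') (hab : latticeGraph.Adj a b)
    (hlt : latticeDist a' < latticeDist b') : latticeDist a < latticeDist b := by
  by_contra hcon
  have hba : latticeDist b < latticeDist a :=
    lt_of_le_of_ne (not_lt.mp hcon) (latticeDist_adj_ne hab).symm
  obtain ⟨h1, h2, h3⟩ := latticeDist_thirds hab.symm hba
  rw [add_comm _ a] at h1
  rw [add_comm _ a, add_comm b] at h2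
  rw [add_comm b] at h3
  rcases h with ⟨rfl, rfl⟩ | ⟨rfl, rfl⟩ | ⟨rfl, rfl⟩ <;> omega

theorem subdivide_vertices {a b : ℤ × ℤ} (hab : latticeGraph.Adj a b) (h : ℤ × ℤ → ℝ) :
    subdivide h ((3 : ℤ) • a) = h a ∧ subdivide h ((2 : ℤ) • a + b) = (2 * h a + h b) / 3 ∧
    subdivide h (a + (2 : ℤ) • b) = (h a + 2 * h b) / 3 ∧ subdivide h ((3 : ℤ) • b) = h b := by
  refine latticeGraph_adj_induction (p := fun a b =>
    subdivide h ((3 : ℤ) • a) = h a ∧ subdivide h ((2 : ℤ) • a + b) = (2 * h a + h b) / 3 ∧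
    subdivide h (a + (2 : ℤ) • b) = (h a + 2 * h b) / 3 ∧ subdivide h ((3 : ℤ) • b) = h b) ?_ ?_ hab
  · rintro a b ⟨h1, h2, h3, h4⟩
    rw [add_comm] at h2 h3
    exact ⟨h4, by rw [h3]; ring, by rw [h2]; ring, h1⟩
  · intro c j hc _
    have h1 := subdivide_arm hc h j (k := 1) (by norm_num) (by norm_num)
    have h2 := subdivide_arm hc h j (k := 2) (by norm_num) (by norm_num)
    refine ⟨subdivide_center hc h, ?_, ?_, subdivide_corner hc h j⟩
    · have e : (2 : ℤ) • c + (c + unit j) = (3 : ℤ) • c + (1 : ℤ) • unit j := by module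
      rw [e, h1]; push_cast; ring
    · have e : c + (2 : ℤ) • (c + unit j) = (3 : ℤ) • c + (2 : ℤ) • unit j := by module
      rw [e, h2]; push_cast; ring

theorem IsThird.subdivide_sub {a b a' b' : ℤ × ℤ} (h : IsThird a b a' b')
    (hab : latticeGraph.Adj a b) (f : ℤ × ℤ → ℝ) :
    subdivide f b' - subdivide f a' = (f b - f a) / 3 := by
  obtain ⟨h1, h2, h3, h4⟩ := subdivide_vertices hab f
  rcases h with ⟨rfl, rfl⟩ | ⟨rfl, rfl⟩ | ⟨rfl, rfl⟩ <;> simp only [h1, h2, h3, h4] <;> ring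

/-- The edge `(a, b)` lies on a line containing edges of the previous level. -/
def OnAxis (a b : ℤ × ℤ) : Prop := (a.1 = b.1 ∧ 6 ∣ a.1) ∨ (a.2 = b.2 ∧ 6 ∣ a.2)

theorem OnAxis.symm {a b : ℤ × ℤ} (h : OnAxis a b) : OnAxis b a := by
  unfold OnAxis at *
  omega

/-- The coordinate that is constant along an edge is that of a center, hence even, and is tripled by
refinement. On a new branch it is `±2` modulo `6` instead. -/
theorem IsThird.onAxis {a b a' b' : ℤ × ℤ} (h : IsThird a b a' b') (hab : latticeGraph.Adj a b) :
    OnAxis a' b' := by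
  have key : (a.1 = b.1 ∧ 2 ∣ a.1) ∨ (a.2 = b.2 ∧ 2 ∣ a.2) := by
    refine latticeGraph_adj_induction
      (p := fun a b => (a.1 = b.1 ∧ 2 ∣ a.1) ∨ (a.2 = b.2 ∧ 2 ∣ a.2)) (fun a b h => by omega)
      (fun c j hc hj => ?_) hab
    obtain ⟨h1, h2⟩ := hc.even
    rw [even_iff_two_dvd] at h1 h2
    fin_cases j <;> simp_all [unit]
  unfold OnAxis
  rcases h with ⟨rfl, rfl⟩ | ⟨rfl, rfl⟩ | ⟨rfl, rfl⟩ <;>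
    simp only [Prod.fst_add, Prod.snd_add, Prod.smul_fst, Prod.smul_snd, smul_eq_mul] <;> omega

/-- An edge is either part of an edge of the previous level, or belongs to a new branch. -/
theorem isThird_or_branch {a' b' : ℤ × ℤ} (h : latticeGraph.Adj a' b') :
    (∃ a b, latticeGraph.Adj a b ∧ IsThird a b a' b') ∨
      (¬ OnAxis a' b' ∧ ∀ f, subdivide f a' = subdivide f b') := by
  refine latticeGraph_adj_induction (p := fun a' b' =>
    (∃ a b, latticeGraph.Adj a b ∧ IsThird a b a' b') ∨
      (¬ OnAxis a' b' ∧ ∀ f, subdivide f a' = subdivide f b')) ?_ ?_ h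
  · rintro a' b' (⟨a, b, hab, h⟩ | ⟨h1, h2⟩)
    · exact Or.inl ⟨b, a, hab.symm, h.symm⟩
    · exact Or.inr ⟨fun h => h1 h.symm, fun f => (h2 f).symm⟩
  · intro c' j hc' hj
    obtain ⟨c, i, hc, rfl⟩ := hc'.exists_eq
    rcases eq_or_ne i 0 with rfl | hi
    · refine Or.inl ⟨c, c + unit j, latticeGraph_adj_center hc hj, Or.inl ⟨?_, ?_⟩⟩
      · rw [unit_zero, smul_zero, add_zero]
      · rw [unit_zero]; module
    rcases eq_or_ne j i with rfl | hji
    · refine Or.inl ⟨c, c + unit j, latticeGraph_adj_center hc hj, Or.inr (Or.inr ⟨?_, ?_⟩)⟩ <;>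
        module
    rcases eq_or_ne j (opp i) with rfl | hji'
    · refine Or.inl ⟨c + unit i, c, (latticeGraph_adj_center hc hi).symm,
        Or.inr (Or.inl ⟨?_, ?_⟩)⟩
      · module
      · rw [unit_opp]; module
    refine Or.inr ⟨?_, fun f => ?_⟩
    · obtain ⟨⟨a, ha⟩, ⟨b, hb⟩⟩ := hc.even
      unfold OnAxis
      fin_cases i <;> fin_cases j <;> simp [opp] at hi hj hji hji' <;> simp [unit] <;> omega
    · rw [add_assoc, subdivide_branch hc f hi hj hji hji']

/-- An edge is covered by its three parts. -/
theorem exists_third_mem {n : ℕ} {a b : ℤ × ℤ} {x : ℂ}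
    (hx : x ∈ segment ℝ (emb n a) (emb n b)) : ∃ a' b', IsThird a b a' b' ∧
      x ∈ segment ℝ (emb (n + 1) a') (emb (n + 1) b') := by
  have hthird : ∀ (p : ℤ × ℤ), emb (n + 1) p = (1 / 3 : ℂ) * emb n p := fun p => by
    rw [emb, emb, pow_succ]; field_simp
  rw [segment_eq_image'] at hx
  obtain ⟨t, ⟨ht0, ht1⟩, rfl⟩ := hx
  rcases le_total t (1 / 3) with h1 | h1
  · refine ⟨_, _, Or.inl ⟨rfl, rfl⟩, ?_⟩
    rw [segment_eq_image']
    refine ⟨3 * t, ⟨by linarith, by linarith⟩, ?_⟩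
    simp only [hthird, emb_add, emb_zsmul, Complex.real_smul]
    push_cast
    ring
  rcases le_total t (2 / 3) with h2 | h2
  · refine ⟨_, _, Or.inr (Or.inl ⟨rfl, rfl⟩), ?_⟩
    rw [segment_eq_image']
    refine ⟨3 * t - 1, ⟨by linarith, by linarith⟩, ?_⟩
    simp only [hthird, emb_add, emb_zsmul, Complex.real_smul]
    push_cast
    ring
  · refine ⟨_, _, Or.inr (Or.inr ⟨rfl, rfl⟩), ?_⟩
    rw [segment_eq_image']
    refine ⟨3 * t - 2, ⟨by linarith, by linarith⟩, ?_⟩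
    simp only [hthird, emb_add, emb_zsmul, Complex.real_smul]
    push_cast
    ring

theorem IsThird.segment_subset {a b a' b' : ℤ × ℤ} (h : IsThird a b a' b') (n : ℕ) :
    segment ℝ (emb (n + 1) a') (emb (n + 1) b') ⊆ segment ℝ (emb n a) (emb n b) := by
  have hthird : ∀ (p : ℤ × ℤ), emb (n + 1) p = (1 / 3 : ℂ) * emb n p := fun p => by
    rw [emb, emb, pow_succ]; field_simp
  have e0 : emb (n + 1) ((3 : ℤ) • a) ∈ segment ℝ (emb n a) (emb n b) := by
    rw [emb_succ]; exact left_mem_segment _ _ _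
  have e3 : emb (n + 1) ((3 : ℤ) • b) ∈ segment ℝ (emb n a) (emb n b) := by
    rw [emb_succ]; exact right_mem_segment _ _ _
  have e1 : emb (n + 1) ((2 : ℤ) • a + b) ∈ segment ℝ (emb n a) (emb n b) := by
    refine ⟨2 / 3, 1 / 3, by norm_num, by norm_num, by norm_num, ?_⟩
    rw [hthird, emb_add, emb_zsmul, Complex.real_smul, Complex.real_smul]; push_cast; ring
  have e2 : emb (n + 1) (a + (2 : ℤ) • b) ∈ segment ℝ (emb n a) (emb n b) := by
    refine ⟨1 / 3, 2 / 3, by norm_num, by norm_num, by norm_num, ?_⟩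
    rw [hthird, emb_add, emb_zsmul, Complex.real_smul, Complex.real_smul]; push_cast; ring
  have hconv := convex_segment (𝕜 := ℝ) (emb n a) (emb n b)
  rcases h with ⟨rfl, rfl⟩ | ⟨rfl, rfl⟩ | ⟨rfl, rfl⟩
  · exact hconv.segment_subset e0 e1
  · exact hconv.segment_subset e1 e2
  · exact hconv.segment_subset e2 e3

/-- Two different edges of the same level meet at most at their end points. -/
theorem edge_eq_of_mem {n : ℕ} {a b a' b' : ℤ × ℤ} (h : latticeGraph.Adj a b)
    (h' : latticeGraph.Adj a' b') {x : ℂ} (hx : x ∈ segment ℝ (emb n a) (emb n b))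
    (hx' : x ∈ segment ℝ (emb n a') (emb n b')) (ha : x ≠ emb n a) (hb : x ≠ emb n b) :
    (a' = a ∧ b' = b) ∨ (a' = b ∧ b' = a) := by
  have key : ∀ {c c' : ℤ × ℤ} {j j' : Fin 5}, IsCenter c → IsCenter c' → j ≠ 0 → j' ≠ 0 →
      x ∈ segment ℝ (emb n c) (emb n (c + unit j)) →
      x ∈ segment ℝ (emb n c') (emb n (c' + unit j')) →
      x ≠ emb n c → x ≠ emb n (c + unit j) → c' = c ∧ unit j' = unit j := by
    intro c c' j j' hc hc' hj hj' hx hx' h1 h2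
    rw [segment_eq_image'] at hx hx'
    obtain ⟨t, ht, rfl⟩ := hx
    obtain ⟨t', ht', he⟩ := hx'
    simp only [emb_add, add_sub_cancel_left, emb_unit, Complex.real_smul] at he h1 h2
    have h3 : ((3 : ℂ) ^ n) ≠ 0 := pow_ne_zero n (by norm_num)
    have ht0 : t ≠ 0 := by rintro rfl; simp at h1
    have ht1 : t ≠ 1 := by rintro rfl; simp at h2
    have hlt : t < 1 := lt_of_le_of_ne ht.2 ht1
    have hpos : 0 < t := lt_of_le_of_ne ht.1 ht0.symm
    have e : plane (c'.1 - c.1 : ℝ) (c'.2 - c.2 : ℝ) = t * q j - t' * q j' := by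
      rw [← plane_sub]
      simp only [emb] at he
      field_simp at he
      linear_combination he
    have hn := normSq_plane (c'.1 - c.1 : ℝ) (c'.2 - c.2 : ℝ)
    have hle : ‖(t * q j - t' * q j' : ℂ)‖ < 2 := by
      refine (norm_sub_le _ _).trans_lt ?_
      rw [norm_mul, norm_mul, norm_q hj, norm_q hj', Complex.norm_real, Complex.norm_real,
        Real.norm_of_nonneg ht.1, Real.norm_of_nonneg ht'.1]
      linarith [ht'.2]
    -- The common point is strictly inside the first edge, so the rescaled centers are at distance
    -- less than `2`; having even coordinates, they coincide.
    have h5 : ((c'.1 - c.1) ^ 2 + (c'.2 - c.2) ^ 2 : ℤ) < 4 := by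
      have : ((c'.1 - c.1) ^ 2 + (c'.2 - c.2) ^ 2 : ℝ) < 4 := by
        rw [← hn, e]; nlinarith [norm_nonneg (t * q j - t' * q j' : ℂ)]
      exact_mod_cast this
    obtain ⟨⟨k, hk⟩, ⟨l, hl⟩⟩ := hc.even
    obtain ⟨⟨k', hk'⟩, ⟨l', hl'⟩⟩ := hc'.even
    have h6 : (k' - k) ^ 2 + (l' - l) ^ 2 < 1 := by rw [hk, hl, hk', hl'] at h5; nlinarith
    have h7 : k' - k = 0 := by
      have : (k' - k) ^ 2 = 0 := by nlinarith [sq_nonneg (k' - k), sq_nonneg (l' - l)]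
      exact pow_eq_zero_iff two_ne_zero |>.mp this
    have h8 : l' - l = 0 := by
      have : (l' - l) ^ 2 = 0 := by nlinarith [sq_nonneg (k' - k), sq_nonneg (l' - l)]
      exact pow_eq_zero_iff two_ne_zero |>.mp this
    obtain rfl : c' = c := Prod.ext (by omega) (by omega)
    refine ⟨rfl, ?_⟩
    have e2 : (t : ℂ) * q j = t' * q j' := by
      have : plane ((c'.1 : ℝ) - c'.1) ((c'.2 : ℝ) - c'.2) = 0 := by simp [plane]
      rw [this] at e
      linear_combination -e
    have e3 : t = t' := by
      have := congrArg norm e2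
      rwa [norm_mul, norm_mul, norm_q hj, norm_q hj', Complex.norm_real, Complex.norm_real,
        Real.norm_of_nonneg ht.1, Real.norm_of_nonneg ht'.1, mul_one, mul_one] at this
    rw [← e3] at e2
    have e4 := mul_left_cancel₀ (by exact_mod_cast ht0) e2
    apply emb_injective 0
    rw [emb_unit, emb_unit, e4]
  obtain ⟨c, j, hc, hj, hcj⟩ := adj_iff_exists_center.mp h
  obtain ⟨c', j', hc', hj', hcj'⟩ := adj_iff_exists_center.mp h'
  rcases hcj with ⟨rfl, rfl⟩ | ⟨rfl, rfl⟩ <;> rcases hcj' with ⟨rfl, rfl⟩ | ⟨rfl, rfl⟩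
  · obtain ⟨rfl, e⟩ := key hc hc' hj hj' hx hx' ha hb
    exact Or.inl ⟨rfl, by rw [e]⟩
  · rw [segment_symm] at hx'
    obtain ⟨rfl, e⟩ := key hc hc' hj hj' hx hx' ha hb
    exact Or.inr ⟨by rw [e], rfl⟩
  · rw [segment_symm] at hx
    obtain ⟨rfl, e⟩ := key hc hc' hj hj' hx hx' hb ha
    exact Or.inr ⟨rfl, by rw [e]⟩
  · rw [segment_symm] at hx hx'
    obtain ⟨rfl, e⟩ := key hc hc' hj hj' hx hx' hb ha
    exact Or.inl ⟨by rw [e], rfl⟩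

/-- Almost every point of an edge lies on no other edge of the same level. -/
theorem ae_edge_eq {n : ℕ} {a b : ℤ × ℤ} (h : latticeGraph.Adj a b) :
    ∀ᵐ x ∂(ν.restrict (segment ℝ (emb n a) (emb n b))), x ∈ segment ℝ (emb n a) (emb n b) ∧
      ∀ a' b', latticeGraph.Adj a' b' →
      x ∈ segment ℝ (emb n a') (emb n b') → (a' = a ∧ b' = b) ∨ (a' = b ∧ b' = a) := by
  rw [ν_restrict_segment h]
  have : NullSingletonClass (Measure.hausdorffMeasure 1 : Measure ℂ) :=
    Measure.nullSingletonClass_hausdorff ℂ one_pos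
  have h1 : ∀ y : ℂ, ∀ᵐ x ∂((Measure.hausdorffMeasure 1).restrict
      (segment ℝ (emb n a) (emb n b))), x ≠ y := fun y =>
    ae_restrict_of_ae (by simp [ae_iff])
  filter_upwards [ae_restrict_mem (measurableSet_segment _ _), h1 (emb n a), h1 (emb n b)]
    with x hx ha hb
  exact ⟨hx, fun a' b' h' hx' => edge_eq_of_mem h h' hx hx' ha hb⟩

end Subdivision

/-! ### Extension of vertex functions to continuous functions on `X` -/

section Extension

/-- A sequence of centers of nested cells of levels `N, N + 1, …`. -/
structure IsChain (c : ℕ → ℤ × ℤ) : Prop where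
  isCenter : ∀ k, IsCenter (c k)
  succ : ∀ k, ∃ i, c (k + 1) = (3 : ℤ) • c k + (2 : ℤ) • unit i

theorem IsChain.shift {c : ℕ → ℤ × ℤ} (hc : IsChain c) (k : ℕ) : IsChain fun l => c (k + l) :=
  ⟨fun _ => hc.isCenter _, fun l => hc.succ (k + l)⟩

theorem exists_chain {x : ℂ} (hx : x ∈ X) (N : ℕ) :
    ∃ c, IsChain c ∧ ∀ k, x ∈ cell (N + k) (c k) := by
  obtain ⟨m, _, ⟨w, rfl⟩, rfl⟩ := Set.mem_iUnion.mp hx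
  exact ⟨fun k => wordCenter w (m + (N + k)), ⟨fun k => ⟨_, isCenterIn_wordCenter w _⟩,
    fun k => ⟨w (m + (N + k)), rfl⟩⟩, fun k => mem_cell_of_coding w m (N + k)⟩

variable {h : ℤ × ℤ → ℝ} {L : ℝ}

/-- The value at the center moves by at most `2/3 * L / 3 ^ k` in step `k`, and these sum to `L * (1
- 1 / 3 ^ k)`. Only the initial cell enters, which makes the extension local in `extend_eq_zero`. -/
theorem abs_iterate_subdivide_sub_le {c : ℕ → ℤ × ℤ} (hc : IsChain c)
    (hL : ∀ j, |h (c 0 + unit j) - h (c 0)| ≤ L) (k : ℕ) :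
    (∀ j, |subdivide^[k] h (c k + unit j) - subdivide^[k] h (c k)| ≤ L / 3 ^ k) ∧
      |subdivide^[k] h (c k) - h (c 0)| ≤ L * (1 - 1 / 3 ^ k) := by
  induction k with
  | zero => simpa using hL
  | succ k ih =>
    obtain ⟨ih1, ih2⟩ := ih
    obtain ⟨i, hi⟩ := hc.succ k
    rw [Function.iterate_succ_apply', hi]
    constructor
    · intro j
      have := abs_subdivide_sub_le (hc.isCenter k) ih1 i j
      rwa [div_div, ← pow_succ] at this
    · have h1 := subdivide_arm (hc.isCenter k) (subdivide^[k] h) i (k := 2) (by norm_num)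
        (by norm_num)
      have h2 := ih1 i
      have h3 : |subdivide (subdivide^[k] h) ((3 : ℤ) • c k + (2 : ℤ) • unit i) -
          subdivide^[k] h (c k)| ≤ 2 / 3 * (L / 3 ^ k) := by
        rw [h1, add_sub_cancel_left, abs_mul]
        push_cast
        rw [abs_of_pos (show (0 : ℝ) < 2 / 3 by norm_num)]
        linarith
      have h4 := abs_sub_le (subdivide (subdivide^[k] h) ((3 : ℤ) • c k + (2 : ℤ) • unit i))
        (subdivide^[k] h (c k)) (h (c 0))
      have h5 : L * (1 - 1 / 3 ^ (k + 1)) = 2 / 3 * (L / 3 ^ k) + L * (1 - 1 / 3 ^ k) := by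
        rw [pow_succ]; field_simp; ring
      linarith

theorem abs_iterate_subdivide_add_sub_le (hL : ∀ c, IsCenter c → ∀ j, |h (c + unit j) - h c| ≤ L)
    (k : ℕ) : ∀ c, IsCenter c → ∀ j,
      |subdivide^[k] h (c + unit j) - subdivide^[k] h c| ≤ L / 3 ^ k := by
  induction k with
  | zero => simpa using hL
  | succ k ih =>
    intro c hc j
    obtain ⟨c', i, hc', rfl⟩ := hc.exists_eq
    rw [Function.iterate_succ_apply']
    have := abs_subdivide_sub_le hc' (ih c' hc') i j
    rwa [div_div, ← pow_succ] at this

theorem abs_chain_sub_le (hL : ∀ c, IsCenter c → ∀ j, |h (c + unit j) - h c| ≤ L)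
    {c : ℕ → ℤ × ℤ} (hc : IsChain c) (k l : ℕ) :
    |subdivide^[k + l] h (c (k + l)) - subdivide^[k] h (c k)| ≤ L / 3 ^ k := by
  have hL0 : 0 ≤ L := (abs_nonneg _).trans (hL 0 isCenter_zero 0)
  have h1 := (abs_iterate_subdivide_sub_le (hc.shift k)
    (fun j => abs_iterate_subdivide_add_sub_le hL k _ (hc.isCenter k) j) l).2
  simp only [← Function.iterate_add_apply, add_zero, add_comm l k] at h1
  refine h1.trans ?_
  have h2 : (0 : ℝ) ≤ 1 / 3 ^ l := by positivity
  have h3 : 0 ≤ L / 3 ^ k := by positivity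
  nlinarith

/-- The extension to `X` of a function `h` on the vertices of level `N`: affine along edges
and constant on the branches. -/
def extend (N : ℕ) (h : ℤ × ℤ → ℝ) (x : ℂ) : ℝ :=
  open Classical in if hx : x ∈ X then
    limUnder atTop fun k => subdivide^[k] h ((exists_chain hx N).choose k) else 0

theorem tendsto_extend (hL : ∀ c, IsCenter c → ∀ j, |h (c + unit j) - h c| ≤ L) (N : ℕ) {x : ℂ}
    (hx : x ∈ X) : ∃ c, IsChain c ∧ (∀ k, x ∈ cell (N + k) (c k)) ∧
      Tendsto (fun k => subdivide^[k] h (c k)) atTop (𝓝 (extend N h x)) := by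
  obtain ⟨hc, hxc⟩ := (exists_chain hx N).choose_spec
  refine ⟨_, hc, hxc, ?_⟩
  rw [extend, dif_pos hx]
  refine CauchySeq.tendsto_limUnder ?_
  have hL0 : 0 ≤ L := (abs_nonneg _).trans (hL 0 isCenter_zero 0)
  refine cauchySeq_of_le_tendsto_0 (fun k => 2 * (L / 3 ^ k)) (fun m n k hm hn => ?_) ?_
  · obtain ⟨m, rfl⟩ := Nat.exists_eq_add_of_le hm
    obtain ⟨n, rfl⟩ := Nat.exists_eq_add_of_le hn
    have h1 := abs_chain_sub_le hL hc k m
    have h2 := abs_chain_sub_le hL hc k n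
    rw [Real.dist_eq]
    rw [abs_le] at *
    constructor <;> linarith
  · have h3 := (tendsto_pow_atTop_nhds_zero_of_lt_one (r := (3 : ℝ)⁻¹) (by norm_num)
      (by norm_num)).const_mul (2 * L)
    rw [mul_zero] at h3
    refine h3.congr fun k => ?_
    rw [inv_pow]; ring

/-- The chain chosen for `x` may run through a neighbour of the cell `c`, which shares a corner with
it. One error comes from the limit along the chain, two from the steps between centers and that
corner, so the choice of chain does not matter. -/
theorem abs_extend_sub_le (hL : ∀ c, IsCenter c → ∀ j, |h (c + unit j) - h c| ≤ L) (N k : ℕ)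
    {c : ℤ × ℤ} (hc : IsCenter c) {x : ℂ} (hx : x ∈ cell (N + k) c) :
    |extend N h x - subdivide^[k] h c| ≤ 3 * (L / 3 ^ k) := by
  obtain ⟨d, hd, hxd, hlim⟩ := tendsto_extend hL N (cell_subset_X hc _ hx)
  have h1 : |extend N h x - subdivide^[k] h (d k)| ≤ L / 3 ^ k := by
    refine le_of_tendsto ((hlim.comp (tendsto_add_atTop_nat k)).sub_const _).abs
      (Eventually.of_forall fun l => ?_)
    have := abs_chain_sub_le hL hd k l
    rwa [add_comm k l] at this
  obtain ⟨j, hj⟩ := eq_or_eq_of_mem_cell hc (hd.isCenter k) hx (hxd k)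
  have h2 := abs_iterate_subdivide_add_sub_le hL k c hc j
  have h3 := abs_iterate_subdivide_add_sub_le hL k (d k) (hd.isCenter k) (opp j)
  have e : d k + unit (opp j) = c + unit j := by rw [hj, unit_opp]; module
  rw [e] at h3
  rw [abs_le] at *
  constructor <;> linarith

theorem extend_eq_zero (hL : ∀ c, IsCenter c → ∀ j, |h (c + unit j) - h c| ≤ L) {N : ℕ} {x : ℂ}
    (hx : x ∈ X) (h0 : ∀ c, IsCenter c → x ∈ cell N c → ∀ j, h (c + unit j) = 0) :
    extend N h x = 0 := by
  obtain ⟨d, hd, hxd, hlim⟩ := tendsto_extend hL N hx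
  have h1 := h0 (d 0) (hd.isCenter 0) (hxd 0)
  have h2 : h (d 0) = 0 := by simpa [unit_zero] using h1 0
  refine tendsto_nhds_unique hlim (tendsto_const_nhds.congr fun k => ?_)
  have := (abs_iterate_subdivide_sub_le hd (h := h) (L := 0) (fun j => by simp [h1 j, h2]) k).2
  rw [zero_mul, h2, sub_zero] at this
  exact (abs_nonpos_iff.mp this).symm

theorem finite_norm_emb_le (n : ℕ) (R : ℝ) : {p : ℤ × ℤ | ‖emb n p‖ ≤ R}.Finite := by
  obtain ⟨B, hB⟩ := exists_nat_ge (R * 3 ^ n)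
  refine ((Set.finite_Icc (-(B : ℤ)) B).prod (Set.finite_Icc (-(B : ℤ)) B)).subset fun p hp => ?_
  have h1 : ‖plane p.1 p.2‖ ≤ B := by
    have : ‖emb n p‖ ≤ R := hp
    rw [emb, norm_mul, norm_inv, norm_pow, Complex.norm_ofNat, inv_mul_le_iff₀ (by positivity)]
      at this
    linarith
  have h2 := normSq_plane p.1 p.2
  have h3 : (p.1 ^ 2 + p.2 ^ 2 : ℤ) ≤ (B : ℤ) ^ 2 := by
    have : (p.1 ^ 2 + p.2 ^ 2 : ℝ) ≤ (B : ℝ) ^ 2 := by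
      rw [← h2]; exact pow_le_pow_left₀ (norm_nonneg _) h1 2
    exact_mod_cast this
  have hB0 : (0 : ℤ) ≤ B := by positivity
  have h4 := abs_le_of_sq_le_sq' (show p.1 ^ 2 ≤ (B : ℤ) ^ 2 by nlinarith [sq_nonneg p.2]) hB0
  have h5 := abs_le_of_sq_le_sq' (show p.2 ^ 2 ≤ (B : ℤ) ^ 2 by nlinarith [sq_nonneg p.1]) hB0
  exact ⟨h4, h5⟩

/-- Points of `X` close to `x` share a cell with `x`. -/
theorem eventually_mem_cell {x : ℂ} (n : ℕ) :
    ∀ᶠ y in 𝓝[X] x, ∃ c, IsCenter c ∧ x ∈ cell n c ∧ y ∈ cell n c := by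
  -- Only finitely many cells come near `x`, so those not containing `x` stay away from it.
  set S : Set (ℤ × ℤ) := {p | ‖emb n p‖ ≤ ‖x‖ + 2 ∧ x ∉ cell n p}
  have hS : S.Finite := (finite_norm_emb_le n (‖x‖ + 2)).subset fun p hp => hp.1
  have hcl : IsClosed (⋃ p ∈ S, cell n p) := hS.isClosed_biUnion fun p _ => (isCompact_cell n p).isClosed
  have hx : x ∉ ⋃ p ∈ S, cell n p := by
    simp only [Set.mem_iUnion, not_exists]
    exact fun p hp hxp => hp.2 hxp
  filter_upwards [self_mem_nhdsWithin, nhdsWithin_le_nhds (hcl.isOpen_compl.mem_nhds hx),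
    nhdsWithin_le_nhds (Metric.ball_mem_nhds x one_pos)] with y hyX hyS hyb
  obtain ⟨c, hc, hyc⟩ := exists_cell hyX n
  refine ⟨c, hc, ?_, hyc⟩
  by_contra hxc
  refine hyS (Set.mem_biUnion (show c ∈ S from ⟨?_, hxc⟩) hyc)
  have h1 := dist_le_of_mem_cell hyc
  have h2 : ((3 : ℝ) ^ n)⁻¹ ≤ 1 := inv_le_one_of_one_le₀ (one_le_pow₀ (by norm_num))
  have h3 : dist y x < 1 := hyb
  have h4 := dist_triangle (emb n c) y x
  rw [dist_comm] at h1
  have h5 : ‖emb n c‖ ≤ ‖emb n c - x‖ + ‖x‖ := norm_le_norm_sub_add _ _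
  rw [← dist_eq_norm] at h5
  linarith

theorem tendsto_const_div_pow (C : ℝ) : Tendsto (fun k : ℕ => C / 3 ^ k) atTop (𝓝 0) := by
  have h3 := (tendsto_pow_atTop_nhds_zero_of_lt_one (r := (3 : ℝ)⁻¹) (by norm_num)
    (by norm_num)).const_mul C
  rw [mul_zero] at h3
  exact h3.congr fun k => by rw [inv_pow]; rfl

theorem continuousOn_extend (hL : ∀ c, IsCenter c → ∀ j, |h (c + unit j) - h c| ≤ L) (N : ℕ) :
    ContinuousOn (extend N h) X := by
  intro x hx
  rw [ContinuousWithinAt, Metric.tendsto_nhds]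
  intro ε hε
  obtain ⟨k, hk⟩ := ((tendsto_const_div_pow (6 * L)).eventually_lt_const hε).exists
  filter_upwards [eventually_mem_cell (x := x) (N + k)] with y ⟨c, hc, hxc, hyc⟩
  have h1 := abs_extend_sub_le hL N k hc hxc
  have h2 := abs_extend_sub_le hL N k hc hyc
  rw [Real.dist_eq]
  refine lt_of_le_of_lt ?_ hk
  rw [mul_div_assoc, abs_le] at *
  constructor <;> linarith

/-- A corner remains the corner in direction `j` of an ever smaller cell. The case `j = 0` covers
centers. -/
theorem iterate_subdivide_pow_smul {c : ℤ × ℤ} (hc : IsCenter c) (j : Fin 5) (l : ℕ) :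
    IsCenter ((3 ^ l : ℤ) • (c + unit j) - unit j) ∧ ∀ f,
      subdivide^[l] f ((3 ^ l : ℤ) • (c + unit j)) = f (c + unit j) := by
  induction l with
  | zero => simpa using hc
  | succ l ih =>
    obtain ⟨h1, h2⟩ := ih
    have e : (3 ^ (l + 1) : ℤ) • (c + unit j) - unit j =
        (3 : ℤ) • ((3 ^ l : ℤ) • (c + unit j) - unit j) + (2 : ℤ) • unit j := by
      rw [pow_succ]; module
    refine ⟨by rw [e]; exact h1.step j, fun f => ?_⟩
    rw [Function.iterate_succ_apply']
    have e2 : (3 ^ (l + 1) : ℤ) • (c + unit j) =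
        (3 : ℤ) • (((3 ^ l : ℤ) • (c + unit j) - unit j) + unit j) := by
      rw [pow_succ]; module
    rw [e2, subdivide_corner h1, sub_add_cancel, h2]

theorem extend_emb (hL : ∀ c, IsCenter c → ∀ j, |h (c + unit j) - h c| ≤ L) (N k : ℕ)
    {a b : ℤ × ℤ} (hab : latticeGraph.Adj a b) :
    extend N h (emb (N + k) a) = subdivide^[k] h a := by
  obtain ⟨c, j, hc, rfl⟩ : ∃ c j, IsCenter c ∧ a = c + unit j := by
    obtain ⟨c, j, hc, hj, ⟨rfl, rfl⟩ | ⟨rfl, rfl⟩⟩ := adj_iff_exists_center.mp hab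
    · exact ⟨a, 0, hc, by rw [unit_zero, add_zero]⟩
    · exact ⟨b, j, hc, rfl⟩
  have hlim := (tendsto_const_div_pow (4 * L)).comp (tendsto_add_atTop_nat k)
  -- Viewed at a deeper level, the vertex lies in a tiny cell: `abs_extend_sub_le` costs `3` and the
  -- step from corner to center costs `1`, in units of `L / 3 ^ (l + k)`.
  have hle : ∀ l : ℕ, |extend N h (emb (N + k) (c + unit j)) - subdivide^[k] h (c + unit j)| ≤
      4 * L / 3 ^ (l + k) := fun l => by
    obtain ⟨h1, h2⟩ := iterate_subdivide_pow_smul hc j l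
    have e : emb (N + k) (c + unit j) = emb (N + (l + k)) ((3 ^ l : ℤ) • (c + unit j)) := by
      rw [emb_zsmul, emb, emb, show N + (l + k) = N + k + l by ring, pow_add _ (N + k)]
      push_cast
      field_simp
    have hmem := emb_mem_cell (N + (l + k)) ((3 ^ l : ℤ) • (c + unit j) - unit j) j
    rw [sub_add_cancel, ← e] at hmem
    have h3 := abs_extend_sub_le hL N (l + k) h1 hmem
    have h4 := abs_iterate_subdivide_add_sub_le hL (l + k) _ h1 j
    rw [sub_add_cancel, Function.iterate_add_apply, h2] at h4
    rw [Function.iterate_add_apply] at h3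
    rw [mul_div_assoc, abs_le] at *
    constructor <;> linarith
  have h0 := ge_of_tendsto' hlim hle
  exact sub_eq_zero.mp (abs_nonpos_iff.mp h0)

end Extension

/-! ### The extension has a step function as weak gradient -/

section EdgeGradient

/-- The edges, oriented away from the center, on which `h` is not constant. -/
def activeEdges (h : ℤ × ℤ → ℝ) : Set ((ℤ × ℤ) × (ℤ × ℤ)) :=
  {e | latticeGraph.Adj e.1 e.2 ∧ latticeDist e.1 < latticeDist e.2 ∧ h e.1 ≠ h e.2}

theorem finite_activeEdges {h : ℤ × ℤ → ℝ} (hh : h.support.Finite) : (activeEdges h).Finite := by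
  have h1 : (⋃ j : Fin 5, (fun a : ℤ × ℤ => (a, a + unit j)) '' h.support).Finite :=
    Set.finite_iUnion fun j => hh.image _
  have h2 : (⋃ j : Fin 5, (fun a : ℤ × ℤ => (a + unit j, a)) '' h.support).Finite :=
    Set.finite_iUnion fun j => hh.image _
  refine (h1.union h2).subset ?_
  rintro ⟨a, b⟩ ⟨hab, -, hne⟩
  simp only at hab hne
  by_cases ha : h a = 0
  · obtain ⟨j, rfl⟩ := exists_eq_add_unit hab.symm
    exact Or.inr (Set.mem_iUnion.mpr ⟨j, b, fun hb => hne (ha.trans hb.symm), rfl⟩)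
  · obtain ⟨j, rfl⟩ := exists_eq_add_unit hab
    exact Or.inl (Set.mem_iUnion.mpr ⟨j, a, ha, rfl⟩)

/-- The gradient of the extension of `h`: the slope of `h` on each edge of level `N`, and zero
elsewhere. -/
def edgeGrad (N : ℕ) {h : ℤ × ℤ → ℝ} (hh : h.support.Finite) (x : ℂ) : ℝ :=
  ∑ e ∈ (finite_activeEdges hh).toFinset,
    (segment ℝ (emb N e.1) (emb N e.2)).indicator (fun _ => 3 ^ N * (h e.2 - h e.1)) x

variable {h : ℤ × ℤ → ℝ} {L : ℝ} (hh : h.support.Finite)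

theorem memLp_edgeGrad (N : ℕ) : MemLp (edgeGrad N hh) 2 ν := by
  refine memLp_finsetSum _ fun e he => memLp_indicator_const 2 (measurableSet_segment _ _) _
    (Or.inr (ν_segment_ne_top ?_))
  rw [Set.Finite.mem_toFinset] at he
  exact he.1

theorem exists_edge_mem_of_le {n : ℕ} {a b : ℤ × ℤ} (hab : latticeGraph.Adj a b) {x : ℂ}
    (hx : x ∈ segment ℝ (emb n a) (emb n b)) (k : ℕ) : ∃ a' b', latticeGraph.Adj a' b' ∧
      x ∈ segment ℝ (emb (n + k) a') (emb (n + k) b') := by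
  induction k with
  | zero => exact ⟨a, b, hab, hx⟩
  | succ k ih =>
    obtain ⟨a', b', h1, h2⟩ := ih
    obtain ⟨a'', b'', h3, h4⟩ := exists_third_mem h2
    exact ⟨a'', b'', h3.adj h1, h4⟩

theorem edgeGrad_ae_eq_zero_of_not_onAxis (N k : ℕ) {a b : ℤ × ℤ} (hab : latticeGraph.Adj a b)
    (hax : ¬ OnAxis a b) :
    ∀ᵐ x ∂(ν.restrict (segment ℝ (emb (N + k + 1) a) (emb (N + k + 1) b))),
      edgeGrad N hh x = 0 := by
  filter_upwards [ae_edge_eq hab] with x hx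
  refine Finset.sum_eq_zero fun e he => Set.indicator_of_notMem (fun hxe => ?_) _
  rw [Set.Finite.mem_toFinset] at he
  obtain ⟨a', b', h1, h2⟩ := exists_edge_mem_of_le he.1 hxe k
  obtain ⟨a'', b'', h3, h4⟩ := exists_third_mem h2
  have h5 := h3.onAxis h1
  rcases hx.2 a'' b'' (h3.adj h1) h4 with ⟨rfl, rfl⟩ | ⟨rfl, rfl⟩
  · exact hax h5
  · exact hax h5.symm

/-- Induction on `k`. On a third of an old edge the increment is divided by `3` while the prefactor
triples; on a new branch both sides vanish, as the branch meets older edges in a null set only. -/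
theorem edgeGrad_ae_eq (N k : ℕ) : ∀ {a b : ℤ × ℤ}, latticeGraph.Adj a b →
    latticeDist a < latticeDist b →
    ∀ᵐ x ∂(ν.restrict (segment ℝ (emb (N + k) a) (emb (N + k) b))),
      edgeGrad N hh x = 3 ^ (N + k) * (subdivide^[k] h b - subdivide^[k] h a) := by
  induction k with
  | zero =>
    intro a b hab hlt
    filter_upwards [ae_edge_eq hab] with x hx
    rw [edgeGrad, Finset.sum_eq_single (a, b)]
    · exact Set.indicator_of_mem hx.1 _
    · rintro ⟨a', b'⟩ he hne
      refine Set.indicator_of_notMem (fun hxe => ?_) _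
      rw [Set.Finite.mem_toFinset] at he
      rcases hx.2 a' b' he.1 hxe with ⟨rfl, rfl⟩ | ⟨rfl, rfl⟩
      · exact hne rfl
      · exact he.2.1.not_gt hlt
    · intro he
      have h0 : h a = h b := by
        by_contra hne
        exact he ((Set.Finite.mem_toFinset _).mpr ⟨hab, hlt, hne⟩)
      simp [h0]
  | succ k ih =>
    intro a' b' hab hlt
    rw [Function.iterate_succ_apply']
    rcases isThird_or_branch hab with ⟨a, b, hab₀, hth⟩ | ⟨hax, hbr⟩
    · have h1 := ae_mono (Measure.restrict_mono (hth.segment_subset (N + k)) le_rfl)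
        (ih hab₀ (hth.lt hab₀ hlt))
      filter_upwards [h1] with x hx
      rw [hx, hth.subdivide_sub hab₀, ← add_assoc, pow_succ]
      ring
    · rw [hbr, sub_self, mul_zero]
      exact edgeGrad_ae_eq_zero_of_not_onAxis hh N k hab hax

theorem integrableOn_edgeGrad (N : ℕ) {n : ℕ} {a b : ℤ × ℤ} (hab : latticeGraph.Adj a b) :
    IntegrableOn (edgeGrad N hh) (segment ℝ (emb n a) (emb n b)) ν :=
  (integrableOn_segment ((memLp_edgeGrad hh N).toLp _) hab).congr
    (ae_restrict_of_ae (memLp_edgeGrad hh N).coeFn_toLp)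

theorem setIntegral_edgeGrad_of_le (hL : ∀ c, IsCenter c → ∀ j, |h (c + unit j) - h c| ≤ L)
    (N k : ℕ) {a b : ℤ × ℤ} (hab : latticeGraph.Adj a b) (hlt : latticeDist a < latticeDist b) :
    ∫ x in segment ℝ (emb (N + k) a) (emb (N + k) b), edgeGrad N hh x ∂ν =
      extend N h (emb (N + k) b) - extend N h (emb (N + k) a) := by
  rw [integral_congr_ae (edgeGrad_ae_eq hh N k hab hlt), setIntegral_const, Measure.real,
    ν_segment hab, ENNReal.toReal_ofReal (by positivity), extend_emb hL N k hab,
    extend_emb hL N k hab.symm, smul_eq_mul, inv_mul_cancel_left₀ (by positivity)]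

theorem setIntegral_edgeGrad (hL : ∀ c, IsCenter c → ∀ j, |h (c + unit j) - h c| ≤ L) (N n : ℕ) :
    ∀ {a b : ℤ × ℤ}, latticeGraph.Adj a b → latticeDist a < latticeDist b →
    ∫ x in segment ℝ (emb n a) (emb n b), edgeGrad N hh x ∂ν =
      extend N h (emb n b) - extend N h (emb n a) := by
  rcases le_total N n with hn | hn
  · obtain ⟨k, rfl⟩ := Nat.exists_eq_add_of_le hn
    exact setIntegral_edgeGrad_of_le hh hL N k
  -- Levels coarser than `N`: the identity telescopes over the three parts of an edge, whose
  -- orientations agree with that of the edge.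
  · induction hn using Nat.decreasingInduction with
    | self => exact setIntegral_edgeGrad_of_le hh hL N 0
    | of_succ n _ ih =>
      intro a b hab hlt
      obtain ⟨h1, h2, h3⟩ := latticeGraph_adj_thirds hab
      obtain ⟨l1, l2, l3⟩ := latticeDist_thirds hab hlt
      rw [setIntegral_thirds hab (integrableOn_edgeGrad hh N hab), ih h1 l1, ih h2 l2, ih h3 l3,
        emb_succ, emb_succ]
      ring

theorem isWeakGradient_extend (hL : ∀ c, IsCenter c → ∀ j, |h (c + unit j) - h c| ≤ L) (N : ℕ) :
    IsWeakGradient (extend N h) ((memLp_edgeGrad hh N).toLp _) := by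
  refine ⟨Lp.aestronglyMeasurable _, fun n u v huv => ?_, fun n u v huv hlt => ?_⟩
  · obtain ⟨a, b, hab, rfl, rfl⟩ := exists_of_graph_adj huv
    exact integrableOn_segment _ hab
  · obtain ⟨a, b, hab, rfl, rfl⟩ := exists_of_graph_adj huv
    rw [integral_congr_ae (ae_restrict_of_ae (memLp_edgeGrad hh N).coeFn_toLp),
      setIntegral_edgeGrad hh hL N n hab ((distCenter_lt_iff n hab).mp hlt)]

end EdgeGradient

/-! ### Density of the domain of the gradient -/

section Density

variable {φ : ℂ → ℝ} {δ : ℝ} {N : ℕ}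

theorem ae_mem_X : ∀ᵐ x ∂μ, x ∈ X := mem_ae_iff.mpr μ_compl_X

theorem abs_sub_le_of_modulus (hδ : ∀ x y, dist x y ≤ ((3 : ℝ) ^ N)⁻¹ → |φ x - φ y| ≤ δ) :
    ∀ c, IsCenter c → ∀ j, |φ (emb N (c + unit j)) - φ (emb N c)| ≤ δ :=
  fun c _ j => hδ _ _ (dist_le_of_mem_cell (emb_mem_cell N c j))

theorem abs_extend_sub_self_le (hδ : ∀ x y, dist x y ≤ ((3 : ℝ) ^ N)⁻¹ → |φ x - φ y| ≤ δ) {x : ℂ}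
    (hx : x ∈ X) : |extend N (fun p => φ (emb N p)) x - φ x| ≤ 4 * δ := by
  obtain ⟨c, hc, hxc⟩ := exists_cell hx N
  have h1 := abs_extend_sub_le (h := fun p => φ (emb N p)) (abs_sub_le_of_modulus hδ) N 0 hc hxc
  have h2 := hδ x (emb N c) (dist_le_of_mem_cell hxc)
  simp only [Function.iterate_zero, id_eq, pow_zero, div_one] at h1
  rw [abs_le] at *
  constructor <;> linarith

/-- All vertices of a cell containing `x` are within distance `2` of `x`, so the vertex data vanish
there. -/
theorem extend_sub_self_eq_zero (hδ : ∀ x y, dist x y ≤ ((3 : ℝ) ^ N)⁻¹ → |φ x - φ y| ≤ δ) {R : ℝ}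
    (hR : ∀ x, R < ‖x‖ → φ x = 0) {x : ℂ} (hx : x ∈ X) (hxR : R + 2 < ‖x‖) :
    extend N (fun p => φ (emb N p)) x - φ x = 0 := by
  rw [hR x (by linarith), sub_zero]
  refine extend_eq_zero (h := fun p => φ (emb N p)) (abs_sub_le_of_modulus hδ) hx fun c _ hxc j => hR _ ?_
  have h1 := dist_le_of_mem_cell hxc
  have h2 := dist_le_of_mem_cell (emb_mem_cell N c j)
  have h3 : ((3 : ℝ) ^ N)⁻¹ ≤ 1 := inv_le_one_of_one_le₀ (one_le_pow₀ (by norm_num))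
  have h4 := dist_triangle_right x (emb N (c + unit j)) (emb N c)
  have h5 : ‖x‖ ≤ ‖x - emb N (c + unit j)‖ + ‖emb N (c + unit j)‖ := norm_le_norm_sub_add _ _
  rw [← dist_eq_norm] at h5
  linarith

theorem eLpNorm_extend_sub_le (hδ : ∀ x y, dist x y ≤ ((3 : ℝ) ^ N)⁻¹ → |φ x - φ y| ≤ δ) {R : ℝ}
    (hR : ∀ x, R < ‖x‖ → φ x = 0) {m : ℕ} (hm : R + 2 < 3 ^ m) :
    eLpNorm (extend N (fun p => φ (emb N p)) - φ) 2 μ ≤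
      ENNReal.ofReal (4 * δ) * μ (Metric.ball 0 (3 ^ m)) ^ (1 / 2 : ℝ) := by
  have hδ0 : 0 ≤ δ := (abs_nonneg _).trans (hδ 0 0 (by rw [dist_self]; positivity))
  have h1 := eLpNorm_indicator_const (μ := μ) (p := 2) (c := 4 * δ)
    (Metric.isOpen_ball (x := (0 : ℂ)) (ε := 3 ^ m)).measurableSet (by norm_num) (by norm_num)
  rw [Real.enorm_eq_ofReal (by positivity), ENNReal.toReal_ofNat] at h1
  rw [← h1]
  refine eLpNorm_mono_ae ?_
  filter_upwards [ae_mem_X] with x hx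
  by_cases hxm : x ∈ Metric.ball (0 : ℂ) (3 ^ m)
  · rw [Set.indicator_of_mem hxm, Real.norm_of_nonneg (r := 4 * δ) (by positivity)]
    exact abs_extend_sub_self_le hδ hx
  · rw [mem_ball_zero_iff, not_lt] at hxm
    rw [Pi.sub_apply, extend_sub_self_eq_zero hδ hR hx (by linarith), norm_zero]
    positivity

theorem aestronglyMeasurable_of_continuousOn (hφ : ContinuousOn φ X) : AEStronglyMeasurable φ μ := by
  have := hφ.aestronglyMeasurable (μ := μ) measurableSet_X
  rwa [Measure.restrict_eq_self_of_ae_mem ae_mem_X] at this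

/-- Approximate `f` by a continuous `φ` of compact support, then `φ` by the extension of its values
at the vertices of level `N`. The latter error is uniformly small by uniform continuity and lives in
a fixed ball of finite measure. -/
theorem dense_grad_domain : Dense (grad.domain : Set (Lp ℝ 2 μ)) := by
  rw [Metric.dense_iff]
  intro f ε hε
  obtain ⟨φ, hcs, hfφ, hφ, -⟩ := (Lp.memLp f).exists_hasCompactSupport_eLpNorm_sub_le
    (by norm_num) (ε := ENNReal.ofReal (ε / 4)) (by simpa using hε)
  obtain ⟨R, hR⟩ : ∃ R : ℝ, ∀ x, R < ‖x‖ → φ x = 0 := by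
    obtain ⟨R, hR⟩ := hcs.isCompact.isBounded.exists_norm_le
    refine ⟨R, fun x hx => ?_⟩
    by_contra h0
    exact hx.not_ge (hR x (subset_tsupport _ h0))
  obtain ⟨m, hm⟩ := pow_unbounded_of_one_lt (R + 2) (show (1 : ℝ) < 3 by norm_num)
  set B := μ (Metric.ball 0 (3 ^ m)) ^ (1 / 2 : ℝ) with hB
  have hBtop : B ≠ ⊤ := (ENNReal.rpow_lt_top_of_nonneg (by norm_num) (μ_ball_lt_top m).ne).ne
  -- Chosen so that `4 * δ * B ≤ ε / 4`, where `4 * δ` is the uniform error of the extension.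
  set δ := ε / (16 * (B.toReal + 1)) with hδ
  have hB0 : 0 ≤ B.toReal := ENNReal.toReal_nonneg
  have hδ0 : 0 < δ := by positivity
  obtain ⟨η, hη, huc⟩ := Metric.uniformContinuous_iff.mp
    (hcs.uniformContinuous_of_continuous hφ) δ hδ0
  obtain ⟨N, hN⟩ := ((tendsto_const_div_pow 1).eventually_lt_const hη).exists
  rw [one_div] at hN
  have hmod : ∀ x y, dist x y ≤ ((3 : ℝ) ^ N)⁻¹ → |φ x - φ y| ≤ δ := fun x y hxy =>
    (huc (hxy.trans_lt hN)).le
  set h : ℤ × ℤ → ℝ := fun p => φ (emb N p) with hh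
  have hfin : h.support.Finite := (finite_norm_emb_le N R).subset fun p hp => by
    by_contra hcon
    exact hp (hR _ (not_le.mp hcon))
  have hcont := continuousOn_extend (h := h) (abs_sub_le_of_modulus hmod) N
  have hclose : eLpNorm (φ - extend N h) 2 μ ≤ ENNReal.ofReal (ε / 4) := by
    rw [eLpNorm_sub_comm]
    refine (eLpNorm_extend_sub_le hmod hR hm).trans ?_
    rw [← hB, ← ENNReal.ofReal_toReal hBtop, ← ENNReal.ofReal_mul (by positivity)]
    refine ENNReal.ofReal_le_ofReal ?_
    rw [hδ]
    field_simp
    nlinarith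
  have hmeas := aestronglyMeasurable_of_continuousOn hcont
  have hdist : eLpNorm (⇑f - extend N h) 2 μ < ENNReal.ofReal ε := by
    have e : ⇑f - extend N h = (⇑f - φ) + (φ - extend N h) := by abel
    rw [e]
    refine (eLpNorm_add_le ((Lp.aestronglyMeasurable f).sub hφ.aestronglyMeasurable)
      (hφ.aestronglyMeasurable.sub hmeas) (by norm_num)).trans_lt ?_
    refine (add_le_add hfφ hclose).trans_lt ?_
    rw [← ENNReal.ofReal_add (by positivity) (by positivity),
      ENNReal.ofReal_lt_ofReal_iff hε]
    linarith
  have hmem : MemLp (extend N h) 2 μ := by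
    have h1 : MemLp (⇑f - extend N h) 2 μ :=
      ⟨(Lp.aestronglyMeasurable f).sub hmeas, hdist.trans ENNReal.ofReal_lt_top⟩
    have := (Lp.memLp f).sub h1
    rwa [sub_sub_cancel] at this
  refine ⟨hmem.toLp, ?_, ?_⟩
  · rw [Metric.mem_ball, dist_comm, ← edist_lt_ofReal, Lp.edist_def]
    refine (eLpNorm_congr_ae ?_).trans_lt hdist
    exact (EventuallyEq.refl _ _).sub hmem.coeFn_toLp
  · have : (hmem.toLp, (memLp_edgeGrad hfin N).toLp) ∈ grad.graph := by
      rw [grad_graph]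
      exact ⟨_, hcont, hmem.coeFn_toLp.symm,
        isWeakGradient_extend hfin (abs_sub_le_of_modulus hmod) N⟩
    exact LinearPMap.mem_domain_of_mem_graph this

theorem isClosed_grad_graph : IsClosed (grad.graph : Set (Lp ℝ 2 μ × Lp ℝ 2 ν)) := by
  rw [grad_graph]
  exact isClosed_gradGraph

end Density

end Vicsek

end

theorem mainTheorem9 :
    (∃! P, Vicsek.IsSemigroupGeneratedBy Vicsek.laplacian P) ∧
    (∃! Q, Vicsek.IsSemigroupGeneratedBy Vicsek.hodgeLaplacian Q) ∧
    ∀ (f : MeasureTheory.Lp ℝ 2 Vicsek.μ) (hf : f ∈ Vicsek.W12) (t : NNReal),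
      ∃ h : Vicsek.heatSemigroup t f ∈ Vicsek.W12,
        Vicsek.grad ⟨Vicsek.heatSemigroup t f, h⟩ =
          Vicsek.hodgeSemigroup t (Vicsek.grad ⟨f, hf⟩) := by
  have hΔ := Vicsek.isMaxDissipative_formGenerator Vicsek.dense_grad_domain
    Vicsek.isClosed_grad_graph
  have hH := Vicsek.isMaxDissipative_neg_compOp_adjoint Vicsek.dense_grad_domain
    Vicsek.isClosed_grad_graph
  refine ⟨hΔ.existsUnique_semigroup, hH.existsUnique_semigroup, fun f hf t => ?_⟩
  -- Membership in the graph contains both claims: `P_t f` lies in the domain, and its gradient is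
  -- the given element.
  have key : (Vicsek.heatSemigroup t f, Vicsek.hodgeSemigroup t (Vicsek.grad ⟨f, hf⟩)) ∈
      Vicsek.grad.graph :=
    Vicsek.mem_graph_semigroup_apply Vicsek.dense_grad_domain Vicsek.isClosed_grad_graph
      hΔ.semigroup_spec hH.semigroup_spec t (Vicsek.grad.mem_graph ⟨f, hf⟩)
  have hmem : Vicsek.heatSemigroup t f ∈ Vicsek.W12 := LinearPMap.mem_domain_of_mem_graph key
  exact ⟨hmem, Vicsek.grad.mem_graph_snd_inj (Vicsek.grad.mem_graph ⟨_, hmem⟩) key rfl⟩
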